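/- Let $\mathrm{PS}=\{x_0,\dots,x_{n-1}\}$ be a finite set of propositional variables ($n$ is part of the input). An $\mathtt{NNF}$ circuit over $\mathrm{PS}$ is a finite rooted directed acyclic graph whose leaves are labeled with $\top$, $\bot$, $x$ or $\neg x$ ($x\in\mathrm{PS}$) and whose internal nodes are labeled with $\wedge$ or $\vee$, with arbitrarily many children; $\mathtt{DNNF}$ is the set of $\mathtt{NNF}$ circuits in which distinct children of a same $\wedge$-node never mention a common variable. A language is a class of $\mathtt{NNF}$ circuits. A weighted base is a finite family $\{(\phi_i,w_i)\mid 1\le i\le k\}$ of $\mathtt{NNF}$ circuits $\phi_i$ over $\mathrm{PS}$ with rational weights $w_i$ of arbitrary sign; it is linear (i.e. in $\mathcal L$) when each $\phi_i$ is a literal $x$ or $\neg x$ or a Boolean constant. An interpretation $\omega:\mathrm{PS}\to\{0,1\}$ has the score vector $(w_1\phi_1(\omega),\dots,w_k\phi_k(\omega))$. For $\oplus=\Sigma$, the value $f(\omega)$ is the sum of the scores; for $\oplus=\mathit{leximax}$, it is the score vector sorted in decreasing order, and values are compared lexicographically. An optimal solution of a circuit $\phi$ is a model of $\phi$ that minimizes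 $f$ among the models of $\phi$. For a language $L$ and a class $\mathcal F$ of weighted bases, $\mathrm{OPT}[L,\mathcal F,\oplus]$ is the problem of computing, given $\phi\in L$ and a weighted base in $\mathcal F$ over the same $\mathrm{PS}$, an optimal solution of $\phi$ when $\phi$ has a model, and "no solution" otherwise. It is in $\mathsf P$ when it is solved on these inputs by a deterministic Turing machine in time polynomial in the length of the input, where weights are written as reduced fractions in binary and circuits as lists of nodes. **Proposition.** For $\oplus=\Sigma$ and for $\oplus=\mathit{leximax}$, $\mathrm{OPT}[\mathtt{DNNF},\mathcal L,\oplus]$ is in $\mathsf P$. Consequently $\mathrm{OPT}[L,\mathcal L,\oplus]$ is in $\mathsf P$ for each subset $L$ of $\mathtt{DNNF}$, in particular for the following languages of the knowledge compilation map: $\mathtt{DNF}$, $\mathtt{IP}$, $\mathtt{MODS}$, $\mathtt{d\text{-}DNNF}$, $\mathtt{FBDD}$, $\mathtt{OBDD}$, $\mathtt{OBDD}_<$ (for every choice of a total order $<$ on each set of variables), $\mathtt{DNNF}_T$ (for every vtree $T$ over a set of variables), and the union $\mathtt{SDNNF}$ of the languages $\mathtt{DNNF}_T$. -/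

import Mathlib

namespace OptNNF

/-! ### NNF circuits -/

/-- The label of a node of an `NNF` circuit over the variables `x₀, …, xₙ₋₁`, whose nodes are
numbered by `Fin m`: a Boolean constant, a literal (`lit x true` is `x`, `lit x false` is `¬ x`),
or a conjunction / disjunction together with the children of the node. -/
inductive Node (n m : ℕ) : Type
  | const (b : Bool) : Node n m
  | lit (x : Fin n) (b : Bool) : Node n m
  | and (cs : List (Fin m)) : Node n m
  | or (cs : List (Fin m)) : Node n m

/-- The children of a node (leaves have none). -/
def Node.children {n m : ℕ} : Node n m → List (Fin m)
  | .const _ => []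
  | .lit _ _ => []
  | .and cs => cs
  | .or cs => cs

/-- Leaf nodes: constants and literals. -/
def Node.IsLeaf {n m : ℕ} : Node n m → Prop
  | .const _ => True
  | .lit _ _ => True
  | .and _ => False
  | .or _ => False

/-- An `NNF` circuit over the set of variables `PS = {x₀, …, xₙ₋₁}`: a rooted directed acyclic
graph, its leaves labeled with `⊤`, `⊥`, `x` or `¬ x`, its internal nodes with `∧` or `∨`.
The nodes are listed in a topological order (children before parents, as every finite
acyclic graph can be), so that the root is the last one. -/
structure NNF (n : ℕ) : Type where
  /-- the index of the last node: there are `last + 1` nodes -/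
  last : ℕ
  /-- the labels of the nodes -/
  node : Fin (last + 1) → Node n (last + 1)
  /-- acyclicity: arcs go from a node to nodes listed earlier -/
  topological : ∀ i, ∀ j ∈ (node i).children, j < i
  /-- there is at most one arc from a node to another one -/
  nodup : ∀ i, (node i).children.Nodup
  /-- a node labeled with `∧` or `∨` is internal, i.e. it has a child -/
  internal : ∀ i, (node i).IsLeaf ∨ (node i).children ≠ []
  /-- every node can be reached from the root -/
  rooted : ∀ i, Relation.ReflTransGen (fun a b => b ∈ (node a).children) (Fin.last last) i

/-- An interpretation of `x₀, …, xₙ₋₁`. -/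
abbrev Interp (n : ℕ) : Type := Fin n → Bool

namespace NNF

variable {n : ℕ}

/-- The root of a circuit. -/
def root (φ : NNF n) : Fin (φ.last + 1) := Fin.last φ.last

/-- `φ.Child i j`: there is an arc from node `i` to node `j`. -/
def Child (φ : NNF n) (i j : Fin (φ.last + 1)) : Prop := j ∈ (φ.node i).children

/-- `φ.SatAt ω i`: the subcircuit of `φ` rooted at node `i` evaluates to `1` under `ω`. -/
inductive SatAt (φ : NNF n) (ω : Interp n) : Fin (φ.last + 1) → Prop
  | const {i} (h : φ.node i = .const true) : SatAt φ ω i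
  | lit {i} {x : Fin n} {b : Bool} (h : φ.node i = .lit x b) (hx : ω x = b) : SatAt φ ω i
  | and {i} {cs} (h : φ.node i = .and cs) (hcs : ∀ j ∈ cs, SatAt φ ω j) : SatAt φ ω i
  | or {i} {cs} (h : φ.node i = .or cs) {j} (hj : j ∈ cs) (hs : SatAt φ ω j) : SatAt φ ω i

/-- `ω` is a model of `φ`. -/
def Sat (φ : NNF n) (ω : Interp n) : Prop := φ.SatAt ω φ.root

/-- `Vars(N)`: the variables labeling the leaves that can be reached from node `i`. -/
def varsAt (φ : NNF n) (i : Fin (φ.last + 1)) : Set (Fin n) :=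
  {x | ∃ j b, Relation.ReflTransGen φ.Child i j ∧ φ.node j = .lit x b}

/-- Decomposability: distinct children of a conjunction share no variable. -/
def Decomposable (φ : NNF n) : Prop :=
  ∀ i cs, φ.node i = .and cs →
    ∀ a ∈ cs, ∀ b ∈ cs, a ≠ b → Disjoint (φ.varsAt a) (φ.varsAt b)

/-- Determinism: distinct children of a disjunction are contradictory. -/
def Deterministic (φ : NNF n) : Prop :=
  ∀ i cs, φ.node i = .or cs →
    ∀ a ∈ cs, ∀ b ∈ cs, a ≠ b → ∀ ω, ¬ (φ.SatAt ω a ∧ φ.SatAt ω b)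

/-- Smoothness: the children of a disjunction mention the same variables. -/
def Smooth (φ : NNF n) : Prop :=
  ∀ i cs, φ.node i = .or cs → ∀ a ∈ cs, ∀ b ∈ cs, φ.varsAt a = φ.varsAt b

/-- Flatness: the height of the circuit is at most two. -/
def Flat (φ : NNF n) : Prop :=
  ¬ ∃ i j k, φ.Child φ.root i ∧ φ.Child i j ∧ φ.Child j k

/-- Simple conjunction: the children of each conjunction are leaves that share no variable. -/
def SimpleConjunction (φ : NNF n) : Prop :=
  ∀ i cs, φ.node i = .and cs →
    (∀ a ∈ cs, (φ.node a).IsLeaf) ∧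
      ∀ a ∈ cs, ∀ b ∈ cs, a ≠ b → Disjoint (φ.varsAt a) (φ.varsAt b)

/-- The terms of a circuit in `DNF`: the nodes other than disjunctions that are reached from the
root through disjunctions only. -/
def IsTermNode (φ : NNF n) (t : Fin (φ.last + 1)) : Prop :=
  (¬ ∃ cs, φ.node t = .or cs) ∧
    Relation.ReflTransGen (fun i j => ∃ cs, φ.node i = .or cs ∧ j ∈ cs) φ.root t

/-- `φ.Extends γ ω`: the interpretation `ω` extends the partial interpretation `γ`
(equivalently, it satisfies the consistent term `γ`). -/
def _root_.OptNNF.Extends (γ : Fin n → Option Bool) (ω : Interp n) : Prop :=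
  ∀ x b, γ x = some b → ω x = b

/-- The terms of the circuit are the prime implicants: every consistent term that entails `φ`
entails a term of `φ`, and no term of `φ` entails another one. -/
def PrimeImplicants (φ : NNF n) : Prop :=
  (∀ γ : Fin n → Option Bool, (∀ ω, Extends γ ω → φ.Sat ω) →
      ∃ t, φ.IsTermNode t ∧ ∀ ω, Extends γ ω → φ.SatAt ω t) ∧
    ∀ s t, φ.IsTermNode s → φ.IsTermNode t → s ≠ t → ∃ ω, φ.SatAt ω s ∧ ¬ φ.SatAt ω t

/-- Node `i` has the form `(x ∧ α) ∨ (¬ x ∧ β)`, where `α` and `β` are the nodes `a` and `b`. -/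
def IsBranch (φ : NNF n) (i : Fin (φ.last + 1)) (x : Fin n) (a b : Fin (φ.last + 1)) : Prop :=
  ∃ cs p q csp csq lp lq, φ.node i = .or cs ∧ cs.Perm [p, q] ∧
    φ.node p = .and csp ∧ csp.Perm [lp, a] ∧ φ.node lp = .lit x true ∧
    φ.node q = .and csq ∧ csq.Perm [lq, b] ∧ φ.node lq = .lit x false

/-- Decision nodes: constants, and nodes `(x ∧ α) ∨ (¬ x ∧ β)` with decision nodes `α`, `β`. -/
inductive IsDecision (φ : NNF n) : Fin (φ.last + 1) → Prop
  | const {i} {b : Bool} (h : φ.node i = .const b) : IsDecision φ i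
  | branch {i} {x : Fin n} {a b} (h : φ.IsBranch i x a b)
      (ha : IsDecision φ a) (hb : IsDecision φ b) : IsDecision φ i

/-- Ordering: the variable decided at a node precedes those decided at its proper descendants.
The order on the variables is given by their ranks. -/
def Ordered (rank : Equiv.Perm (Fin n)) (φ : NNF n) : Prop :=
  ∀ i x a b j y c d, φ.IsBranch i x a b → φ.IsBranch j y c d →
    Relation.TransGen φ.Child i j → rank x < rank y

/-- `φ` is a literal: `x`, `¬ x` or a Boolean constant. -/
def IsLiteral (φ : NNF n) : Prop :=
  (∃ b, φ.node φ.root = .const b) ∨ ∃ x b, φ.node φ.root = .lit x b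

end NNF

/-- Binary trees with leaves labeled in `V`. -/
inductive BTree (V : Type) : Type
  | leaf (v : V) : BTree V
  | node (l r : BTree V) : BTree V

namespace BTree

variable {V : Type}

/-- The labels of the leaves, from left to right. -/
def leaves : BTree V → List V
  | .leaf v => [v]
  | .node l r => l.leaves ++ r.leaves

/-- `t.Splits A B`: some internal node of `t` has all of `A` below its left child and all
of `B` below its right child. -/
def Splits : BTree V → Set V → Set V → Prop
  | .leaf _, _, _ => False
  | .node l r, A, B =>
      ((∀ v ∈ A, v ∈ l.leaves) ∧ (∀ v ∈ B, v ∈ r.leaves)) ∨ l.Splits A B ∨ r.Splits A B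

end BTree

/-- A vtree over `x₀, …, xₙ₋₁`: each variable labels exactly one leaf. -/
structure VTree (n : ℕ) : Type where
  tree : BTree (Fin n)
  nodup : tree.leaves.Nodup
  mem_leaves : ∀ x, x ∈ tree.leaves

/-- `φ` respects the vtree `T`: each conjunction has two children, whose variables lie below
the two children of some node of `T`. -/
def NNF.Respects {n : ℕ} (T : VTree n) (φ : NNF n) : Prop :=
  ∀ i cs, φ.node i = .and cs →
    ∃ a b, cs.Perm [a, b] ∧ T.tree.Splits (φ.varsAt a) (φ.varsAt b)

/-! ### Languages -/

/-- A language: for each number `n` of variables, a set of `NNF` circuits over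
`x₀, …, xₙ₋₁`. -/
abbrev Language : Type := ∀ n : ℕ, Set (NNF n)

def DNNF : Language := fun _ => {φ | φ.Decomposable}

def dDNNF : Language := fun _ => {φ | φ.Decomposable ∧ φ.Deterministic}

def DNF : Language := fun _ => {φ | φ.Flat ∧ φ.SimpleConjunction}

def IP : Language := fun n => {φ | φ ∈ DNF n ∧ φ.PrimeImplicants}

def MODS : Language := fun n => {φ | φ ∈ DNF n ∧ φ.Deterministic ∧ φ.Smooth}

def FBDD : Language := fun _ => {φ | φ.IsDecision φ.root ∧ φ.Decomposable}

/-- The language `OBDD_<`, for a total order `<` on each set of variables. -/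
def OBDDlt (rank : ∀ n, Equiv.Perm (Fin n)) : Language :=
  fun n => {φ | φ ∈ FBDD n ∧ φ.Ordered (rank n)}

/-- The language `OBDD`: the order on the variables is arbitrary. -/
def OBDD : Language := fun n => {φ | φ ∈ FBDD n ∧ ∃ rank, φ.Ordered rank}

/-- The language `DNNF_T`, for a set of variables `x₀, …, xₘ₋₁` and a vtree `T` over it. -/
def DNNFT {m : ℕ} (T : VTree m) : Language :=
  fun n => {φ | φ.Decomposable ∧ ∃ h : m = n, φ.Respects (h ▸ T)}

/-- The union `SDNNF` of the languages `DNNF_T`. -/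
def SDNNF : Language := fun n => {φ | φ.Decomposable ∧ ∃ T : VTree n, φ.Respects T}

/-! ### Weighted bases and optimal models -/

/-- A weighted base: a finite family of circuits with weights. -/
abbrev WeightedBase (n : ℕ) : Type := List (NNF n × ℚ)

/-- The linear representations `𝓛`: every formula of the weighted base is a literal. -/
def Linear : ∀ n : ℕ, Set (WeightedBase n) := fun _ => {B | ∀ p ∈ B, p.1.IsLiteral}

open Classical in
/-- The vector of scores `w₁ · φ₁(ω), …, wₖ · φₖ(ω)`. -/
noncomputable def scores {n : ℕ} (B : WeightedBase n) (ω : Interp n) : List ℚ :=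
  B.map fun p => p.2 * (if p.1.Sat ω then 1 else 0)

/-- The two aggregators. -/
inductive Aggregator : Type
  | sum : Aggregator
  | leximax : Aggregator

/-- `agg.Le s t`: aggregated by `agg`, the score vector `s` is at most `t`. For `leximax` the
vectors, which have the same length, are sorted in decreasing order and compared in the
lexicographic order, which is the order `≤` on lists. -/
def Aggregator.Le : Aggregator → List ℚ → List ℚ → Prop
  | .sum, s, t => s.sum ≤ t.sum
  | .leximax, s, t => s.insertionSort (· ≥ ·) ≤ t.insertionSort (· ≥ ·)

/-- `ω` is an optimal solution: a model of `φ` that minimizes the objective function. -/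
def IsOptimal (agg : Aggregator) {n : ℕ} (φ : NNF n) (B : WeightedBase n) (ω : Interp n) : Prop :=
  φ.Sat ω ∧ ∀ ω', φ.Sat ω' → agg.Le (scores B ω) (scores B ω')

/-! ### Encodings -/

/-- An instance of the optimization problem. -/
structure Instance : Type where
  /-- the number of variables -/
  n : ℕ
  /-- the hard constraint -/
  hard : NNF n
  /-- the representation of the objective function -/
  base : WeightedBase n

/-- The input alphabet. -/
inductive Sym : Type
  | tick | sep | close
  | bit (b : Bool)
  | minus | slash
  | top | bot | pos | neg | and | or
  deriving DecidableEq, Fintype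

/-- Unary code, used for the number of variables (a complete assignment has that length), and for
the indices of variables and nodes, which are bounded by the numbers of variables and nodes. -/
def encodeIndex (k : ℕ) : List Sym := List.replicate k Sym.tick ++ [Sym.sep]

/-- Weights are written in binary: sign, numerator and denominator of the reduced fraction. -/
def encodeWeight (q : ℚ) : List Sym :=
  (if q.num < 0 then [Sym.minus] else []) ++
    (Computability.encodeNat q.num.natAbs).map Sym.bit ++ [Sym.slash] ++
    (Computability.encodeNat q.den).map Sym.bit ++ [Sym.sep]

def encodeNode {n m : ℕ} : Node n m → List Sym
  | .const true => [Sym.top]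
  | .const false => [Sym.bot]
  | .lit x true => Sym.pos :: encodeIndex x
  | .lit x false => Sym.neg :: encodeIndex x
  | .and cs => Sym.and :: (cs.flatMap fun j => encodeIndex j) ++ [Sym.close]
  | .or cs => Sym.or :: (cs.flatMap fun j => encodeIndex j) ++ [Sym.close]

/-- A circuit is written as the list of its nodes. -/
def encodeNNF {n : ℕ} (φ : NNF n) : List Sym :=
  ((List.finRange (φ.last + 1)).flatMap fun i => encodeNode (φ.node i)) ++ [Sym.close]

def encodeInstance (I : Instance) : List Sym :=
  encodeIndex I.n ++ encodeNNF I.hard ++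
    I.base.flatMap fun p => encodeNNF p.1 ++ encodeWeight p.2

/-- The output alphabet is `Bool`; `none` stands for "no solution". -/
def encodeAnswer : Option (List Bool) → List Bool
  | none => [false]
  | some l => true :: l

/-! ### The optimization problem -/

/-- The answer `r` is correct for `I`: it is an optimal solution, written as the list of the
values of `x₀, …, xₙ₋₁`, when a feasible solution exists, and "no solution" otherwise. -/
def IsAnswer (agg : Aggregator) (I : Instance) (r : Option (List Bool)) : Prop :=
  ((∃ ω, I.hard.Sat ω) → ∃ ω, IsOptimal agg I.hard I.base ω ∧ r = some (List.ofFn ω)) ∧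
    ((¬ ∃ ω, I.hard.Sat ω) → r = none)

/-- `OPT[L, F, ⊕]` is in `P`: some polynomial-time Turing machine maps every `φ` in `L` and every
weighted base in `F` to an optimal solution when a feasible solution exists, and to
"no solution" otherwise. -/
def OPTinP (L : Language) (F : ∀ n : ℕ, Set (WeightedBase n)) (agg : Aggregator) : Prop :=
  ∃ f : {I : Instance // I.hard ∈ L I.n ∧ I.base ∈ F I.n} → Option (List Bool),
    (∀ I, IsAnswer agg I.1 (f I)) ∧
      Nonempty (Turing.TM2ComputableInPolyTime
        (fun I : {I : Instance // I.hard ∈ L I.n ∧ I.base ∈ F I.n} => encodeInstance I.1)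
        encodeAnswer f)

end OptNNF

/-!
# Optimization over decomposable circuits with linear objective functions

An optimal model of a `DNNF` circuit is computed node by node. Both aggregators lead to an
objective function of the form `F ω = C + ∑ x, c x (ω x)`. For `Σ` this is immediate, since every
formula of a linear base is a literal or a constant (`exists_cost_eq`). For `leximax`, a score of
rank `r` among the possible scores is replaced by `K ^ r`, where `K` exceeds the number of scores;
then the sums of the new scores are ordered as the sorted vectors of the old ones are
(`leximax_le_iff`). Let `ω₀` be the interpretation that minimizes `F` over all interpretations. For
each node one stores the set of variables at which an optimal model of the node differs from `ω₀`,
which can be taken among the variables below the node. At a disjunction it is the set of the best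
child. At a conjunction it is the union of the sets of the children: since these have no common
variable, the deviations of `F` from its minimum add up (`OptOn.and`, `spec_root`). In this form no
variable set has to be computed, and the number of comparisons of sums of fractions at a node is at
most the number of its children.

Polynomial time is established on an intermediate level. Structured programs on a few stacks
(`Prog`) are translated into Turing machines with the same number of steps
(`Prog.Runs.steps`). Values are binary trees, written on the main stack in preorder, so that
an operation acts on the top of the stack and leaves alone what is below. The functions that such
programs compute in polynomial time, `PolyTime`, contain the projections and constants and are
closed under composition, pairing, case distinction, and iteration as long as the number of rounds
and the sizes of the intermediate values stay polynomial (`PolyTime.iterate`, `PolyTime.foldl`).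
Binary arithmetic and the algorithm itself are obtained from these closure properties
(`PolyTime.solveRev`), and only the bounds on sizes need an argument. Finally the word that encodes
an instance is shown to be read as intended (`solveItems_encodeInstance`).
-/

namespace OptNNF

/-! ### Stack programs -/

/-- The stacks of the machine: the input, a main stack on which values live, and three auxiliary
stacks, which are empty between two operations on values. -/
inductive Stk : Type
  | inp | main | aux | aux' | cnt
  deriving DecidableEq

instance : Fintype Stk where
  elems := {.inp, .main, .aux, .aux', .cnt}
  complete k := by cases k <;> decide

/-- The alphabets of the stacks. -/
abbrev Alph : Stk → Type
  | .inp => Sym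
  | .main => Bool
  | .aux => Bool
  | .aux' => Bool
  | .cnt => Bool

/-- The contents of the stacks. -/
abbrev Mem : Type := ∀ k, List (Alph k)

/-- Structured programs on the stacks. Tests look at the top of a stack (`none` if it is empty). -/
inductive Prog : Type
  | skip : Prog
  | push (k : Stk) (a : Alph k) : Prog
  | pop (k : Stk) : Prog
  | seq (p q : Prog) : Prog
  | ite (k : Stk) (c : Option (Alph k) → Bool) (p q : Prog) : Prog
  | loop (k : Stk) (c : Option (Alph k) → Bool) (p : Prog) : Prog

namespace Prog

/-- `p.Runs S t S'`: started with the stacks `S`, the program `p` stops after `t` steps with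
the stacks `S'`. -/
inductive Runs : Prog → Mem → ℕ → Mem → Prop
  | skip {S} : Runs .skip S 1 S
  | push {k a S} : Runs (.push k a) S 1 (Function.update S k (a :: S k))
  | pop {k S} : Runs (.pop k) S 1 (Function.update S k (S k).tail)
  | seq {p q S t S' t' S''} (hp : Runs p S t S') (hq : Runs q S' t' S'') :
      Runs (.seq p q) S (t + t') S''
  | iteTrue {k c p q S t S'} (h : c (S k).head? = true) (hp : Runs p S t S') :
      Runs (.ite k c p q) S (1 + t) S'
  | iteFalse {k c p q S t S'} (h : c (S k).head? = false) (hq : Runs q S t S') :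
      Runs (.ite k c p q) S (1 + t) S'
  | loopStop {k c p S} (h : c (S k).head? = false) : Runs (.loop k c p) S 1 S
  | loopStep {k c p S t S' t' S''} (h : c (S k).head? = true) (hp : Runs p S t S')
      (hl : Runs (.loop k c p) S' t' S'') : Runs (.loop k c p) S (1 + t + t') S''

/-- The labels that a program occupies in a Turing machine. -/
def Lab : Prog → Type
  | skip => Unit
  | push _ _ => Unit
  | pop _ => Unit
  | seq p q => p.Lab ⊕ q.Lab
  | ite _ _ p q => Option (p.Lab ⊕ q.Lab)
  | loop _ _ p => Option p.Lab

/-- The label at which a program starts. -/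
def entry : (p : Prog) → p.Lab
  | skip => ()
  | push _ _ => ()
  | pop _ => ()
  | seq p _ => .inl p.entry
  | ite _ _ _ _ => none
  | loop _ _ _ => none

noncomputable instance labFintype : (p : Prog) → Fintype p.Lab
  | skip => inferInstanceAs (Fintype Unit)
  | push _ _ => inferInstanceAs (Fintype Unit)
  | pop _ => inferInstanceAs (Fintype Unit)
  | seq p q => @instFintypeSum _ _ (labFintype p) (labFintype q)
  | ite _ _ p q =>
      @instFintypeOption _ (@instFintypeSum _ _ (labFintype p) (labFintype q))
  | loop _ _ p => @instFintypeOption _ (labFintype p)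

open Turing.TM2 in
/-- The code of a program whose labels are placed by `e` and which exits to the label `x`. The
internal state of the machine holds the outcome of the last test. -/
def code {Λ : Type} : (p : Prog) → (e : p.Lab → Λ) → (x : Λ) → p.Lab → Stmt Alph Λ Bool
  | skip, _, x, _ => .goto fun _ => x
  | push k a, _, x, _ => .push k (fun _ => a) (.goto fun _ => x)
  | pop k, _, x, _ => .pop k (fun v _ => v) (.goto fun _ => x)
  | seq p q, e, _, .inl l => p.code (fun l => e (.inl l)) (e (.inr q.entry)) l
  | seq _ q, e, x, .inr l => q.code (fun l => e (.inr l)) x l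
  | ite k c p q, e, _, none =>
      .peek k (fun _ o => c o) (.branch (fun v => v)
        (.goto fun _ => e (some (.inl p.entry))) (.goto fun _ => e (some (.inr q.entry))))
  | ite _ _ p _, e, x, some (.inl l) => p.code (fun l => e (some (.inl l))) x l
  | ite _ _ _ q, e, x, some (.inr l) => q.code (fun l => e (some (.inr l))) x l
  | loop k c p, e, x, none =>
      .peek k (fun _ o => c o) (.branch (fun v => v)
        (.goto fun _ => e (some p.entry)) (.goto fun _ => x))
  | loop _ _ p, e, _, some l => p.code (fun l => e (some l)) (e none) l

/-- `M.Steps t c c'`: the machine goes from `c` to `c'` in `t` steps. -/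
abbrev Steps {Λ : Type} (M : Λ → Turing.TM2.Stmt Alph Λ Bool) (t : ℕ)
    (c c' : Turing.TM2.Cfg Alph Λ Bool) : Prop :=
  (flip bind (Turing.TM2.step M))^[t] (some c) = some c'

theorem Steps.trans {Λ : Type} {M : Λ → Turing.TM2.Stmt Alph Λ Bool} {t t' : ℕ}
    {a b c : Turing.TM2.Cfg Alph Λ Bool} (h : Steps M t a b) (h' : Steps M t' b c) :
    Steps M (t + t') a c := by
  unfold Steps at *
  rw [Nat.add_comm, Function.iterate_add_apply, h, h']

theorem Steps.single {Λ : Type} {M : Λ → Turing.TM2.Stmt Alph Λ Bool} {l : Λ}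
    {q : Turing.TM2.Stmt Alph Λ Bool} {v : Bool} {S : Mem} {c : Turing.TM2.Cfg Alph Λ Bool}
    (h : M l = q) (hc : Turing.TM2.stepAux q v S = c) : Steps M 1 ⟨some l, v, S⟩ c := by
  simp [Steps, flip, h, hc]

/-- A machine containing the code of a program simulates it step by step. -/
theorem Runs.steps {Λ : Type} {M : Λ → Turing.TM2.Stmt Alph Λ Bool} {p : Prog} {S S' : Mem}
    {t : ℕ} (h : p.Runs S t S') : ∀ (e : p.Lab → Λ) (x : Λ), (∀ l, M (e l) = p.code e x l) →
      ∀ v, ∃ v', Steps M t ⟨some (e p.entry), v, S⟩ ⟨some x, v', S'⟩ := by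
  induction h with
  | skip =>
    intro e x hM v
    exact ⟨v, .single (hM ()) (by simp [code])⟩
  | push =>
    intro e x hM v
    exact ⟨v, .single (hM ()) (by simp [code])⟩
  | pop =>
    intro e x hM v
    exact ⟨v, .single (hM ()) (by simp [code])⟩
  | @seq p q S t S' t' S'' hp hq ihp ihq =>
    intro e x hM v
    obtain ⟨v₁, h₁⟩ := ihp (fun l => e (.inl l)) (e (.inr q.entry)) (fun l => hM (.inl l)) v
    obtain ⟨v₂, h₂⟩ := ihq (fun l => e (.inr l)) x (fun l => hM (.inr l)) v₁
    exact ⟨v₂, h₁.trans h₂⟩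
  | @iteTrue k c p q S t S' h hp ih =>
    intro e x hM v
    obtain ⟨v₁, h₁⟩ := ih (fun l => e (some (.inl l))) x (fun l => hM (some (.inl l))) true
    refine ⟨v₁, Steps.trans (b := ⟨some (e (some (.inl p.entry))), true, S⟩) ?_ h₁⟩
    exact .single (hM none) (by simp [code, h])
  | @iteFalse k c p q S t S' h hp ih =>
    intro e x hM v
    obtain ⟨v₁, h₁⟩ := ih (fun l => e (some (.inr l))) x (fun l => hM (some (.inr l))) false
    refine ⟨v₁, Steps.trans (b := ⟨some (e (some (.inr q.entry))), false, S⟩) ?_ h₁⟩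
    exact .single (hM none) (by simp [code, h])
  | loopStop h =>
    intro e x hM v
    exact ⟨false, .single (hM none) (by simp [code, h])⟩
  | @loopStep k c p S t S' t' S'' h hp hl ihp ihl =>
    intro e x hM v
    obtain ⟨v₁, h₁⟩ := ihp (fun l => e (some l)) (e none) (fun l => hM (some l)) true
    obtain ⟨v₂, h₂⟩ := ihl e x hM v₁
    refine ⟨v₂, (Steps.trans (b := ⟨some (e (some p.entry)), true, S⟩) ?_ h₁).trans h₂⟩
    exact .single (hM none) (by simp [code, h])

/-- The Turing machine that runs a program and halts. -/
noncomputable def machine (p : Prog) : Turing.FinTM2 where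
  k₀ := Stk.inp
  k₁ := Stk.aux
  Γ := Alph
  Λ := Option p.Lab
  main := some p.entry
  σ := Bool
  initialState := false
  Γk₀Fin := inferInstanceAs (Fintype Sym)
  m
    | none => .load (fun _ => false) .halt
    | some l => p.code some none l

/-- The memory with given contents of the main and the auxiliary stacks, and no input. -/
def mem (m a a' c : List Bool) : Mem
  | .inp => []
  | .main => m
  | .aux => a
  | .aux' => a'
  | .cnt => c

/-- The memory with a given input. -/
def inMem (i : List Sym) (m : List Bool) : Mem
  | .inp => i
  | .main => m
  | .aux => []
  | .aux' => []
  | .cnt => []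

theorem initList_machine (p : Prog) (l : List Sym) :
    Turing.initList p.machine l = ⟨some (some p.entry), false, inMem l []⟩ := by
  refine congrArg (Turing.TM2.Cfg.mk _ _) (funext fun k => ?_)
  cases k <;> rfl

theorem haltList_machine (p : Prog) (l : List Bool) :
    Turing.haltList p.machine l = ⟨none, false, mem [] l [] []⟩ := by
  refine congrArg (Turing.TM2.Cfg.mk _ _) (funext fun k => ?_)
  cases k <;> rfl

/-- A program that transforms the input on the stack `inp` into the output on the stack `aux`, in
polynomial time, is a polynomial-time Turing machine. -/
noncomputable def computableInPolyTime {α : Type} {ea : α → List Sym} {β : Type}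
    {eb : β → List Bool} {f : α → β} (p : Prog) (P : Polynomial ℕ)
    (h : ∀ a, ∃ t ≤ P.eval (ea a).length, p.Runs (inMem (ea a) []) t (mem [] (eb (f a)) [] [])) :
    Turing.TM2ComputableInPolyTime ea eb f where
  tm := p.machine
  inputAlphabet := Equiv.refl Sym
  outputAlphabet := Equiv.refl Bool
  time := P + 1
  outputsFun a :=
    { steps := (h a).choose + 1
      evals_in_steps := by
        obtain ⟨v, hv⟩ := (h a).choose_spec.2.steps (M := p.machine.m) some none
          (fun _ => rfl) false
        have hi : Turing.initList p.machine (List.map (Equiv.refl Sym).invFun (ea a)) =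
            ⟨some (some p.entry), false, inMem (ea a) []⟩ :=
          (congrArg (Turing.initList p.machine) (List.map_id (ea a))).trans (p.initList_machine _)
        have ho : Turing.haltList p.machine (List.map (Equiv.refl Bool).invFun (eb (f a))) =
            ⟨none, false, mem [] (eb (f a)) [] []⟩ :=
          (congrArg (Turing.haltList p.machine) (List.map_id (eb (f a)))).trans
            (p.haltList_machine _)
        have h1 := hv.trans (t' := 1) (c := ⟨none, false, mem [] (eb (f a)) [] []⟩)
          (.single (M := p.machine.m) (l := none) rfl rfl)
        exact (congrArg (fun c => _ = some c) ho).mpr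
          ((congrArg (fun c => (flip bind (Turing.TM2.step p.machine.m))^[_] (some c) = _) hi).mpr h1)
      steps_le_m := by
        rw [Polynomial.eval_add, Polynomial.eval_one]
        exact Nat.succ_le_succ (h a).choose_spec.1 }

end Prog

namespace Prog

/-- `p.RunsLE S t S'`: started with the stacks `S`, the program `p` stops within `t` steps with
the stacks `S'`. -/
def RunsLE (p : Prog) (S : Mem) (t : ℕ) (S' : Mem) : Prop := ∃ t' ≤ t, p.Runs S t' S'

section update
variable (m a a' c : List Bool) (i : List Sym) (l : List Bool)

@[simp] theorem update_main : Function.update (mem m a a' c) .main l = mem l a a' c := by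
  funext k; cases k <;> rfl
@[simp] theorem update_aux : Function.update (mem m a a' c) .aux l = mem m l a' c := by
  funext k; cases k <;> rfl
@[simp] theorem update_aux' : Function.update (mem m a a' c) .aux' l = mem m a l c := by
  funext k; cases k <;> rfl
@[simp] theorem update_cnt : Function.update (mem m a a' c) .cnt l = mem m a a' l := by
  funext k; cases k <;> rfl

end update

namespace RunsLE
variable {p q : Prog} {S S' S'' : Mem} {t t' n : ℕ}

theorem mono (h : p.RunsLE S t S') (ht : t ≤ n) : p.RunsLE S n S' := by
  obtain ⟨s, hs, h⟩ := h; exact ⟨s, hs.trans ht, h⟩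

theorem seq (hp : p.RunsLE S t S') (hq : q.RunsLE S' t' S'') :
    (Prog.seq p q).RunsLE S (t + t') S'' := by
  obtain ⟨s, hs, h⟩ := hp
  obtain ⟨s', hs', h'⟩ := hq
  exact ⟨s + s', by omega, h.seq h'⟩

theorem skip : Prog.skip.RunsLE S 1 S := ⟨1, le_rfl, .skip⟩

theorem push {k : Stk} {a : Alph k} (h : Function.update S k (a :: S k) = S') :
    (Prog.push k a).RunsLE S 1 S' := ⟨1, le_rfl, h ▸ .push⟩

theorem pop {k : Stk} (h : Function.update S k (S k).tail = S') :
    (Prog.pop k).RunsLE S 1 S' := ⟨1, le_rfl, h ▸ .pop⟩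

theorem iteTrue {k : Stk} {c : Option (Alph k) → Bool} (h : c (S k).head? = true)
    (hp : p.RunsLE S t S') : (Prog.ite k c p q).RunsLE S (1 + t) S' := by
  obtain ⟨s, hs, h'⟩ := hp
  exact ⟨1 + s, by omega, .iteTrue h h'⟩

theorem iteFalse {k : Stk} {c : Option (Alph k) → Bool} (h : c (S k).head? = false)
    (hq : q.RunsLE S t S') : (Prog.ite k c p q).RunsLE S (1 + t) S' := by
  obtain ⟨s, hs, h'⟩ := hq
  exact ⟨1 + s, by omega, .iteFalse h h'⟩

theorem loopStop {k : Stk} {c : Option (Alph k) → Bool} (h : c (S k).head? = false) :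
    (Prog.loop k c p).RunsLE S 1 S := ⟨1, le_rfl, .loopStop h⟩

theorem loopStep {k : Stk} {c : Option (Alph k) → Bool} (h : c (S k).head? = true)
    (hp : p.RunsLE S t S') (hl : (Prog.loop k c p).RunsLE S' t' S'') :
    (Prog.loop k c p).RunsLE S (1 + t + t') S'' := by
  obtain ⟨s, hs, h₁⟩ := hp
  obtain ⟨s', hs', h₂⟩ := hl
  exact ⟨1 + s + s', by omega, .loopStep h h₁ h₂⟩

end RunsLE

/-- A step adds at most one symbol to the main stack. -/
theorem Runs.length_main_le {p : Prog} {S S' : Mem} {t : ℕ} (h : p.Runs S t S') :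
    (S' .main).length ≤ (S .main).length + t := by
  induction h with
  | @push k a S =>
    by_cases hk : k = .main
    · subst hk; simp
    · rw [Function.update_of_ne (Ne.symm hk)]; omega
  | @pop k S =>
    by_cases hk : k = .main
    · subst hk; simp; omega
    · rw [Function.update_of_ne (Ne.symm hk)]; omega
  | _ => omega

end Prog

/-! ### Values on the main stack -/

/-- Binary trees: the values that programs handle. -/
inductive Dat : Type
  | nil : Dat
  | cons (a b : Dat) : Dat

/-- The preorder code of a tree, which determines where it ends. -/
def Dat.code : Dat → List Bool
  | .nil => [false]
  | .cons a b => true :: (a.code ++ b.code)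

namespace Prog
open Stk

/-- Remove the first tree from the main stack, executing `on b` for each symbol `b` of its code.
The stack `cnt` counts the trees that are still to be read. -/
def scan (on : Bool → Prog) : Prog :=
  seq (push cnt true) <| loop cnt (·.isSome) <| seq (pop cnt) <|
    ite main (· == some true)
      (seq (pop main) <| seq (on true) <| seq (push cnt true) (push cnt true))
      (seq (pop main) (on false))

theorem scan_runs {on : Bool → Prog} {g g' : List Bool → Bool → List Bool}
    (hon : ∀ b m a a' c, (on b).RunsLE (mem m a a' c) 1 (mem m (g a b) (g' a' b) c))
    (d : Dat) (m a a' : List Bool) :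
    (scan on).RunsLE (mem (d.code ++ m) a a' []) (2 + 7 * d.code.length)
      (mem m (d.code.foldl g a) (d.code.foldl g' a') []) := by
  suffices h : ∀ (d : Dat) (m a a' c : List Bool) (t : ℕ) (S : Mem),
      (loop cnt (·.isSome) <| seq (pop cnt) <| ite main (· == some true)
        (seq (pop main) <| seq (on true) <| seq (push cnt true) (push cnt true))
        (seq (pop main) (on false))).RunsLE (mem m (d.code.foldl g a) (d.code.foldl g' a') c) t S →
      (loop cnt (·.isSome) <| seq (pop cnt) <| ite main (· == some true)
        (seq (pop main) <| seq (on true) <| seq (push cnt true) (push cnt true))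
        (seq (pop main) (on false))).RunsLE (mem (d.code ++ m) a a' (true :: c))
          (t + 7 * d.code.length) S by
    refine ((RunsLE.push (S' := mem (d.code ++ m) a a' [true]) ?_).seq
      (h d m a a' [] 1 _ (.loopStop ?_))).mono (by omega)
    · simp [mem]
    · simp [mem]
  intro d
  induction d with
  | nil =>
    intro m a a' c t S h
    refine (RunsLE.loopStep (t := 4) (t' := t) (S' := mem m (g a false) (g' a' false) c) ?_
      ?_ h).mono (by simp [Dat.code]; omega)
    · simp [mem]
    · refine (RunsLE.pop (S' := mem (false :: m) a a' c) (by simp [mem, Dat.code])).seq (t' := 3) ?_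
      refine .iteFalse (by simp [mem]) (t := 2) ?_
      exact (RunsLE.pop (S' := mem m a a' c) (by simp [mem])).seq (hon _ _ _ _ _)
  | cons x y ihx ihy =>
    intro m a a' c t S h
    simp only [Dat.code, List.foldl_cons, List.foldl_append] at h
    refine (RunsLE.loopStep (t := 6) (t' := t + 7 * y.code.length + 7 * x.code.length)
      (S' := mem (x.code ++ (y.code ++ m)) (g a true) (g' a' true) (true :: true :: c)) ?_
      ?_ (ihx _ _ _ _ _ _ (ihy _ _ _ _ _ _ h))).mono
        (by simp only [Dat.code, List.length_cons, List.length_append]; omega)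
    · simp [mem]
    · refine (RunsLE.pop (S' := mem (true :: (x.code ++ (y.code ++ m))) a a' c)
        (by simp [mem, Dat.code])).seq (t' := 5) ?_
      refine .iteTrue (by simp [mem]) (t := 4) ?_
      refine (RunsLE.pop (S' := mem (x.code ++ (y.code ++ m)) a a' c) (by simp [mem])).seq
        (t' := 3) ((hon _ _ _ _ _).seq (t' := 2) ?_)
      exact (RunsLE.push rfl).seq (.push (by simp [mem]))

/-- Empty the stack `k`, executing `on b` for each symbol `b`. -/
def pour (k : Stk) (c : Option (Alph k) → Bool) (on : Bool → Prog) : Prog :=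
  loop k (·.isSome) <| ite k c (seq (pop k) (on true)) (seq (pop k) (on false))

theorem pour_aux {on : Bool → Prog} {g g' : List Bool → Bool → List Bool}
    (hon : ∀ b m a a' c, (on b).RunsLE (mem m a a' c) 2 (mem (g m b) a (g' a' b) c))
    (a : List Bool) : ∀ m a', (pour aux (· == some true) on).RunsLE (mem m a a' [])
      (1 + 5 * a.length) (mem (a.foldl g m) [] (a.foldl g' a') []) := by
  induction a with
  | nil => exact fun m a' => .loopStop (by simp [mem])
  | cons b a ih =>
    intro m a'
    refine (RunsLE.loopStep (t := 4) (S' := mem (g m b) a (g' a' b) []) (by simp [mem]) ?_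
      (ih _ _)).mono (by simp; omega)
    cases b
    · exact .iteFalse (by simp [mem]) (t := 3)
        ((RunsLE.pop (S' := mem m a a' []) (by simp [mem])).seq (hon _ _ _ _ _))
    · exact .iteTrue (by simp [mem]) (t := 3)
        ((RunsLE.pop (S' := mem m a a' []) (by simp [mem])).seq (hon _ _ _ _ _))

theorem pour_aux' {on : Bool → Prog} {g g' : List Bool → Bool → List Bool}
    (hon : ∀ b m a a' c, (on b).RunsLE (mem m a a' c) 2 (mem (g m b) (g' a b) a' c))
    (a' : List Bool) : ∀ m a, (pour aux' (· == some true) on).RunsLE (mem m a a' [])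
      (1 + 5 * a'.length) (mem (a'.foldl g m) (a'.foldl g' a) [] []) := by
  induction a' with
  | nil => exact fun m a => .loopStop (by simp [mem])
  | cons b a' ih =>
    intro m a
    refine (RunsLE.loopStep (t := 4) (S' := mem (g m b) (g' a b) a' []) (by simp [mem]) ?_
      (ih _ _)).mono (by simp; omega)
    cases b
    · exact .iteFalse (by simp [mem]) (t := 3)
        ((RunsLE.pop (S' := mem m a a' []) (by simp [mem])).seq (hon _ _ _ _ _))
    · exact .iteTrue (by simp [mem]) (t := 3)
        ((RunsLE.pop (S' := mem m a a' []) (by simp [mem])).seq (hon _ _ _ _ _))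

theorem foldl_flip_cons (l r : List Bool) : l.foldl (fun a b => b :: a) r = l.reverse ++ r := by
  induction l generalizing r <;> simp_all

theorem foldl_const (l r : List Bool) : l.foldl (fun a _ => a) r = r := by
  induction l generalizing r <;> simp_all

/-- Remove the first tree from the main stack. -/
def drop : Prog := scan fun _ => skip

theorem drop_runs (d : Dat) (m : List Bool) :
    drop.RunsLE (mem (d.code ++ m) [] [] []) (2 + 7 * d.code.length) (mem m [] [] []) := by
  have := scan_runs (on := fun _ => skip) (g := fun a _ => a) (g' := fun a _ => a)
    (fun _ _ _ _ _ => .skip) d m [] []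
  rwa [foldl_const] at this

/-- Duplicate the first tree on the main stack. -/
def dup : Prog :=
  seq (scan fun b => push aux b) <|
    seq (pour aux (· == some true) fun b => seq (push main b) (push aux' b)) <|
      seq (pour aux' (· == some true) fun b => push aux b)
        (pour aux (· == some true) fun b => push main b)

theorem dup_runs (d : Dat) (m : List Bool) : dup.RunsLE (mem (d.code ++ m) [] [] [])
    (5 + 22 * d.code.length) (mem (d.code ++ (d.code ++ m)) [] [] []) := by
  have h₁ := scan_runs (on := fun b => push aux b) (g := fun a b => b :: a) (g' := fun a _ => a)
    (fun b m a a' c => .push (by simp [mem])) d m [] []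
  have h₂ := pour_aux (on := fun b => seq (push main b) (push aux' b)) (g := fun a b => b :: a)
    (g' := fun a b => b :: a)
    (fun b m a a' c => (RunsLE.push rfl).seq (.push (by simp [mem]))) d.code.reverse m []
  have h₃ := pour_aux' (on := fun b => push aux b) (g := fun a _ => a) (g' := fun a b => b :: a)
    (fun b m a a' c => (RunsLE.push (by simp [mem])).mono (by simp)) d.code (d.code ++ m) []
  have h₄ := pour_aux (on := fun b => push main b) (g := fun a b => b :: a) (g' := fun a _ => a)
    (fun b m a a' c => (RunsLE.push (by simp [mem])).mono (by simp)) d.code.reverse (d.code ++ m) []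
  simp only [foldl_flip_cons, foldl_const, List.append_nil, List.reverse_reverse,
    List.length_reverse] at h₁ h₂ h₃ h₄
  exact (h₁.seq (h₂.seq (h₃.seq h₄))).mono (by omega)

/-- Exchange the two first trees on the main stack. -/
def swap : Prog :=
  seq (scan fun b => push aux b) <| seq (scan fun b => push aux' b) <|
    seq (pour aux (· == some true) fun b => push main b)
      (pour aux' (· == some true) fun b => push main b)

theorem swap_runs (d e : Dat) (m : List Bool) : swap.RunsLE (mem (d.code ++ (e.code ++ m)) [] [] [])
    (6 + 12 * (d.code.length + e.code.length)) (mem (e.code ++ (d.code ++ m)) [] [] []) := by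
  have h₁ := scan_runs (on := fun b => push aux b) (g := fun a b => b :: a) (g' := fun a _ => a)
    (fun b m a a' c => .push (by simp [mem])) d (e.code ++ m) [] []
  have h₂ := scan_runs (on := fun b => push aux' b) (g := fun a _ => a) (g' := fun a b => b :: a)
    (fun b m a a' c => .push (by simp [mem])) e m d.code.reverse []
  have h₃ := pour_aux (on := fun b => push main b) (g := fun a b => b :: a) (g' := fun a _ => a)
    (fun b m a a' c => (RunsLE.push (by simp [mem])).mono (by simp)) d.code.reverse m e.code.reverse
  have h₄ := pour_aux' (on := fun b => push main b) (g := fun a b => b :: a) (g' := fun a _ => a)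
    (fun b m a a' c => (RunsLE.push (by simp [mem])).mono (by simp)) e.code.reverse (d.code ++ m) []
  simp only [foldl_flip_cons, foldl_const, List.append_nil, List.reverse_reverse,
    List.length_reverse] at h₁ h₂ h₃ h₄
  exact (h₁.seq (h₂.seq (h₃.seq h₄))).mono (by omega)

/-- Push a word on the main stack. -/
def pushes : List Bool → Prog
  | [] => skip
  | b :: l => seq (pushes l) (push main b)

theorem pushes_runs' (l : List Bool) (S : Mem) :
    (pushes l).RunsLE S (l.length + 1) (Function.update S .main (l ++ S .main)) := by
  induction l with
  | nil => rw [List.nil_append, Function.update_eq_self]; exact .skip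
  | cons b l ih => exact (ih.seq (.push (by simp))).mono (by simp)

theorem pushes_runs (l m : List Bool) :
    (pushes l).RunsLE (mem m [] [] []) (l.length + 1) (mem (l ++ m) [] [] []) := by
  simpa [mem] using pushes_runs' l (mem m [] [] [])

end Prog

/-! ### Polynomial-time functions -/

/-- Types whose elements are represented by trees. -/
class Enc (α : Type) where
  enc : α → Dat

/-- The code of a value. -/
def codeOf {α : Type} [Enc α] (x : α) : List Bool := (Enc.enc x).code

/-- The size of a value: the length of its code. -/
def size {α : Type} [Enc α] (x : α) : ℕ := (codeOf x).length

/-- `f` is computed by a program in time polynomial in the size of the argument. The program finds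
the argument on top of the main stack and replaces it by the value of `f`. -/
@[fun_prop]
def PolyTime {α β : Type} [Enc α] [Enc β] (f : α → β) : Prop :=
  ∃ (p : Prog) (P : Polynomial ℕ), ∀ x m,
    p.RunsLE (Prog.mem (codeOf x ++ m) [] [] []) (P.eval (size x))
      (Prog.mem (codeOf (f x) ++ m) [] [] [])

/-- `g` is bounded by a polynomial in the size of the argument. -/
def PolyBdd {α : Type} [Enc α] (g : α → ℕ) : Prop := ∃ P : Polynomial ℕ, ∀ x, g x ≤ P.eval (size x)

theorem eval_mono (P : Polynomial ℕ) {m n : ℕ} (h : m ≤ n) : P.eval m ≤ P.eval n := by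
  induction P using Polynomial.induction_on' with
  | add p q hp hq => simp only [Polynomial.eval_add]; omega
  | monomial k a => simp only [Polynomial.eval_monomial]; gcongr

section
variable {α β γ σ τ : Type} [Enc α] [Enc β] [Enc γ] [Enc σ] [Enc τ]

namespace PolyBdd

theorem const (k : ℕ) : PolyBdd fun _ : α => k := ⟨Polynomial.C k, fun _ => by simp⟩

theorem mono {f g : α → ℕ} (hg : PolyBdd g) (h : ∀ x, f x ≤ g x) : PolyBdd f :=
  ⟨hg.choose, fun x => (h x).trans (hg.choose_spec x)⟩

theorem add {f g : α → ℕ} (hf : PolyBdd f) (hg : PolyBdd g) : PolyBdd fun x => f x + g x :=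
  ⟨hf.choose + hg.choose, fun x => by
    rw [Polynomial.eval_add]; exact add_le_add (hf.choose_spec x) (hg.choose_spec x)⟩

theorem mul {f g : α → ℕ} (hf : PolyBdd f) (hg : PolyBdd g) : PolyBdd fun x => f x * g x :=
  ⟨hf.choose * hg.choose, fun x => by
    rw [Polynomial.eval_mul]; exact Nat.mul_le_mul (hf.choose_spec x) (hg.choose_spec x)⟩

theorem size : PolyBdd fun x : α => OptNNF.size x := ⟨Polynomial.X, fun x => by simp⟩

theorem eval {f : α → ℕ} (hf : PolyBdd f) (P : Polynomial ℕ) : PolyBdd fun x => P.eval (f x) :=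
  ⟨P.comp hf.choose, fun x => by
    rw [Polynomial.eval_comp]; exact eval_mono P (hf.choose_spec x)⟩

end PolyBdd

/-- A function whose time is bounded by a polynomially bounded function is in polynomial time. -/
theorem PolyTime.of_bdd {f : α → β} (p : Prog) {g : α → ℕ} (hg : PolyBdd g)
    (h : ∀ x m, p.RunsLE (Prog.mem (codeOf x ++ m) [] [] []) (g x)
      (Prog.mem (codeOf (f x) ++ m) [] [] [])) : PolyTime f :=
  ⟨p, hg.choose, fun x m => (h x m).mono (hg.choose_spec x)⟩

/-- The values of a polynomial-time function have polynomial size. -/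
theorem PolyTime.bdd {f : α → β} (hf : PolyTime f) : PolyBdd fun x => size (f x) := by
  obtain ⟨p, P, h⟩ := hf
  refine ⟨Polynomial.X + P, fun x => ?_⟩
  obtain ⟨t, ht, h⟩ := h x []
  have := h.length_main_le
  simp only [Prog.mem, List.append_nil] at this
  simp only [Polynomial.eval_add, Polynomial.eval_X, size] at *
  omega

namespace PolyTime

@[fun_prop]
theorem id : PolyTime fun x : α => x :=
  of_bdd .skip (PolyBdd.const 1) fun _ _ => .skip

@[fun_prop]
theorem comp {g : β → γ} {f : α → β} (hg : PolyTime g) (hf : PolyTime f) :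
    PolyTime fun x => g (f x) := by
  obtain ⟨q, Q, hq⟩ := hg
  have hb := hf.bdd
  obtain ⟨p, P, hp⟩ := hf
  exact of_bdd (.seq p q) ((PolyBdd.size.eval P).add (hb.eval Q)) fun x m => (hp x m).seq (hq _ m)

@[fun_prop]
theorem const (b : β) : PolyTime fun _ : α => b :=
  of_bdd (.seq .drop (.pushes (codeOf b)))
    (((PolyBdd.const 2).add ((PolyBdd.const 7).mul .size)).add (PolyBdd.const (size b + 1)))
    fun _ _ => (Prog.drop_runs _ _).seq (Prog.pushes_runs _ _)

/-- Running `f` on a copy of the argument. -/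
theorem dup_runs {f : α → β} {p : Prog} {P : Polynomial ℕ} (hp : ∀ x m,
    p.RunsLE (Prog.mem (codeOf x ++ m) [] [] []) (P.eval (size x))
      (Prog.mem (codeOf (f x) ++ m) [] [] [])) (x : α) (m : List Bool) :
    (Prog.seq .dup p).RunsLE (Prog.mem (codeOf x ++ m) [] [] [])
      (5 + 22 * size x + P.eval (size x))
      (Prog.mem (codeOf (f x) ++ (codeOf x ++ m)) [] [] []) :=
  (Prog.dup_runs _ m).seq (hp x _)

end PolyTime

/-! ### Representation of data by trees -/

/-- The tree is not a leaf. -/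
def Dat.isCons : Dat → Bool
  | .nil => false
  | .cons _ _ => true

/-- The left subtree (a leaf, for a leaf). -/
def Dat.left : Dat → Dat
  | .nil => .nil
  | .cons a _ => a

/-- The right subtree (a leaf, for a leaf). -/
def Dat.right : Dat → Dat
  | .nil => .nil
  | .cons _ b => b

instance : Enc Dat := ⟨fun d => d⟩

instance : Enc Unit := ⟨fun _ => .nil⟩

instance : Enc Bool := ⟨fun b => cond b (.cons .nil .nil) .nil⟩

instance : Enc (α × β) := ⟨fun p => .cons (Enc.enc p.1) (Enc.enc p.2)⟩

instance : Enc (Option α) := ⟨fun o => o.elim .nil fun a => .cons (Enc.enc a) .nil⟩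

instance : Enc (List α) := ⟨fun l => l.foldr (fun a d => .cons (Enc.enc a) d) .nil⟩

/-- Natural numbers are represented by their binary digits, the least significant one first. -/
instance : Enc ℕ := ⟨fun n => Enc.enc n.bits⟩

theorem codeOf_pair (x : α) (y : β) : codeOf (x, y) = true :: (codeOf x ++ codeOf y) := rfl

theorem codeOf_nil : codeOf ([] : List α) = [false] := rfl

theorem codeOf_cons (a : α) (l : List α) : codeOf (a :: l) = true :: (codeOf a ++ codeOf l) := rfl

theorem size_pair (x : α) (y : β) : size (x, y) = 1 + size x + size y := by
  simp [size, codeOf_pair]; omega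

theorem size_nil : size ([] : List α) = 1 := rfl

theorem size_cons (a : α) (l : List α) : size (a :: l) = 1 + size a + size l := by
  simp [size, codeOf_cons]; omega

theorem size_none : size (none : Option α) = 1 := rfl

theorem size_some (a : α) : size (some a) = 2 + size a := by
  simp [size, codeOf, Enc.enc, Dat.code]; omega

theorem size_bool_le (b : Bool) : size b ≤ 3 := by cases b <;> decide

theorem size_append (l l' : List α) : size (l ++ l') + 1 = size l + size l' := by
  induction l with
  | nil => simp [size_nil]; omega
  | cons a l ih => simp only [List.cons_append, size_cons]; omega

theorem size_reverse (l : List α) : size l.reverse = size l := by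
  induction l with
  | nil => rfl
  | cons a l ih =>
    have := size_append l.reverse [a]
    simp only [List.reverse_cons, size_cons, size_nil] at *
    omega

theorem length_le_size (l : List α) : l.length ≤ size l := by
  induction l with
  | nil => simp
  | cons a l ih => simp only [size_cons, List.length_cons]; omega

theorem size_le_of_mem {a : α} {l : List α} (h : a ∈ l) : size a ≤ size l := by
  induction l with
  | nil => simp at h
  | cons b l ih =>
    rw [size_cons]
    rcases List.mem_cons.1 h with rfl | h
    · omega
    · have := ih h; omega

theorem size_list_le {l : List α} {k : ℕ} (h : ∀ a ∈ l, size a ≤ k) :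
    size l ≤ 1 + l.length * (k + 1) := by
  induction l with
  | nil => simp [size_nil]
  | cons a l ih =>
    have h1 := h a (by simp)
    have h2 := ih fun b hb => h b (by simp [hb])
    simp only [size_cons, List.length_cons, add_mul]
    omega

theorem size_le_of_prefix {l l' : List α} (h : l <+: l') : size l ≤ size l' := by
  obtain ⟨r, rfl⟩ := h
  have h1 := size_append l r
  have : 1 ≤ size r := by
    cases r
    · simp [size_nil]
    · rw [size_cons]; omega
  omega

theorem size_le_of_suffix {l l' : List α} (h : l <:+ l') : size l ≤ size l' := by
  have := size_le_of_prefix (List.reverse_prefix.2 h)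
  rwa [size_reverse, size_reverse] at this

/-! ### Closure properties -/

namespace PolyTime

/-- A function that acts on representations as a polynomial-time function on trees does. -/
theorem of_enc {f : α → β} {F : σ → τ} (hF : PolyTime F) (e : α → σ)
    (he : ∀ x, Enc.enc (e x) = Enc.enc x) (h : ∀ x, Enc.enc (F (e x)) = Enc.enc (f x)) :
    PolyTime f := by
  obtain ⟨p, P, hp⟩ := hF
  refine ⟨p, P, fun x m => ?_⟩
  have := hp (e x) m
  simpa only [size, codeOf, he, h] using this

@[fun_prop]
theorem prodMk {f : α → β} {g : α → γ} (hf : PolyTime f) (hg : PolyTime g) :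
    PolyTime fun x => (f x, g x) := by
  have hbf := hf.bdd
  have hbg := hg.bdd
  obtain ⟨p, P, hp⟩ := hf
  obtain ⟨q, Q, hq⟩ := hg
  refine of_bdd (.seq (.seq .dup p) (.seq .swap (.seq q (.seq .swap (.push .main true)))))
    (g := fun x => (5 + 22 * size x + P.eval (size x)) + ((6 + 12 * (size (f x) + size x)) +
      (Q.eval (size x) + ((6 + 12 * (size (g x) + size (f x))) + 1))))
    (((((PolyBdd.const 5).add ((PolyBdd.const 22).mul .size))).add (PolyBdd.size.eval P)).add
      (((PolyBdd.const 6).add ((PolyBdd.const 12).mul (hbf.add .size))).add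
        ((PolyBdd.size.eval Q).add (((PolyBdd.const 6).add
          ((PolyBdd.const 12).mul (hbg.add hbf))).add (.const 1))))) fun x m => ?_
  refine (dup_runs hp x m).seq ((Prog.swap_runs _ _ _).seq ((hq x _).seq
    ((Prog.swap_runs _ _ _).seq (.push ?_))))
  simp [Prog.mem, codeOf_pair]; rfl

@[fun_prop]
theorem fst {f : α → β × γ} (hf : PolyTime f) : PolyTime fun x => (f x).1 := by
  refine comp (f := f) (g := Prod.fst) ?_ hf
  refine of_bdd (.seq (.pop .main) (.seq .swap .drop))
    (g := fun x : β × γ => 1 + ((6 + 12 * size x) + (2 + 7 * size x)))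
    ((PolyBdd.const 1).add (((PolyBdd.const 6).add ((PolyBdd.const 12).mul .size)).add
      ((PolyBdd.const 2).add ((PolyBdd.const 7).mul .size)))) fun x m => ?_
  have hx : size x = 1 + size x.1 + size x.2 := size_pair x.1 x.2
  simp only [size, codeOf] at hx ⊢
  refine (Prog.RunsLE.pop (S' := Prog.mem (codeOf x.1 ++ (codeOf x.2 ++ m)) [] [] []) ?_).seq
    (((Prog.swap_runs _ _ _).mono ?_).seq ((Prog.drop_runs _ _).mono ?_))
  · simp [Prog.mem, codeOf, Enc.enc, Dat.code]
  · omega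
  · omega

@[fun_prop]
theorem snd {f : α → β × γ} (hf : PolyTime f) : PolyTime fun x => (f x).2 := by
  refine comp (f := f) (g := Prod.snd) ?_ hf
  refine of_bdd (.seq (.pop .main) .drop) (g := fun x : β × γ => 1 + (2 + 7 * size x))
    ((PolyBdd.const 1).add ((PolyBdd.const 2).add ((PolyBdd.const 7).mul .size))) fun x m => ?_
  have hx : size x = 1 + size x.1 + size x.2 := size_pair x.1 x.2
  simp only [size, codeOf] at hx ⊢
  refine (Prog.RunsLE.pop (S' := Prog.mem (codeOf x.1 ++ (codeOf x.2 ++ m)) [] [] []) ?_).seq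
    ((Prog.drop_runs _ _).mono ?_)
  · simp [Prog.mem, codeOf, Enc.enc, Dat.code]
  · omega

@[fun_prop]
theorem cond {c : α → Bool} {f g : α → β} (hc : PolyTime c) (hf : PolyTime f) (hg : PolyTime g) :
    PolyTime fun x => cond (c x) (f x) (g x) := by
  obtain ⟨r, R, hr⟩ := hc
  obtain ⟨p, P, hp⟩ := hf
  obtain ⟨q, Q, hq⟩ := hg
  refine of_bdd (.seq (.seq .dup r) (.ite .main (· == some true)
      (.seq (.pop .main) (.seq (.pop .main) (.seq (.pop .main) p))) (.seq (.pop .main) q)))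
    (g := fun x => (5 + 22 * size x + R.eval (size x)) +
      (4 + (P.eval (size x) + Q.eval (size x))))
    (((((PolyBdd.const 5).add ((PolyBdd.const 22).mul .size))).add (PolyBdd.size.eval R)).add
      ((PolyBdd.const 4).add ((PolyBdd.size.eval P).add (PolyBdd.size.eval Q)))) fun x m => ?_
  refine (dup_runs hr x m).seq ?_
  cases c x
  · refine (Prog.RunsLE.iteFalse (by simp [Prog.mem, codeOf, Enc.enc, Dat.code]) (t := 1 + _)
      ((Prog.RunsLE.pop rfl).seq ?_)).mono (n := _) (?_ : 1 + (1 + Q.eval (size x)) ≤ _)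
    · simpa [Prog.mem, codeOf, Enc.enc, Dat.code] using hq x m
    · omega
  · refine (Prog.RunsLE.iteTrue (by simp [Prog.mem, codeOf, Enc.enc, Dat.code]) (t := 1 + _)
      ((Prog.RunsLE.pop rfl).seq ((Prog.RunsLE.pop rfl).seq ((Prog.RunsLE.pop rfl).seq ?_)))).mono
        (n := _) (?_ : 1 + (1 + (1 + (1 + P.eval (size x)))) ≤ _)
    · simpa [Prog.mem, codeOf, Enc.enc, Dat.code] using hp x m
    · omega

/-- Polynomially many iterations of a polynomial-time function, all intermediate values of which
have polynomial size, take polynomial time. -/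
theorem iterate {step : σ → σ} {c : σ → Bool} {s : α → σ} {N B : α → ℕ} (hstep : PolyTime step)
    (hc : PolyTime c) (hs : PolyTime s) (hN : PolyBdd N) (hB : PolyBdd B)
    (hsize : ∀ x, ∀ i ≤ N x, size (step^[i] (s x)) ≤ B x)
    (htrue : ∀ x, ∀ i < N x, c (step^[i] (s x)) = true)
    (hfalse : ∀ x, c (step^[N x] (s x)) = false) : PolyTime fun x => step^[N x] (s x) := by
  obtain ⟨p, P, hp⟩ := hs
  obtain ⟨q, Q, hq⟩ := hstep
  obtain ⟨r, R, hr⟩ := hc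
  -- `T`: the time of a test, `U`: the time of a round of the loop
  let T : α → ℕ := fun x => 5 + 22 * B x + R.eval (B x)
  let U : α → ℕ := fun x => 4 + (Q.eval (B x) + T x)
  have hT : PolyBdd T := ((PolyBdd.const 5).add ((PolyBdd.const 22).mul hB)).add (hB.eval R)
  have hU : PolyBdd U := (PolyBdd.const 4).add ((hB.eval Q).add hT)
  refine of_bdd (.seq p (.seq (.seq .dup r) (.seq (.loop .main (· == some true)
      (.seq (.pop .main) (.seq (.pop .main) (.seq (.pop .main) (.seq q (.seq .dup r))))))
      (.pop .main))))
    (g := fun x => P.eval (size x) + (T x + ((N x * U x + 1) + 1)))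
    ((PolyBdd.size.eval P).add (hT.add (((hN.mul hU).add (.const 1)).add (.const 1))))
    fun x m => ?_
  have test : ∀ i ≤ N x, (Prog.seq .dup r).RunsLE
      (Prog.mem (codeOf (step^[i] (s x)) ++ m) [] [] []) (T x)
      (Prog.mem (codeOf (c (step^[i] (s x))) ++ (codeOf (step^[i] (s x)) ++ m)) [] [] []) :=
    fun i hi => (dup_runs hr _ m).mono (by
      have h1 := hsize x i hi
      have h2 := eval_mono R h1
      simp only [T]; omega)
  refine (hp x m).seq ((test 0 (Nat.zero_le _)).seq (Prog.RunsLE.seq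
    (S' := Prog.mem (codeOf (c (step^[N x] (s x))) ++ (codeOf (step^[N x] (s x)) ++ m)) [] [] [])
    ?_ ?_))
  · suffices h : ∀ j i, i + j = N x → (Prog.loop .main (· == some true)
      (.seq (.pop .main) (.seq (.pop .main) (.seq (.pop .main) (.seq q (.seq .dup r)))))).RunsLE
      (Prog.mem (codeOf (c (step^[i] (s x))) ++ (codeOf (step^[i] (s x)) ++ m)) [] [] [])
      (j * U x + 1) (Prog.mem (codeOf (c (step^[N x] (s x))) ++
        (codeOf (step^[N x] (s x)) ++ m)) [] [] []) from h (N x) 0 (by omega)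
    intro j
    induction j with
    | zero =>
      rintro i rfl
      rw [Nat.add_zero, Nat.zero_mul, Nat.zero_add] at *
      exact .loopStop (by rw [hfalse]; simp [Prog.mem, codeOf, Enc.enc, Dat.code])
    | succ j ih =>
      intro i hi
      refine (Prog.RunsLE.loopStep (t := 1 + (1 + (1 + (Q.eval (B x) + T x)))) ?_ ?_
        (ih (i + 1) (by omega))).mono (n := _) ?_
      · rw [htrue x i (by omega)]; simp [Prog.mem, codeOf, Enc.enc, Dat.code]
      · rw [htrue x i (by omega)]
        refine (Prog.RunsLE.pop rfl).seq ((Prog.RunsLE.pop rfl).seq ((Prog.RunsLE.pop rfl).seq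
          (Prog.RunsLE.seq (S' := Prog.mem (codeOf (step^[i + 1] (s x)) ++ m) [] [] []) ?_
            (test _ (by omega)))))
        have := (hq (step^[i] (s x)) m).mono (eval_mono Q (hsize x i (by omega)))
        rw [Function.iterate_succ_apply']
        simpa [Prog.mem, codeOf, Enc.enc, Dat.code] using this
      · simp only [U]; ring_nf; omega
  · refine .pop ?_
    rw [hfalse]; simp [Prog.mem, codeOf, Enc.enc, Dat.code]

/-! ### Lists and options -/

@[fun_prop]
theorem cons {f : α → β} {l : α → List β} (hf : PolyTime f) (hl : PolyTime l) :
    PolyTime fun x => f x :: l x :=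
  comp (g := fun p : β × List β => p.1 :: p.2) (of_enc (F := fun p : β × List β => p) id (fun p => p)
    (fun _ => rfl) fun _ => rfl) (hf.prodMk hl)

@[fun_prop]
theorem some {f : α → β} (hf : PolyTime f) : PolyTime fun x => some (f x) :=
  of_enc (F := fun x => (f x, ())) (by fun_prop) (fun x => x) (fun _ => rfl) fun _ => rfl

theorem datIsCons : PolyTime fun d : Dat => d.isCons := by
  refine of_bdd (.ite .main (· == Option.some true) (.seq .drop (.pushes (codeOf true)))
      (.seq .drop (.pushes (codeOf false))))
    (g := fun d => 1 + ((2 + 7 * size d) + 4))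
    ((PolyBdd.const 1).add ((((PolyBdd.const 2).add ((PolyBdd.const 7).mul .size))).add
      (.const 4))) fun x m => ?_
  cases x with
  | nil => exact (Prog.RunsLE.iteFalse (by simp [Prog.mem, Enc.enc, Dat.code])
      ((Prog.drop_runs _ _).seq ((Prog.pushes_runs _ _).mono (by decide)))).mono le_rfl
  | cons a b => exact (Prog.RunsLE.iteTrue (by simp [Prog.mem, Enc.enc, Dat.code])
      ((Prog.drop_runs _ _).seq ((Prog.pushes_runs _ _).mono (by decide)))).mono le_rfl

theorem datRight : PolyTime fun d : Dat => d.right := by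
  refine of_bdd (.ite .main (· == Option.some true) (.seq (.pop .main) .drop) .skip)
    (g := fun d => 1 + (1 + (2 + 7 * size d)))
    ((PolyBdd.const 1).add ((PolyBdd.const 1).add ((PolyBdd.const 2).add
      ((PolyBdd.const 7).mul .size)))) fun x m => ?_
  cases x with
  | nil => exact (Prog.RunsLE.iteFalse (by simp [Prog.mem, codeOf, Enc.enc, Dat.code])
      .skip).mono (by omega)
  | cons a b =>
    refine Prog.RunsLE.iteTrue (by simp [Prog.mem, codeOf, Enc.enc, Dat.code])
      ((Prog.RunsLE.pop (S' := Prog.mem (a.code ++ (b.code ++ m)) [] [] []) ?_).seq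
        ((Prog.drop_runs _ _).mono ?_))
    · simp [Prog.mem, codeOf, Enc.enc, Dat.code]
    · simp [size, codeOf, Enc.enc, Dat.code]; omega

theorem datLeft : PolyTime fun d : Dat => d.left := by
  refine of_bdd (.ite .main (· == Option.some true) (.seq (.pop .main) (.seq .swap .drop)) .skip)
    (g := fun d => 1 + (1 + ((6 + 12 * size d) + (2 + 7 * size d))))
    ((PolyBdd.const 1).add ((PolyBdd.const 1).add (((PolyBdd.const 6).add
      ((PolyBdd.const 12).mul .size)).add ((PolyBdd.const 2).add
      ((PolyBdd.const 7).mul .size))))) fun x m => ?_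
  cases x with
  | nil => exact (Prog.RunsLE.iteFalse (by simp [Prog.mem, codeOf, Enc.enc, Dat.code])
      .skip).mono (by omega)
  | cons a b =>
    refine Prog.RunsLE.iteTrue (by simp [Prog.mem, codeOf, Enc.enc, Dat.code])
      ((Prog.RunsLE.pop (S' := Prog.mem (a.code ++ (b.code ++ m)) [] [] []) ?_).seq
        (((Prog.swap_runs _ _ _).mono ?_).seq ((Prog.drop_runs _ _).mono ?_)))
    · simp [Prog.mem, codeOf, Enc.enc, Dat.code]
    · simp [size, codeOf, Enc.enc, Dat.code]
    · simp [size, codeOf, Enc.enc, Dat.code]; omega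

@[fun_prop]
theorem tail {l : α → List β} (hl : PolyTime l) : PolyTime fun x => (l x).tail :=
  comp (g := fun l : List β => l.tail) (of_enc datRight Enc.enc (fun _ => rfl)
    fun l => by cases l <;> rfl) hl

@[fun_prop]
theorem isEmpty {l : α → List β} (hl : PolyTime l) : PolyTime fun x => (l x).isEmpty :=
  comp (g := fun l : List β => l.isEmpty) (of_enc
    (F := fun d : Dat => bif d.isCons then false else true)
    (cond datIsCons (by fun_prop) (by fun_prop)) Enc.enc (fun _ => rfl)
    fun l => by cases l <;> rfl) hl

@[fun_prop]
theorem headD {l : α → List β} {f : α → β} (hl : PolyTime l) (hf : PolyTime f) :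
    PolyTime fun x => (l x).headD (f x) :=
  of_enc (F := fun x => bif (l x).isEmpty then Enc.enc (f x) else
      (Enc.enc (l x)).left)
    (cond (by fun_prop) (of_enc hf (fun x => x) (fun _ => rfl) fun _ => rfl)
      (datLeft.comp (of_enc hl (fun x => x) (fun _ => rfl) fun _ => rfl)))
    (fun x => x) (fun _ => rfl) fun x => by cases l x <;> rfl

@[fun_prop]
theorem isSome {f : α → Option β} (hf : PolyTime f) : PolyTime fun x => (f x).isSome :=
  comp (g := fun o : Option β => o.isSome) (of_enc datIsCons Enc.enc (fun _ => rfl)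
    fun o => by cases o <;> rfl) hf

@[fun_prop]
theorem getD {f : α → Option β} {g : α → β} (hf : PolyTime f) (hg : PolyTime g) :
    PolyTime fun x => (f x).getD (g x) :=
  of_enc (F := fun x => bif (f x).isSome then
      (Enc.enc (f x)).left else Enc.enc (g x))
    (cond (by fun_prop) (datLeft.comp (of_enc hf (fun x => x) (fun _ => rfl) fun _ => rfl))
      (of_enc hg (fun x => x) (fun _ => rfl) fun _ => rfl))
    (fun x => x) (fun _ => rfl) fun x => by cases f x <;> rfl

/-- Folds the intermediate values of which have polynomial size. -/
theorem foldl {l : α → List β} {s : α → σ} {f : α → σ → β → σ} {B : α → ℕ}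
    (hf : PolyTime fun p : α × σ × β => f p.1 p.2.1 p.2.2) (hs : PolyTime s) (hl : PolyTime l)
    (hB : PolyBdd B) (h : ∀ x l', l' <+: l x → size (l'.foldl (f x) (s x)) ≤ B x) :
    PolyTime fun x => (l x).foldl (f x) (s x) := by
  by_cases hne : ∀ x, l x = []
  · simpa only [hne, List.foldl_nil] using hs
  obtain ⟨x₀, hx₀⟩ := not_forall.1 hne
  -- the list is never empty where the default value `d` is used
  obtain ⟨d, -⟩ := List.exists_mem_of_ne_nil _ hx₀
  let step : α × List β × σ → α × List β × σ := fun p =>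
    (p.1, p.2.1.tail, f p.1 p.2.2 (p.2.1.headD d))
  have hstep : PolyTime step := by
    have : PolyTime fun p : α × List β × σ => f p.1 p.2.2 (p.2.1.headD d) :=
      hf.comp (f := fun p : α × List β × σ => (p.1, p.2.2, p.2.1.headD d)) (by fun_prop)
    simp only [step]
    fun_prop
  have hiter : ∀ x, ∀ i ≤ (l x).length, step^[i] (x, l x, s x) =
      (x, (l x).drop i, ((l x).take i).foldl (f x) (s x)) := by
    intro x i
    induction i with
    | zero => intro _; simp
    | succ i ih =>
      intro hi
      rw [Function.iterate_succ_apply', ih (by omega)]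
      have hd : (l x).drop i = (l x)[i] :: (l x).drop (i + 1) := List.drop_eq_getElem_cons (by omega)
      simp only [step, hd, List.tail_cons, List.headD_cons]
      rw [List.take_succ_eq_append_getElem (by omega), List.foldl_append]
      rfl
  have := iterate (step := step) (c := fun p => bif p.2.1.isEmpty then false else true)
    (s := fun x => (x, l x, s x)) (N := fun x => (l x).length)
    (B := fun x => 2 + size x + (size (l x) + B x)) hstep (by fun_prop) (by fun_prop)
    (hl.bdd.mono fun x => length_le_size _) (((PolyBdd.const 2).add .size).add (hl.bdd.add hB))
    (fun x i hi => by
      rw [hiter x i hi, size_pair, size_pair]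
      have h1 := h x _ ((l x).take_prefix i)
      have h2 := size_le_of_suffix ((l x).drop_suffix i)
      omega)
    (fun x i hi => by
      rw [hiter x i hi.le]
      have : ((l x).drop i).isEmpty = false := by simp; omega
      simp [this])
    (fun x => by rw [hiter x _ le_rfl]; simp)
  have hres : ∀ x, (step^[(l x).length] (x, l x, s x)).2.2 = (l x).foldl (f x) (s x) := by
    intro x; rw [hiter x _ le_rfl]; simp
  simpa only [hres] using this.snd.snd

end PolyTime

/-! ### Booleans, symbols and lists -/

/-- The symbols of the input alphabet, in the order in which they are numbered. -/
def symList : List Sym :=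
  [.tick, .sep, .close, .bit true, .bit false, .minus, .slash, .top, .bot, .pos, .neg, .and, .or]

instance : Enc Sym := ⟨fun s => (Dat.cons .nil)^[symList.idxOf s] .nil⟩

theorem size_sym_le (s : Sym) : size s ≤ 25 := by
  rcases s with _ | _ | _ | (_ | _) | _ <;> decide

namespace PolyTime

@[fun_prop]
theorem not {f : α → Bool} (hf : PolyTime f) : PolyTime fun x => !(f x) := by
  have : PolyTime fun x => bif f x then false else true := by fun_prop
  simpa using this

@[fun_prop]
theorem and {f g : α → Bool} (hf : PolyTime f) (hg : PolyTime g) :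
    PolyTime fun x => f x && g x := by
  have : PolyTime fun x => bif f x then g x else false := by fun_prop
  simpa using this

@[fun_prop]
theorem or {f g : α → Bool} (hf : PolyTime f) (hg : PolyTime g) :
    PolyTime fun x => f x || g x := by
  have : PolyTime fun x => bif f x then true else g x := by fun_prop
  simpa using this

@[fun_prop]
theorem xor {f g : α → Bool} (hf : PolyTime f) (hg : PolyTime g) :
    PolyTime fun x => f x ^^ g x := by
  have : PolyTime fun x => bif f x then !(g x) else g x := by fun_prop
  exact (funext fun x => by cases f x <;> simp :
    (fun x => bif f x then !(g x) else g x) = fun x => f x ^^ g x) ▸ this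

@[fun_prop]
theorem beqBool {f g : α → Bool} (hf : PolyTime f) (hg : PolyTime g) :
    PolyTime fun x => f x == g x := by
  have : PolyTime fun x => !(f x ^^ g x) := by fun_prop
  exact (funext fun x => by cases f x <;> cases g x <;> rfl :
    (fun x => !(f x ^^ g x)) = fun x => f x == g x) ▸ this

/-- Every function on the finite input alphabet is in polynomial time. -/
theorem ofSym (g : Sym → β) : PolyTime g := by
  have table : ∀ t : List β, ∃ F : Dat → β, PolyTime F ∧
      ∀ i (h : i < t.length), F ((Dat.cons .nil)^[i] .nil) = t[i] := by
    intro t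
    induction t with
    | nil => exact ⟨fun _ => g .tick, const _, fun i h => absurd h (by simp)⟩
    | cons b t ih =>
      obtain ⟨F, hF, h⟩ := ih
      refine ⟨fun d => bif d.isCons then F d.right else b,
        cond datIsCons (hF.comp datRight) (const b), fun i hi => ?_⟩
      cases i with
      | zero => rfl
      | succ i =>
        rw [Function.iterate_succ_apply']
        exact h i (by simpa using hi)
  obtain ⟨F, hF, h⟩ := table (symList.map g)
  refine of_enc hF Enc.enc (fun _ => rfl) fun s => congrArg Enc.enc ?_
  have hs : symList.idxOf s < symList.length :=
    List.idxOf_lt_length_of_mem (by rcases s with _ | _ | _ | (_ | _) | _ <;> decide)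
  refine (h _ (by simpa using hs)).trans ?_
  rw [List.getElem_map, List.getElem_idxOf]

@[fun_prop]
theorem beqSym {f : α → Sym} (hf : PolyTime f) (s : Sym) : PolyTime fun x => f x == s :=
  (ofSym fun t => t == s).comp hf

/-- Folds in which the intermediate value grows by a polynomially bounded amount at each step. -/
theorem foldl_of_add {l : α → List β} {s : α → σ} {f : α → σ → β → σ} {C : α → ℕ}
    (hf : PolyTime fun p : α × σ × β => f p.1 p.2.1 p.2.2) (hs : PolyTime s) (hl : PolyTime l)
    (hC : PolyBdd C) (h : ∀ x s, ∀ b ∈ l x, size (f x s b) ≤ size s + C x) :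
    PolyTime fun x => (l x).foldl (f x) (s x) := by
  refine foldl hf hs hl (B := fun x => size (s x) + size (l x) * C x)
    (hs.bdd.add (hl.bdd.mul hC)) fun x l' hl' => ?_
  suffices H : ∀ (l' : List β) (t : σ), (∀ b ∈ l', b ∈ l x) →
      size (l'.foldl (f x) t) ≤ size t + l'.length * C x by
    refine (H l' _ fun b hb => hl'.subset hb).trans ?_
    gcongr
    exact hl'.length_le.trans (length_le_size _)
  intro l'
  induction l' with
  | nil => intro t _; simp
  | cons b l' ih =>
    intro t hb
    have h1 := h x t b (hb b (by simp))
    have h2 := ih (f x t b) fun c hc => hb c (by simp [hc])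
    simp only [List.foldl_cons, List.length_cons, add_mul, one_mul]
    omega

/-- Values on the elements of a list are polynomially bounded. -/
theorem exists_bdd_of_mem {l : α → List β} {f : α → β → γ}
    (hf : PolyTime fun p : α × β => f p.1 p.2) (hl : PolyTime l) :
    ∃ C : α → ℕ, PolyBdd C ∧ ∀ x, ∀ b ∈ l x, size (f x b) ≤ C x := by
  obtain ⟨P, hP⟩ := hf.bdd
  refine ⟨fun x => P.eval (1 + size x + size (l x)),
    (((PolyBdd.const 1).add .size).add hl.bdd).eval P, fun x b hb => (hP (x, b)).trans ?_⟩
  refine eval_mono P ?_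
  rw [size_pair]
  have := size_le_of_mem hb
  omega

@[fun_prop]
theorem reverse {l : α → List β} (hl : PolyTime l) : PolyTime fun x => (l x).reverse := by
  have := foldl_of_add (f := fun (_ : α) (s : List β) b => b :: s) (s := fun _ => [])
    (C := fun x => 1 + size (l x)) (by fun_prop) (by fun_prop) hl ((PolyBdd.const 1).add hl.bdd)
    fun x s b hb => by have := size_le_of_mem hb; rw [size_cons]; omega
  simpa using this

@[fun_prop]
theorem append {l l' : α → List β} (hl : PolyTime l) (hl' : PolyTime l') :
    PolyTime fun x => l x ++ l' x := by
  have := foldl_of_add (f := fun (_ : α) (s : List β) b => b :: s) (s := l')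
    (l := fun x => (l x).reverse) (C := fun x => 1 + size (l x)) (by fun_prop) hl' (by fun_prop)
    ((PolyBdd.const 1).add hl.bdd)
    fun x s b hb => by have := size_le_of_mem (List.mem_reverse.1 hb); rw [size_cons]; omega
  simpa using this

theorem map {l : α → List β} {f : α → β → γ} (hf : PolyTime fun p : α × β => f p.1 p.2)
    (hl : PolyTime l) : PolyTime fun x => (l x).map (f x) := by
  obtain ⟨C, hC, h⟩ := exists_bdd_of_mem hf hl
  have := (foldl_of_add (f := fun x (s : List γ) b => f x b :: s) (s := fun _ => [])
    (C := fun x => 1 + C x)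
    (cons (hf.comp (f := fun p : α × List γ × β => (p.1, p.2.2)) (by fun_prop)) (by fun_prop))
    (by fun_prop) hl ((PolyBdd.const 1).add hC)
    fun x s b hb => by have := h x b hb; rw [size_cons]; omega).reverse
  have e : ∀ (x : α) (l : List β) (r : List γ),
      l.foldl (fun s b => f x b :: s) r = (l.map (f x)).reverse ++ r := by
    intro x l
    induction l <;> simp_all
  simpa [e] using this

/-- Dropping as many elements from a list as another list has. -/
@[fun_prop]
theorem drop {l : α → List β} {k : α → List γ} (hl : PolyTime l) (hk : PolyTime k) :
    PolyTime fun x => (l x).drop (k x).length := by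
  have e : ∀ (k : List γ) (l : List β), k.foldl (fun s _ => s.tail) l = l.drop k.length := by
    intro k
    induction k with
    | nil => simp
    | cons a k ih => intro l; rw [List.foldl_cons, ih]; simp
  have := foldl_of_add (f := fun (_ : α) (s : List β) (_ : γ) => s.tail) (s := l) (l := k)
    (C := fun x => 0) (by fun_prop) hl hk (.const 0)
    fun x s b hb => size_le_of_suffix (List.tail_suffix s)
  simpa only [e] using this

theorem zipWithBool {l l' : α → List Bool} (f : Bool → Bool → Bool)
    (hl : PolyTime l) (hl' : PolyTime l') : PolyTime fun x => (l x).zipWith f (l' x) := by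
  have e : ∀ (l l' r : List Bool), (l.foldl (fun (s : List Bool × List Bool) b =>
      bif s.1.isEmpty then s else (s.1.tail, f b (s.1.headD false) :: s.2)) (l', r)).2 =
      (l.zipWith f l').reverse ++ r := by
    intro l
    induction l with
    | nil => simp
    | cons a l ih =>
      intro l' r
      cases l' with
      | nil =>
        have h := ih [] r
        rw [List.foldl_cons]
        simpa using h
      | cons b l' =>
        rw [List.foldl_cons, List.zipWith_cons_cons]
        have h := ih l' (f a b :: r)
        simpa using h
  have hf : PolyTime fun p : Bool × Bool => f p.1 p.2 := by
    have : PolyTime fun p : Bool × Bool =>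
      bif p.1 then (bif p.2 then f true true else f true false)
        else (bif p.2 then f false true else f false false) := by fun_prop
    exact (funext fun p => by rcases p with ⟨_ | _, _ | _⟩ <;> rfl :
      (fun p : Bool × Bool => bif p.1 then (bif p.2 then f true true else f true false)
        else (bif p.2 then f false true else f false false)) = fun p => f p.1 p.2) ▸ this
  have := (foldl_of_add (f := fun (_ : α) (s : List Bool × List Bool) b =>
      bif s.1.isEmpty then s else (s.1.tail, f b (s.1.headD false) :: s.2))
    (s := fun x => (l' x, [])) (l := l) (C := fun x => 4)
    (cond (by fun_prop) (by fun_prop) (prodMk (by fun_prop) (cons (hf.comp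
      (f := fun p : α × (List Bool × List Bool) × Bool => (p.2.2, p.2.1.1.headD false))
      (by fun_prop)) (by fun_prop)))) (by fun_prop) hl (.const 4)
    fun x s b hb => by
      rcases s with ⟨s, t⟩
      have h1 := size_bool_le (f b (s.headD false))
      have h2 := size_le_of_suffix (List.tail_suffix s)
      cases h : s.isEmpty
      · simp only [cond_false, size_pair, size_cons]; omega
      · simp).snd.reverse
  simpa only [e, List.append_nil, List.reverse_reverse] using this

end PolyTime

/-! ### Arithmetic -/

theorem size_nat_le {n k : ℕ} (h : n < 2 ^ k) : size n ≤ 4 * k + 1 := by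
  have h1 : size n = size n.bits := rfl
  have h2 := size_list_le (l := n.bits) (k := 3) fun b _ => size_bool_le b
  rw [Nat.size_eq_bits_len] at h2
  have h3 := Nat.size_le.2 h
  omega

theorem lt_two_pow_size (n : ℕ) : n < 2 ^ size n := by
  refine (Nat.lt_size_self n).trans_le (Nat.pow_le_pow_right (by norm_num) ?_)
  rw [← Nat.size_eq_bits_len]
  exact length_le_size n.bits

/-- The number with given binary digits, the most significant one first. -/
def ofDigits (l : List Bool) : ℕ := l.foldl (fun n b => Nat.bit b n) 0

theorem foldl_bit (l : List Bool) (n : ℕ) :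
    l.foldl (fun n b => Nat.bit b n) n = n * 2 ^ l.length + ofDigits l := by
  induction l generalizing n with
  | nil => simp [ofDigits]
  | cons b l ih =>
    rw [ofDigits, List.foldl_cons, List.foldl_cons, ih, ih (Nat.bit b 0), Nat.bit_val, Nat.bit_val,
      List.length_cons, pow_succ]
    ring

theorem ofDigits_cons (b : Bool) (l : List Bool) :
    ofDigits (b :: l) = b.toNat * 2 ^ l.length + ofDigits l := by
  rw [ofDigits, List.foldl_cons, foldl_bit, Nat.bit_val]; simp

theorem bits_bit (b : Bool) (n : ℕ) :
    (Nat.bit b n).bits = bif b || !n.bits.isEmpty then b :: n.bits else [] := by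
  by_cases hn : n = 0
  · subst hn
    cases b
    · simp
    · rw [Nat.bits_append_bit _ _ (fun _ => rfl)]; simp
  · rw [Nat.bits_append_bit _ _ (fun h => absurd h hn)]
    have : n.bits ≠ [] := fun h => hn (by
      have := Nat.size_eq_bits_len n
      rw [h] at this
      exact Nat.size_eq_zero.1 (by simpa using this.symm))
    cases h : n.bits with
    | nil => exact absurd h this
    | cons c t => simp

theorem ofDigits_reverse_bits (n : ℕ) : ofDigits n.bits.reverse = n := by
  induction n using Nat.binaryRec' with
  | zero => simp [ofDigits]
  | bit b n h ih =>
    rw [Nat.bits_append_bit _ _ h, List.reverse_cons, ofDigits, List.foldl_append]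
    rw [ofDigits] at ih
    rw [ih]; rfl

namespace PolyTime

@[fun_prop]
theorem bits {f : α → ℕ} (hf : PolyTime f) : PolyTime fun x => (f x).bits :=
  of_enc hf (fun x => x) (fun _ => rfl) fun _ => rfl

@[fun_prop]
theorem bit {f : α → Bool} {g : α → ℕ} (hf : PolyTime f) (hg : PolyTime g) :
    PolyTime fun x => Nat.bit (f x) (g x) := by
  refine of_enc (F := fun x => bif f x || !(g x).bits.isEmpty then f x :: (g x).bits else [])
    (by fun_prop) (fun x => x) (fun _ => rfl) fun x => ?_
  rw [← bits_bit]; rfl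

@[fun_prop]
theorem bodd {f : α → ℕ} (hf : PolyTime f) : PolyTime fun x => (f x).bodd := by
  have : PolyTime fun x => (f x).bits.headD false := by fun_prop
  refine (funext fun x => ?_ : _ = fun x => (f x).bodd) ▸ this
  rw [Nat.bodd_eq_bits_head]
  cases (f x).bits <;> rfl

@[fun_prop]
theorem div2 {f : α → ℕ} (hf : PolyTime f) : PolyTime fun x => (f x).div2 :=
  of_enc (F := fun x => (f x).bits.tail) (by fun_prop) (fun x => x) (fun _ => rfl)
    fun x => by rw [← Nat.div2_bits_eq_tail]; rfl

@[fun_prop]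
theorem ofDigits {l : α → List Bool} (hl : PolyTime l) : PolyTime fun x => ofDigits (l x) :=
  foldl_of_add (f := fun (_ : α) n b => Nat.bit b n) (s := fun _ => 0) (C := fun _ => 4)
    (by fun_prop) (by fun_prop) hl (.const 4) fun x n b _ => by
      change size (Nat.bit b n).bits ≤ size n.bits + 4
      have := size_bool_le b
      rw [bits_bit]
      cases b || !n.bits.isEmpty
      · rw [cond_false, size_nil]; omega
      · rw [cond_true, size_cons]; omega

end PolyTime

/-- A step of the binary addition: `s` consists of the parts of the summands that are still to be
read, of the carry, and of the digits computed so far, the most significant one first. -/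
def addStep (s : (ℕ × ℕ) × Bool × List Bool) : (ℕ × ℕ) × Bool × List Bool :=
  ((s.1.1.div2, s.1.2.div2),
    bif s.1.1.bodd == s.1.2.bodd then s.1.1.bodd else s.2.1,
    (s.1.1.bodd ^^ s.1.2.bodd ^^ s.2.1) :: s.2.2)

/-- The sum of the remaining parts and the carry is halved at each step, and the digit that is put
out is its parity. -/
theorem foldl_addStep (l : List Bool) : ∀ (a b : ℕ) (c : Bool) (r : List Bool),
    a + b + c.toNat < 2 ^ l.length →
      ofDigits (l.foldl (fun s _ => addStep s) ((a, b), c, r)).2.2 =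
        ofDigits r + (a + b + c.toNat) * 2 ^ r.length := by
  induction l with
  | nil =>
    intro a b c r h
    rw [List.length_nil, pow_zero, Nat.lt_one_iff] at h
    simp [h]
  | cons d l ih =>
    intro a b c r h
    rw [List.foldl_cons, addStep]
    have ha := Nat.bodd_add_div2 a
    have hb := Nat.bodd_add_div2 b
    rw [List.length_cons, pow_succ] at h
    dsimp only
    have key : a + b + c.toNat = (a.bodd ^^ b.bodd ^^ c).toNat +
        2 * (a.div2 + b.div2 + (bif a.bodd == b.bodd then a.bodd else c).toNat) := by
      cases h1 : a.bodd <;> cases h2 : b.bodd <;> cases c <;>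
        rw [h1] at ha <;> rw [h2] at hb <;> simp at * <;> omega
    rw [ih _ _ _ _ (by omega), ofDigits_cons, List.length_cons, pow_succ, key]
    ring

/-- A step of the comparison of binary numbers: `s` consists of the parts of the numbers that are
still to be read, and of the outcome for the digits read so far. -/
def leStep (s : (ℕ × ℕ) × Bool) : (ℕ × ℕ) × Bool :=
  ((s.1.1.div2, s.1.2.div2), bif s.1.1.bodd == s.1.2.bodd then s.2 else s.1.2.bodd)

theorem foldl_leStep (l : List Bool) : ∀ (a b : ℕ) (c : Bool), a < 2 ^ l.length →
    b < 2 ^ l.length → (l.foldl (fun s _ => leStep s) ((a, b), c)).2 =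
      decide (a < b ∨ a = b ∧ c = true) := by
  induction l with
  | nil =>
    intro a b c ha hb
    rw [List.length_nil, pow_zero, Nat.lt_one_iff] at ha hb
    simp [ha, hb]
  | cons d l ih =>
    intro a b c h h'
    rw [List.foldl_cons, leStep]
    have ha := Nat.bodd_add_div2 a
    have hb := Nat.bodd_add_div2 b
    rw [List.length_cons, pow_succ] at h h'
    dsimp only
    rw [ih _ _ _ (by omega) (by omega), decide_eq_decide]
    cases h1 : a.bodd <;> cases h2 : b.bodd <;> cases c <;>
      rw [h1] at ha <;> rw [h2] at hb <;> simp at * <;> omega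

/-- Multiplication by Horner's scheme. -/
theorem foldl_mul (l : List Bool) (b : ℕ) : ∀ n : ℕ,
    l.foldl (fun n d => bif d then Nat.bit false n + b else Nat.bit false n) n =
      n * 2 ^ l.length + ofDigits l * b := by
  induction l with
  | nil => simp [ofDigits]
  | cons d l ih =>
    intro n
    rw [List.foldl_cons, ih, ofDigits_cons, List.length_cons, pow_succ]
    cases d <;> simp [Nat.bit_val] <;> ring

namespace PolyTime

@[fun_prop]
theorem add {f g : α → ℕ} (hf : PolyTime f) (hg : PolyTime g) : PolyTime fun x => f x + g x := by
  have := (foldl_of_add (f := fun (_ : α) s (_ : Bool) => addStep s)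
    (s := fun x => ((f x, g x), false, []))
    (l := fun x => true :: ((f x).bits ++ (g x).bits)) (C := fun _ => 6)
    (by unfold addStep; fun_prop) (by fun_prop) (by fun_prop) (.const 6) fun x s b hb => by
      rcases s with ⟨⟨a, b⟩, c, r⟩
      have h1 : size a.div2 ≤ size a := by
        change size a.div2.bits ≤ size a.bits
        rw [Nat.div2_bits_eq_tail]; exact size_le_of_suffix (List.tail_suffix _)
      have h2 : size b.div2 ≤ size b := by
        change size b.div2.bits ≤ size b.bits
        rw [Nat.div2_bits_eq_tail]; exact size_le_of_suffix (List.tail_suffix _)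
      have h3 := size_bool_le (bif a.bodd == b.bodd then a.bodd else c)
      have h4 := size_bool_le (a.bodd ^^ b.bodd ^^ c)
      have h5 : 1 ≤ size c := by cases c <;> decide
      simp only [addStep, size_pair, size_cons]
      omega).snd.snd.ofDigits
  refine (funext fun x => ?_ : _ = fun x => f x + g x) ▸ this
  rw [foldl_addStep]
  · simp [OptNNF.ofDigits]
  · rw [List.length_cons, List.length_append, Nat.size_eq_bits_len, Nat.size_eq_bits_len,
      pow_succ]
    have h1 := Nat.lt_size_self (f x)
    have h2 := Nat.lt_size_self (g x)
    have h3 : 2 ^ (f x).size ≤ 2 ^ ((f x).size + (g x).size) :=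
      Nat.pow_le_pow_right (by norm_num) (by omega)
    have h4 : 2 ^ (g x).size ≤ 2 ^ ((f x).size + (g x).size) :=
      Nat.pow_le_pow_right (by norm_num) (by omega)
    simp only [Bool.toNat_false]
    omega

@[fun_prop]
theorem natLE {f g : α → ℕ} (hf : PolyTime f) (hg : PolyTime g) :
    PolyTime fun x => decide (f x ≤ g x) := by
  have := (foldl_of_add (f := fun (_ : α) s (_ : Bool) => leStep s)
    (s := fun x => ((f x, g x), true))
    (l := fun x => (f x).bits ++ (g x).bits) (C := fun _ => 2)
    (by unfold leStep; fun_prop) (by fun_prop) (by fun_prop) (.const 2) fun x s b hb => by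
      rcases s with ⟨⟨a, b⟩, c⟩
      have h1 : size a.div2 ≤ size a := by
        change size a.div2.bits ≤ size a.bits
        rw [Nat.div2_bits_eq_tail]; exact size_le_of_suffix (List.tail_suffix _)
      have h2 : size b.div2 ≤ size b := by
        change size b.div2.bits ≤ size b.bits
        rw [Nat.div2_bits_eq_tail]; exact size_le_of_suffix (List.tail_suffix _)
      have h3 := size_bool_le (bif a.bodd == b.bodd then c else b.bodd)
      have h5 : 1 ≤ size c := by cases c <;> decide
      simp only [leStep, size_pair]
      omega).snd
  refine (funext fun x => ?_ : _ = fun x => decide (f x ≤ g x)) ▸ this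
  have h1 := Nat.lt_size_self (f x)
  have h2 := Nat.lt_size_self (g x)
  rw [foldl_leStep, decide_eq_decide]
  · simp; omega
  · rw [List.length_append, Nat.size_eq_bits_len, Nat.size_eq_bits_len]
    exact h1.trans_le (Nat.pow_le_pow_right (by norm_num) (by omega))
  · rw [List.length_append, Nat.size_eq_bits_len, Nat.size_eq_bits_len]
    exact h2.trans_le (Nat.pow_le_pow_right (by norm_num) (by omega))

@[fun_prop]
theorem mul {f g : α → ℕ} (hf : PolyTime f) (hg : PolyTime g) : PolyTime fun x => f x * g x := by
  have := foldl (f := fun (x : α) n d => bif d then Nat.bit false n + g x else Nat.bit false n)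
    (s := fun x => 0) (l := fun x => (f x).bits.reverse)
    (B := fun x => 4 * (size (f x) + size (g x)) + 1)
    (cond (by fun_prop) (by fun_prop) (by fun_prop))
    (by fun_prop) (by fun_prop) (((PolyBdd.const 4).mul (hf.bdd.add hg.bdd)).add (.const 1))
    fun x l hl => size_nat_le (by
      rw [foldl_mul, zero_mul, zero_add, pow_add]
      refine Nat.mul_lt_mul_of_lt_of_le ?_ (lt_two_pow_size _).le (by positivity : 0 < 2 ^ size (g x))
      have hlen : l.length ≤ size (f x) :=
        hl.length_le.trans (by rw [List.length_reverse]; exact length_le_size _)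
      refine lt_of_lt_of_le ?_ (Nat.pow_le_pow_right (by norm_num) hlen)
      clear hlen hl
      induction l with
      | nil => simp [OptNNF.ofDigits]
      | cons b l ih =>
        rw [ofDigits_cons, List.length_cons, pow_succ]
        cases b <;> simp <;> omega)
  refine (funext fun x => ?_ : _ = fun x => f x * g x) ▸ this
  rw [foldl_mul, ofDigits_reverse_bits]; simp

end PolyTime

/-! ### The algorithm -/

/-- A part of the input: a symbol with the words that follow it, each written backwards, the last
word first. -/
abbrev Item : Type := Sym × List (List Sym)

/-- A step of the division of the input into items; the state consists of the items read so far,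
the last one first, and of the word that is being read, backwards. A word ends at `sep` or `slash`,
and any other symbol than a digit begins an item. The separator of an initial word
stands for the symbol of its item. -/
def itemStep (s : List Item × List Sym) (a : Sym) : List Item × List Sym :=
  bif a == .tick || a == .bit true || a == .bit false then (s.1, a :: s.2)
  else bif a == .sep then
    (((s.1.headD (.sep, [])).1, s.2 :: (s.1.headD (.sep, [])).2) :: s.1.tail, [])
  else bif a == .slash then ((.slash, [s.2]) :: s.1, [])
  else ((a, []) :: s.1, s.2)

/-- The division of the input into items. -/
def items (l : List Sym) : List Item := (l.foldl itemStep ([], [])).1.reverse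

/-- Fractions: `((p, q), d)` stands for `(p - q) / d`. -/
abbrev Frac : Type := (ℕ × ℕ) × ℕ

namespace Frac

/-- The sum of two fractions. -/
def add (a b : Frac) : Frac :=
  ((a.1.1 * b.2 + b.1.1 * a.2, a.1.2 * b.2 + b.1.2 * a.2), a.2 * b.2)

/-- The comparison of two fractions. -/
def le (a b : Frac) : Bool :=
  decide (a.1.1 * b.2 + b.1.2 * a.2 ≤ b.1.1 * a.2 + a.1.2 * b.2)

/-- The fraction `0`. -/
def zero : Frac := ((0, 0), 1)

end Frac

/-- A literal (the item of a leaf) with its weight. -/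
abbrev Entry : Type := Item × Frac

/-- The number that a word of binary digits, written backwards, represents. -/
def wordVal (w : List Sym) : ℕ := ofDigits (w.map fun a => a == .bit true)

/-- The weight with a given sign and the absolute value given by the words `[denominator,
numerator]`. -/
def weightOf (neg : Bool) (ws : List (List Sym)) : Frac :=
  (bif neg then (0, wordVal (ws.tail.headD [])) else (wordVal (ws.tail.headD []), 0),
    wordVal (ws.headD []))

/-- The state of the reader of items: whether the children of a node are being read, whether the
hard constraint has been read, the nodes of the hard constraint, the literal and the sign of the
weight that is being read, and the weighted literals; the lists are reversed. -/
abbrev ReadState : Type := (Bool × Bool) × List Item × (Item × Bool) × List Entry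

/-- A step of the reader of items. -/
def readStep (s : ReadState) (it : Item) : ReadState :=
  bif s.1.2 then
    bif it.1 == .close then s
    else bif it.1 == .minus then (s.1, s.2.1, (s.2.2.1.1, true), s.2.2.2)
    else bif it.1 == .slash then
      (s.1, s.2.1, ((.top, []), false), (s.2.2.1.1, weightOf s.2.2.1.2 it.2) :: s.2.2.2)
    else (s.1, s.2.1, (it, false), s.2.2.2)
  else bif it.1 == .close then ((false, !s.1.1), s.2)
  else ((it.1 == .and || it.1 == .or, false), it :: s.2.1, s.2.2)

/-- The initial state of the reader of items. -/
def readInit : ReadState := ((false, false), [], ((.top, []), false), [])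

/-- The element whose index is given in unary. -/
def lookup {δ : Type} (l : List δ) (i : List Sym) (d : δ) : δ := (l.drop i.length).headD d

/-- The truth value of a literal, given the list of the values of the variables. -/
def litVal (it : Item) (ω : List Bool) : Bool :=
  bif it.1 == .top then true else bif it.1 == .bot then false
  else (it.1 == .pos) == lookup ω (it.2.headD []) false

/-- The sum of the weights of the satisfied literals. -/
def objective (B : List Entry) (ω : List Bool) : Frac :=
  B.foldl (fun a e => bif litVal e.1 ω then a.add e.2 else a) .zero

/-- The power `K ^ r`, where `r` is the number of elements of `V` that are less than `v`. -/
def rankPow (V : List Frac) (K : ℕ) (v : Frac) : ℕ :=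
  V.foldl (fun a u => bif v.le u then a else a * K) 1

/-- The number `2 ^ V.length`. -/
def powLength (V : List Frac) : ℕ := V.foldl (fun a _ => Nat.bit false a) 1

/-- The values that scores can take: `0` and the weights. -/
def scoreValues (B : List Entry) : List Frac := .zero :: B.map fun e => e.2

/-- The weights for which the sum of the scores orders the interpretations as `leximax` does:
a score `v` is replaced by `K ^ r`, where `r` is its rank and `K` exceeds the number of scores
(shifted so that the score `0` of an unsatisfied literal becomes `0`). -/
def lexBase (B : List Entry) : List Entry :=
  B.map fun e => (e.1, (rankPow (scoreValues B) (powLength (scoreValues B)) e.2,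
    rankPow (scoreValues B) (powLength (scoreValues B)) .zero), 1)

/-- The weights for which the interpretations are to be compared by their sums of scores. -/
def sumBase : Aggregator → List Entry → List Entry
  | .sum, B => B
  | .leximax, B => lexBase B

/-- The indices of the variables, in unary. -/
def vars (n : List Sym) : List (List Sym) :=
  (List.range n.length).map fun i => List.replicate i Sym.tick

/-- Whether two indices in unary are equal. -/
def sameIdx (x y : List Sym) : Bool := (x.drop y.length).isEmpty && (y.drop x.length).isEmpty

/-- The list of the values of the variables at which only `x` is true. -/
def oneHot (vs : List (List Sym)) (x : List Sym) : List Bool := vs.map fun y => sameIdx y x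

/-- The list of the values of the variables at which all are false. -/
def zeros (vs : List (List Sym)) : List Bool := vs.map fun _ => false

/-- The interpretation that minimizes the sum of the scores. -/
def bestInterp (B : List Entry) (vs : List (List Sym)) : List Bool :=
  vs.map fun x => (objective B (oneHot vs x)).le (objective B (zeros vs))

/-- The data on which the evaluation of a circuit depends: the weighted literals, the variables, and
the interpretation that minimizes the sum of the scores. -/
abbrev Ctx : Type := List Entry × List (List Sym) × List Bool

/-- The better of two models, each given by the set of variables at which it differs from the best
interpretation. -/
def better (c : Ctx) (a b : List Bool) : List Bool :=
  bif (objective c.1 (c.2.2.zipWith (· ^^ ·) a)).le (objective c.1 (c.2.2.zipWith (· ^^ ·) b))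
  then a else b

/-- Combine the models of two children of a conjunction. -/
def andStep (T : List (Option (List Bool))) (a : Option (List Bool)) (j : List Sym) :
    Option (List Bool) :=
  bif a.isSome && (lookup T j none).isSome
  then some ((a.getD []).zipWith (· || ·) ((lookup T j none).getD [])) else none

/-- Choose between the models of two children of a disjunction. -/
def orStep (c : Ctx) (T : List (Option (List Bool))) (a : Option (List Bool)) (j : List Sym) :
    Option (List Bool) :=
  bif (lookup T j none).isSome then
    bif a.isSome then some (better c (a.getD []) ((lookup T j none).getD [])) else lookup T j none
  else a

/-- An optimal model of a node, if it has a model, given optimal models of the nodes before it. -/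
def nodeVal (c : Ctx) (T : List (Option (List Bool))) (it : Item) : Option (List Bool) :=
  bif it.1 == .top then some (zeros c.2.1)
  else bif it.1 == .bot then none
  else bif it.1 == .and then it.2.foldl (andStep T) (some (zeros c.2.1))
  else bif it.1 == .or then it.2.foldl (orStep c T) none
  else bif lookup c.2.2 (it.2.headD []) false == (it.1 == .pos) then some (zeros c.2.1)
  else some (oneHot c.2.1 (it.2.headD []))

/-- Optimal models of the nodes of a circuit. -/
def table (c : Ctx) (nodes : List Item) : List (Option (List Bool)) :=
  nodes.foldl (fun T it => T ++ [nodeVal c T it]) []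

/-- The answer, encoded, for a model of the root. -/
def answerOf (c : Ctx) (r : Option (List Bool)) : List Bool :=
  bif r.isSome then true :: c.2.2.zipWith (· ^^ ·) (r.getD []) else [false]

/-- The data for a list of weighted literals and a set of variables. -/
def mkCtx (B : List Entry) (vs : List (List Sym)) : Ctx := (B, vs, bestInterp B vs)

/-- The answer computed from the items of the input. -/
def solveItems (agg : Aggregator) (its : List Item) : List Bool :=
  let s := its.tail.foldl readStep readInit
  let c := mkCtx (sumBase agg s.2.2.2.reverse) (vars ((its.headD (.sep, [])).2.headD []))
  answerOf c ((table c s.2.1.reverse).reverse.headD none)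

/-- The algorithm. The input is given backwards and the answer is returned backwards, because of
the order in which a machine moves words between stacks. -/
def solveRev (agg : Aggregator) (l : List Sym) : List Bool :=
  (solveItems agg (items l.reverse)).reverse

/-! ### The algorithm takes polynomial time -/

/-- The three numbers of a fraction are less than `2 ^ k`. -/
def Frac.Small (a : Frac) (k : ℕ) : Prop :=
  a.1.1 < 2 ^ k ∧ a.1.2 < 2 ^ k ∧ a.2 < 2 ^ k

theorem Frac.Small.size_le {a : Frac} {k : ℕ} (h : a.Small k) :
    size a ≤ 12 * k + 5 := by
  rcases a with ⟨⟨p, q⟩, d⟩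
  have h1 := size_nat_le h.1
  have h2 := size_nat_le h.2.1
  have h3 := size_nat_le h.2.2
  simp only [size_pair] at *
  omega

theorem Frac.small_size (a : Frac) : a.Small (size a) := by
  rcases a with ⟨⟨p, q⟩, d⟩
  have h : ∀ n k : ℕ, size n ≤ k → n < 2 ^ k := fun n k hk =>
    (lt_two_pow_size n).trans_le (Nat.pow_le_pow_right (by norm_num) hk)
  refine ⟨h _ _ ?_, h _ _ ?_, h _ _ ?_⟩ <;> simp only [size_pair] <;> omega

theorem Frac.Small.mono {a : Frac} {k l : ℕ} (h : a.Small k) (hkl : k ≤ l) :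
    a.Small l := by
  have := Nat.pow_le_pow_right (n := 2) (by norm_num) hkl
  exact ⟨h.1.trans_le this, h.2.1.trans_le this, h.2.2.trans_le this⟩

theorem Frac.Small.add {a b : Frac} {k l : ℕ} (ha : a.Small k) (hb : b.Small l) :
    (a.add b).Small (k + l + 1) := by
  have key : ∀ {x y : ℕ}, x < 2 ^ k → y < 2 ^ l → x * y < 2 ^ (k + l) := fun hx hy => by
    rw [pow_add]
    exact Nat.mul_lt_mul_of_lt_of_le hx hy.le (by positivity)
  have h1 := key ha.1 hb.2.2
  have h2 := key ha.2.2 hb.1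
  have h3 := key ha.2.1 hb.2.2
  have h4 := key ha.2.2 hb.2.1
  have h5 := key ha.2.2 hb.2.2
  simp only [Frac.Small, Frac.add, pow_succ, mul_comm b.1.1, mul_comm b.1.2]
  omega

namespace PolyTime

@[fun_prop]
theorem fracAdd {f g : α → Frac} (hf : PolyTime f) (hg : PolyTime g) :
    PolyTime fun x => (f x).add (g x) := by
  unfold Frac.add; fun_prop

@[fun_prop]
theorem fracLE {f g : α → Frac} (hf : PolyTime f) (hg : PolyTime g) :
    PolyTime fun x => (f x).le (g x) := by
  unfold Frac.le; fun_prop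

@[fun_prop]
theorem lookup {l : α → List β} {i : α → List Sym} {d : α → β} (hl : PolyTime l)
    (hi : PolyTime i) (hd : PolyTime d) : PolyTime fun x => lookup (l x) (i x) (d x) := by
  unfold OptNNF.lookup; fun_prop

@[fun_prop]
theorem litVal {f : α → Item} {ω : α → List Bool} (hf : PolyTime f) (hω : PolyTime ω) :
    PolyTime fun x => litVal (f x) (ω x) := by
  unfold OptNNF.litVal; fun_prop

@[fun_prop]
theorem sameIdx {f g : α → List Sym} (hf : PolyTime f) (hg : PolyTime g) :
    PolyTime fun x => sameIdx (f x) (g x) := by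
  unfold OptNNF.sameIdx; fun_prop

@[fun_prop]
theorem oneHot {vs : α → List (List Sym)} {f : α → List Sym} (hvs : PolyTime vs)
    (hf : PolyTime f) : PolyTime fun x => oneHot (vs x) (f x) :=
  map (f := fun x y => OptNNF.sameIdx y (f x)) (by fun_prop) hvs

@[fun_prop]
theorem zeros {vs : α → List (List Sym)} (hvs : PolyTime vs) : PolyTime fun x => zeros (vs x) :=
  map (f := fun _ _ => false) (by fun_prop) hvs

@[fun_prop]
theorem wordVal {w : α → List Sym} (hw : PolyTime w) : PolyTime fun x => wordVal (w x) :=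
  ofDigits (map (f := fun _ a => a == .bit true) (by fun_prop) hw)

@[fun_prop]
theorem weightOf {f : α → Bool} {g : α → List (List Sym)} (hf : PolyTime f) (hg : PolyTime g) :
    PolyTime fun x => weightOf (f x) (g x) := by
  unfold OptNNF.weightOf; fun_prop

@[fun_prop]
theorem items {l : α → List Sym} (hl : PolyTime l) : PolyTime fun x => items (l x) := by
  refine (foldl_of_add (f := fun _ s a => itemStep s a) (s := fun _ => ([], [])) (C := fun _ => 100)
    (by unfold itemStep; fun_prop) (by fun_prop) hl (.const 100) fun x s a _ => ?_).fst.reverse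
  rcases s with ⟨s, w⟩
  have h1 := size_sym_le a
  have h2 := size_sym_le Sym.slash
  have h3 := size_sym_le Sym.sep
  have h4 : 1 ≤ size w := by cases w <;> simp [size_nil, size_cons]; omega
  unfold itemStep
  cases a == Sym.tick || a == Sym.bit true || a == Sym.bit false
  · cases a == Sym.sep
    · cases a == Sym.slash
      · simp only [cond_false, size_pair, size_cons, size_nil]; omega
      · simp only [cond_false, cond_true, size_pair, size_cons, size_nil]; omega
    · cases s
      · simp only [cond_false, cond_true, size_pair, size_cons, size_nil, List.headD_nil,
          List.tail_nil]
        omega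
      · rename_i b s
        have := size_pair b.1 b.2
        rw [Prod.mk.eta] at this
        simp only [cond_false, cond_true, size_pair, size_cons, size_nil, List.headD_cons,
          List.tail_cons]
        omega
  · simp only [cond_true, size_pair, size_cons]; omega

/-- The state grows by at most the items that are stored and the weight that is computed. -/
theorem readItems {l : α → List Item} (hl : PolyTime l) :
    PolyTime fun x => (l x).foldl readStep readInit := by
  obtain ⟨C, hC, h⟩ := exists_bdd_of_mem (f := fun _ p => OptNNF.weightOf p.1 p.2)
    (l := fun x : α => (l x).map (fun it => (false, it.2)) ++ (l x).map fun it => (true, it.2))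
    (by fun_prop) (append (map (f := fun _ it => (false, it.2)) (by fun_prop) hl)
      (map (f := fun _ it => (true, it.2)) (by fun_prop) hl))
  refine foldl_of_add (f := fun _ s it => readStep s it) (s := fun _ => readInit)
    (C := fun x => 100 + size (l x) + C x)
    (by unfold readStep; fun_prop) (by fun_prop) hl (((PolyBdd.const 100).add hl.bdd).add hC)
    fun x s it hit => ?_
  rcases s with ⟨⟨o, d⟩, ns, ⟨lit, neg⟩, B⟩
  have h1 := size_le_of_mem hit
  have h2 : size (OptNNF.weightOf neg it.2) ≤ C x := h x (neg, it.2) (by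
    cases neg
    · exact List.mem_append_left _ (List.mem_map_of_mem hit)
    · exact List.mem_append_right _ (List.mem_map_of_mem hit))
  have h3 := size_sym_le Sym.top
  have h4 : ∀ b : Bool, size b ≤ 3 := size_bool_le
  have h5 : ∀ b : Bool, 1 ≤ size b := by decide
  have h6 := h4 (it.1 == .and || it.1 == .or)
  have h7 := h4 (!o)
  have h8 := h4 true
  have h9 := h4 false
  have h10 := h5 neg
  have h11 := h5 o
  have h12 := h5 d
  unfold readStep
  cases d
  · cases it.1 == Sym.close
    · simp only [cond_false, size_pair, size_cons] at *; omega
    · simp only [cond_false, cond_true, size_pair] at *; omega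
  · cases it.1 == Sym.close
    · cases it.1 == Sym.minus
      · cases it.1 == Sym.slash
        · simp only [cond_false, cond_true, size_pair] at *
          have : 1 ≤ size lit := by rw [← Prod.mk.eta (p := lit), size_pair]; omega
          omega
        · simp only [cond_false, cond_true, size_pair, size_cons, size_nil] at *; omega
      · simp only [cond_false, cond_true, size_pair] at *; omega
    · simp only [cond_true]; omega

@[fun_prop]
theorem objective {B : α → List Entry} {ω : α → List Bool} (hB : PolyTime B) (hω : PolyTime ω) :
    PolyTime fun x => objective (B x) (ω x) := by
  refine foldl (f := fun x a (e : Entry) => bif OptNNF.litVal e.1 (ω x) then a.add e.2 else a)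
    (s := fun _ => Frac.zero) (B := fun x => 12 * (1 + size (B x)) + 5) (by fun_prop) (by fun_prop)
    hB (((PolyBdd.const 12).mul ((PolyBdd.const 1).add hB.bdd)).add (.const 5)) fun x l hl => ?_
  refine (Frac.Small.size_le (k := 1 + size l) ?_).trans (by have := size_le_of_prefix hl; omega)
  suffices H : ∀ (l : List Entry) (a : Frac) (k : ℕ), a.Small k →
      (l.foldl (fun a (e : Entry) => bif OptNNF.litVal e.1 (ω x) then a.add e.2 else a) a).Small
        (k + size l) from H l .zero 1 (by simp [Frac.Small, Frac.zero])
  intro l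
  induction l with
  | nil => exact fun a k ha => ha.mono (by omega)
  | cons e l ih =>
    intro a k ha
    rw [List.foldl_cons, size_cons, ← add_assoc]
    refine ih _ _ ?_
    have h := size_pair e.1 e.2
    rw [Prod.mk.eta] at h
    cases OptNNF.litVal e.1 (ω x)
    · exact ha.mono (by omega)
    · exact (ha.add e.2.small_size).mono (by omega)

@[fun_prop]
theorem powLength {V : α → List Frac} (hV : PolyTime V) : PolyTime fun x => powLength (V x) := by
  refine foldl_of_add (f := fun (_ : α) a (_ : Frac) => Nat.bit false a) (s := fun _ => 1)
    (C := fun _ => 4) (by fun_prop) (by fun_prop) hV (.const 4) fun x n b _ => ?_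
  change size (Nat.bit false n).bits ≤ size n.bits + 4
  have := size_bool_le false
  rw [bits_bit]
  cases false || !n.bits.isEmpty
  · rw [cond_false, size_nil]; omega
  · rw [cond_true, size_cons]; omega

@[fun_prop]
theorem rankPow {V : α → List Frac} {K : α → ℕ} {v : α → Frac} (hV : PolyTime V)
    (hK : PolyTime K) (hv : PolyTime v) : PolyTime fun x => rankPow (V x) (K x) (v x) := by
  refine foldl (f := fun x a (u : Frac) => bif (v x).le u then a else a * K x)
    (s := fun _ => 1) (B := fun x => 4 * (size (V x) * size (K x) + 1) + 1) (by fun_prop)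
    (by fun_prop) hV
    (((PolyBdd.const 4).mul ((hV.bdd.mul hK.bdd).add (.const 1))).add (.const 1)) fun x l hl => ?_
  have hl : l.length ≤ size (V x) := hl.length_le.trans (length_le_size _)
  suffices H : ∀ (l : List Frac) (a k : ℕ), a < 2 ^ k →
      l.foldl (fun a (u : Frac) => bif (v x).le u then a else a * K x) a <
        2 ^ (k + l.length * size (K x)) from
    size_nat_le ((H l 1 1 (by norm_num)).trans_le (Nat.pow_le_pow_right (by norm_num) (by
      have := Nat.mul_le_mul_right (size (K x)) hl; omega)))
  intro l
  induction l with
  | nil => intro a k ha; simpa using ha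
  | cons u l ih =>
    intro a k ha
    rw [List.foldl_cons, List.length_cons, add_mul, one_mul, Nat.add_comm (l.length * _),
      ← add_assoc]
    refine ih _ _ ?_
    cases (v x).le u
    · rw [cond_false, pow_add]
      exact Nat.mul_lt_mul_of_lt_of_le ha (lt_two_pow_size _).le (by positivity)
    · exact ha.trans_le (Nat.pow_le_pow_right (by norm_num) (by omega))

@[fun_prop]
theorem scoreValues {B : α → List Entry} (hB : PolyTime B) :
    PolyTime fun x => scoreValues (B x) :=
  cons (by fun_prop) (map (f := fun _ e => e.2) (by fun_prop) hB)

@[fun_prop]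
theorem sumBase (agg : Aggregator) {B : α → List Entry} (hB : PolyTime B) :
    PolyTime fun x => sumBase agg (B x) := by
  cases agg with
  | sum => exact hB
  | leximax =>
    exact map (f := fun x e => (e.1, (OptNNF.rankPow (OptNNF.scoreValues (B x))
      (OptNNF.powLength (OptNNF.scoreValues (B x))) e.2, OptNNF.rankPow
      (OptNNF.scoreValues (B x)) (OptNNF.powLength (OptNNF.scoreValues (B x))) .zero), 1)) (by fun_prop) hB

@[fun_prop]
theorem vars {n : α → List Sym} (hn : PolyTime n) : PolyTime fun x => vars (n x) := by
  have e : ∀ l : List Sym, l.foldl (fun (s : List (List Sym) × List Sym) _ =>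
      (s.2 :: s.1, Sym.tick :: s.2)) ([], []) =
        ((OptNNF.vars l).reverse, List.replicate l.length Sym.tick) := by
    intro l
    induction l using List.reverseRecOn with
    | nil => rfl
    | append_singleton l a ih =>
      rw [List.foldl_append, ih]
      simp [OptNNF.vars, List.range_succ, List.replicate_succ]
  have hrep : ∀ k n : ℕ, k ≤ n → size (List.replicate k Sym.tick) ≤ 1 + n * 26 := fun k n hk =>
    (size_list_le (k := 25) fun a _ => size_sym_le a).trans (by
      rw [List.length_replicate]; omega)
  have := (foldl (f := fun (_ : α) (s : List (List Sym) × List Sym) (_ : Sym) =>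
      (s.2 :: s.1, Sym.tick :: s.2)) (s := fun _ => ([], [])) (l := n)
      (B := fun x => 1 + (1 + size (n x) * ((1 + size (n x) * 26) + 1)) + (1 + size (n x) * 26))
      (by fun_prop) (by fun_prop) hn
      (((PolyBdd.const 1).add ((PolyBdd.const 1).add (hn.bdd.mul (((PolyBdd.const 1).add
        (hn.bdd.mul (.const 26))).add (.const 1))))).add ((PolyBdd.const 1).add
          (hn.bdd.mul (.const 26)))) fun x l hl => by
        have hlen : l.length ≤ size (n x) := hl.length_le.trans (length_le_size _)
        rw [e, size_pair, size_reverse]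
        have h1 := hrep _ _ hlen
        have h2 := size_list_le (l := OptNNF.vars l) (k := 1 + size (n x) * 26) fun a ha => by
          obtain ⟨i, hi, rfl⟩ := List.mem_map.1 ha
          exact hrep _ _ ((List.mem_range.1 hi).le.trans hlen)
        have h3 : (OptNNF.vars l).length ≤ size (n x) := by simpa [OptNNF.vars] using hlen
        have h4 := Nat.mul_le_mul_right (1 + size (n x) * 26 + 1) h3
        omega).fst.reverse
  simpa only [e, List.reverse_reverse] using this

@[fun_prop]
theorem mkCtx {B : α → List Entry} {vs : α → List (List Sym)} (hB : PolyTime B)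
    (hvs : PolyTime vs) : PolyTime fun x => mkCtx (B x) (vs x) :=
  prodMk hB (prodMk hvs (map (f := fun x y =>
    (OptNNF.objective (B x) (OptNNF.oneHot (vs x) y)).le
      (OptNNF.objective (B x) (OptNNF.zeros (vs x)))) (by fun_prop) hvs))

@[fun_prop]
theorem zipXor {f g : α → List Bool} (hf : PolyTime f) (hg : PolyTime g) :
    PolyTime fun x => (f x).zipWith (· ^^ ·) (g x) := zipWithBool _ hf hg

@[fun_prop]
theorem zipOr {f g : α → List Bool} (hf : PolyTime f) (hg : PolyTime g) :
    PolyTime fun x => (f x).zipWith (· || ·) (g x) := zipWithBool _ hf hg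

@[fun_prop]
theorem better {c : α → Ctx} {f g : α → List Bool} (hc : PolyTime c) (hf : PolyTime f)
    (hg : PolyTime g) : PolyTime fun x => better (c x) (f x) (g x) := by
  unfold OptNNF.better; fun_prop

end PolyTime

/-- A model is given by at most `n` Boolean values. -/
def Short (n : ℕ) (a : Option (List Bool)) : Prop := ∀ l, a = some l → l.length ≤ n

theorem Short.size_le {n : ℕ} {a : Option (List Bool)} (h : Short n a) : size a ≤ 3 + n * 4 := by
  cases a with
  | none => rw [size_none]; omega
  | some l =>
    have h1 := size_list_le (l := l) (k := 3) fun b _ => size_bool_le b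
    have h2 := h l rfl
    rw [size_some]
    omega

theorem short_lookup {n : ℕ} {T : List (Option (List Bool))} (h : ∀ a ∈ T, Short n a)
    (j : List Sym) : Short n (lookup T j none) := by
  rw [lookup]
  cases hd : T.drop j.length with
  | nil => exact fun l hl => by simp at hl
  | cons a t => exact h a (List.mem_of_mem_drop (hd ▸ List.mem_cons_self))

theorem short_foldl_andStep {n : ℕ} (T : List (Option (List Bool))) (l : List (List Sym)) :
    ∀ a, Short n a → Short n (l.foldl (andStep T) a) := by
  induction l with
  | nil => exact fun a ha => ha
  | cons j l ih =>
    intro a ha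
    refine ih _ ?_
    unfold andStep
    cases a with
    | none => exact fun l hl => by simp at hl
    | some a =>
      cases lookup T j none with
      | none => exact fun l hl => by simp at hl
      | some b =>
        intro l hl
        obtain rfl := by simpa using hl
        have := ha a rfl
        simp; omega

theorem short_foldl_orStep {n : ℕ} (c : Ctx) {T : List (Option (List Bool))}
    (h : ∀ a ∈ T, Short n a) (l : List (List Sym)) :
    ∀ a, Short n a → Short n (l.foldl (orStep c T) a) := by
  induction l with
  | nil => exact fun a ha => ha
  | cons j l ih =>
    intro a ha
    refine ih _ ?_
    unfold orStep
    have hj := short_lookup h j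
    cases hb : lookup T j none with
    | none => exact ha
    | some b =>
      rw [hb] at hj
      cases a with
      | none => exact hj
      | some a =>
        intro l hl
        obtain rfl := by simpa using hl
        unfold better
        cases (objective c.1 (c.2.2.zipWith (· ^^ ·) a)).le (objective c.1 (c.2.2.zipWith (· ^^ ·) b))
        · exact hj _ rfl
        · exact ha _ rfl

theorem short_nodeVal (c : Ctx) {T : List (Option (List Bool))}
    (h : ∀ a ∈ T, Short c.2.1.length a) (it : Item) : Short c.2.1.length (nodeVal c T it) := by
  have h0 : Short c.2.1.length (some (zeros c.2.1)) := fun l hl => by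
    obtain rfl := by simpa using hl
    simp [zeros]
  have h1 : ∀ x, Short c.2.1.length (some (oneHot c.2.1 x)) := fun x l hl => by
    obtain rfl := by simpa using hl
    simp [oneHot]
  have h2 : Short c.2.1.length none := fun l hl => by simp at hl
  unfold nodeVal
  cases it.1 == Sym.top
  · cases it.1 == Sym.bot
    · cases it.1 == Sym.and
      · cases it.1 == Sym.or
        · cases lookup c.2.2 (it.2.headD []) false == (it.1 == .pos)
          · exact h1 _
          · exact h0
        · exact short_foldl_orStep c h _ _ h2
      · exact short_foldl_andStep T _ _ h0
    · exact h2
  · exact h0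

theorem short_table (c : Ctx) (l : List Item) : ∀ T : List (Option (List Bool)),
    (∀ a ∈ T, Short c.2.1.length a) →
      ∀ a ∈ l.foldl (fun T it => T ++ [nodeVal c T it]) T, Short c.2.1.length a := by
  induction l with
  | nil => exact fun T h => h
  | cons it l ih =>
    intro T h
    refine ih _ fun a ha => ?_
    rcases List.mem_append.1 ha with ha | ha
    · exact h a ha
    · rw [List.mem_singleton.1 ha]; exact short_nodeVal c h it

theorem length_table (c : Ctx) (l : List Item) : (table c l).length = l.length := by
  unfold table
  induction l using List.reverseRecOn with
  | nil => rfl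
  | append_singleton l a ih => rw [List.foldl_append]; simp [ih]

theorem short_of_mem {T : List (Option (List Bool))} {a : Option (List Bool)} (h : a ∈ T) :
    Short (size T) a := by
  rintro l rfl
  have h1 := size_le_of_mem h
  have h2 := length_le_size l
  rw [size_some] at h1
  omega

namespace PolyTime

theorem foldl_andStep {T : α → List (Option (List Bool))} {s : α → Option (List Bool)}
    {l : α → List (List Sym)} (hT : PolyTime T) (hs : PolyTime s) (hl : PolyTime l) :
    PolyTime fun x => (l x).foldl (andStep (T x)) (s x) :=
  foldl (f := fun x => andStep (T x)) (B := fun x => 3 + size (s x) * 4)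
    (by unfold andStep; fun_prop) hs hl ((PolyBdd.const 3).add (hs.bdd.mul (.const 4)))
    fun x l' _ => (short_foldl_andStep _ _ _ (by
      rintro l hl
      have := length_le_size l
      rw [hl, size_some]; omega)).size_le

theorem foldl_orStep {c : α → Ctx} {T : α → List (Option (List Bool))} {l : α → List (List Sym)}
    (hc : PolyTime c) (hT : PolyTime T) (hl : PolyTime l) :
    PolyTime fun x => (l x).foldl (orStep (c x) (T x)) none :=
  foldl (f := fun x => orStep (c x) (T x)) (s := fun _ => none) (B := fun x => 3 + size (T x) * 4)
    (by unfold orStep; fun_prop) (by fun_prop) hl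
    ((PolyBdd.const 3).add (hT.bdd.mul (.const 4)))
    fun x l' _ => (short_foldl_orStep (c x) (fun a ha => short_of_mem ha) _ _
      fun l hl => by simp at hl).size_le

@[fun_prop]
theorem nodeVal {c : α → Ctx} {T : α → List (Option (List Bool))} {it : α → Item}
    (hc : PolyTime c) (hT : PolyTime T) (hit : PolyTime it) :
    PolyTime fun x => nodeVal (c x) (T x) (it x) := by
  have h1 := foldl_andStep hT (s := fun x => Option.some (OptNNF.zeros (c x).2.1)) (by fun_prop)
    hit.snd
  have h2 := foldl_orStep hc hT hit.snd
  unfold OptNNF.nodeVal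
  fun_prop

@[fun_prop]
theorem table {c : α → Ctx} {l : α → List Item} (hc : PolyTime c) (hl : PolyTime l) :
    PolyTime fun x => table (c x) (l x) := by
  refine foldl (f := fun x T it => T ++ [OptNNF.nodeVal (c x) T it]) (s := fun _ => [])
    (B := fun x => 1 + size (l x) * ((3 + size (c x) * 4) + 1))
    (by fun_prop) (by fun_prop) hl ((PolyBdd.const 1).add (hl.bdd.mul
      (((PolyBdd.const 3).add (hc.bdd.mul (.const 4))).add (.const 1)))) fun x l' hl' => ?_
  change size (OptNNF.table (c x) l') ≤ _
  have h1 := size_list_le (l := OptNNF.table (c x) l') (k := 3 + size (c x) * 4) fun a ha => by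
    refine (short_table (c x) l' [] (by simp) a ha).size_le.trans ?_
    have h2 := length_le_size (c x).2.1
    have h3 := size_pair (c x).1 (c x).2
    have h4 := size_pair (c x).2.1 (c x).2.2
    rw [Prod.mk.eta] at h3 h4
    omega
  rw [length_table] at h1
  have h2 := Nat.mul_le_mul_right (3 + size (c x) * 4 + 1)
    (hl'.length_le.trans (length_le_size (l x)))
  omega

/-- The algorithm takes polynomial time. -/
theorem solveRev (agg : Aggregator) : PolyTime (solveRev agg) := by
  have h := readItems (l := fun l : List Sym => (OptNNF.items l.reverse).tail) (by fun_prop)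
  unfold OptNNF.solveRev solveItems answerOf
  fun_prop

end PolyTime

end

/-! ### Input and output -/

namespace Prog
open Stk

@[simp] theorem update_inMem_inp (i j : List Sym) (m : List Bool) :
    Function.update (inMem i m) .inp j = inMem j m := by
  funext k; cases k <;> rfl

@[simp] theorem update_inMem_main (i : List Sym) (m l : List Bool) :
    Function.update (inMem i m) .main l = inMem i l := by
  funext k; cases k <;> rfl

theorem inMem_nil (m : List Bool) : inMem [] m = mem m [] [] [] := by
  funext k; cases k <;> rfl

/-- Move a symbol, which belongs to a given list, from the input to the list of symbols on the main
stack. -/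
def readSym : List Sym → Prog
  | [] => skip
  | a :: l => ite inp (· == some a) (seq (pop inp) (pushes (true :: codeOf a))) (readSym l)

theorem readSym_runs {a : Sym} {l : List Sym} (h : a ∈ l) (i : List Sym) (m : List Bool) :
    (readSym l).RunsLE (inMem (a :: i) m) (l.length + 28) (inMem i (true :: (codeOf a ++ m))) := by
  induction l with
  | nil => simp at h
  | cons b l ih =>
    by_cases hb : a = b
    · subst hb
      have := size_sym_le a
      refine (RunsLE.iteTrue (by simp [inMem]) ((RunsLE.pop (S' := inMem i m)
        (by simp [inMem])).seq (t' := (true :: codeOf a).length + 1) ?_)).mono ?_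
      · simpa [inMem] using pushes_runs' (true :: codeOf a) (inMem i m)
      · simp only [List.length_cons, size] at *; omega
    · exact (RunsLE.iteFalse (by simpa [inMem] using hb)
        (ih (by simpa [hb] using h))).mono (by simp; omega)

/-- Move the input to the main stack. -/
def readInput : Prog := seq (push main false) (loop inp (·.isSome) (readSym symList))

theorem readInput_runs (l : List Sym) :
    readInput.RunsLE (inMem l []) (2 + 42 * l.length) (mem (codeOf l.reverse ++ []) [] [] []) := by
  suffices h : ∀ l r : List Sym, (loop inp (·.isSome) (readSym symList)).RunsLE
      (inMem l (codeOf r)) (1 + 42 * l.length) (inMem [] (codeOf (l.reverse ++ r))) by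
    have h := (RunsLE.push (S := inMem l []) (k := main) (a := false) (S' := inMem l (codeOf []))
      (by simp [inMem, codeOf_nil])).seq (h l [])
    rw [inMem_nil] at h
    simp only [List.append_nil] at h ⊢
    exact h.mono (by omega)
  intro l
  induction l with
  | nil => exact fun r => .loopStop (by simp [inMem])
  | cons a l ih =>
    intro r
    have ha : a ∈ symList := by rcases a with _ | _ | _ | (_ | _) | _ <;> decide
    have := ih (a :: r)
    rw [codeOf_cons] at this
    rw [show (a :: l).reverse ++ r = l.reverse ++ a :: r by simp]
    exact (RunsLE.loopStep (by simp [inMem]) (readSym_runs ha _ _) this).mono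
      (by simp [symList]; omega)

/-- Move the list of truth values on the main stack to the stack `aux`. -/
def writeOutput : Prog :=
  seq (loop main (· == some true) <| seq (pop main) <|
    ite main (· == some true)
      (seq (pop main) <| seq (pop main) <| seq (pop main) (push aux true))
      (seq (pop main) (push aux false))) (pop main)

theorem writeOutput_runs (l : List Bool) :
    writeOutput.RunsLE (mem (codeOf l ++ []) [] [] []) (2 + 7 * size l)
      (mem [] l.reverse [] []) := by
  suffices h : ∀ l r : List Bool, (loop main (· == some true) <| seq (pop main) <|
      ite main (· == some true)
        (seq (pop main) <| seq (pop main) <| seq (pop main) (push aux true))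
        (seq (pop main) (push aux false))).RunsLE (mem (codeOf l) r [] []) (1 + 7 * l.length)
        (mem (codeOf ([] : List Bool)) (l.reverse ++ r) [] []) by
    have h := (h l []).seq (RunsLE.pop (k := main) (S' := mem [] l.reverse [] [])
      (by simp [mem, codeOf_nil]))
    simp only [List.append_nil] at h ⊢
    have := length_le_size l
    exact h.mono (by omega)
  intro l
  induction l with
  | nil => exact fun r => .loopStop (by simp [mem, codeOf_nil])
  | cons b l ih =>
    intro r
    have h := ih (b :: r)
    rw [show (b :: l).reverse ++ r = l.reverse ++ b :: r by simp]
    refine (RunsLE.loopStep (t := 6) (by simp [mem, codeOf_cons]) ?_ h).mono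
      (by simp; omega)
    · refine (RunsLE.pop (S' := mem (codeOf b ++ codeOf l) r [] [])
        (by simp [mem, codeOf_cons])).seq (t' := 5) ?_
      cases b
      · refine (RunsLE.iteFalse (by simp [mem, codeOf, Enc.enc, Dat.code]) ((RunsLE.pop rfl).seq
          (t' := 1) (.push ?_))).mono (by omega)
        simp [mem, codeOf, Enc.enc, Dat.code]
      · refine (RunsLE.iteTrue (by simp [mem, codeOf, Enc.enc, Dat.code]) ((RunsLE.pop rfl).seq
          ((RunsLE.pop rfl).seq ((RunsLE.pop rfl).seq (t' := 1) (.push ?_))))).mono (by omega)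
        simp [mem, codeOf, Enc.enc, Dat.code]

end Prog

/-- A function that is, up to the reversal of the words, in polynomial time on words is computed by
a polynomial-time Turing machine. -/
theorem PolyTime.computable {g : List Sym → List Bool} (hg : PolyTime g) {α β : Type}
    {ea : α → List Sym} {eb : β → List Bool} {f : α → β}
    (h : ∀ a, eb (f a) = (g (ea a).reverse).reverse) :
    Nonempty (Turing.TM2ComputableInPolyTime ea eb f) := by
  obtain ⟨Q, hQ⟩ := hg.bdd
  obtain ⟨p, P, hp⟩ := hg
  refine ⟨Prog.computableInPolyTime (.seq .readInput (.seq p .writeOutput))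
    (2 + 42 * Polynomial.X + (P.comp (1 + 26 * Polynomial.X) +
      (2 + 7 * Q.comp (1 + 26 * Polynomial.X)))) fun a => ?_⟩
  rw [h]
  have hs : size (ea a).reverse ≤ 1 + 26 * (ea a).length := by
    have := size_list_le (l := (ea a).reverse) (k := 25) fun a _ => size_sym_le a
    rw [List.length_reverse] at this
    omega
  refine (Prog.readInput_runs (ea a)).seq ((hp _ []).seq (Prog.writeOutput_runs _))
    |>.mono ?_
  have h1 := eval_mono P hs
  have h2 : size (g (ea a).reverse) ≤ _ := (hQ (ea a).reverse).trans (eval_mono Q hs)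
  have e1 : ∀ n : ℕ, Polynomial.eval n (2 + 42 * Polynomial.X + (P.comp (1 + 26 * Polynomial.X) +
      (2 + 7 * Q.comp (1 + 26 * Polynomial.X))) : Polynomial ℕ) =
      2 + 42 * n + (P.eval (1 + 26 * n) + (2 + 7 * Q.eval (1 + 26 * n))) := by
    intro n; simp [Polynomial.eval_comp]
  rw [e1]
  omega

/-! ### Optimal models of decomposable circuits -/

namespace Frac

/-- The value of a fraction. -/
def val (a : Frac) : ℚ := ((a.1.1 : ℚ) - a.1.2) / a.2

theorem val_zero : zero.val = 0 := by simp [zero, val]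

theorem add_pos {a b : Frac} (ha : 0 < a.2) (hb : 0 < b.2) : 0 < (a.add b).2 := Nat.mul_pos ha hb

theorem val_add {a b : Frac} (ha : 0 < a.2) (hb : 0 < b.2) : (a.add b).val = a.val + b.val := by
  have ha' : (a.2 : ℚ) ≠ 0 := by positivity
  have hb' : (b.2 : ℚ) ≠ 0 := by positivity
  simp only [val, add]
  push_cast
  field_simp
  ring

theorem le_iff {a b : Frac} (ha : 0 < a.2) (hb : 0 < b.2) : a.le b = true ↔ a.val ≤ b.val := by
  have ha' : (0 : ℚ) < a.2 := by exact_mod_cast ha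
  have hb' : (0 : ℚ) < b.2 := by exact_mod_cast hb
  rw [le, decide_eq_true_iff, val, val, div_le_div_iff₀ ha' hb', ← Nat.cast_le (α := ℚ)]
  push_cast
  constructor <;> intro h <;> linarith

end Frac

/-- Literals and Boolean constants. -/
inductive Lit (n : ℕ) : Type
  | const (b : Bool) : Lit n
  | var (x : Fin n) (b : Bool) : Lit n

namespace Lit
variable {n : ℕ}

/-- The truth value of a literal. -/
def val (ω : Interp n) : Lit n → Bool
  | const b => b
  | var x b => ω x == b

/-- The item that a literal is read as. -/
def item : Lit n → Item
  | const true => (.top, [])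
  | const false => (.bot, [])
  | var x true => (.pos, [List.replicate x .tick])
  | var x false => (.neg, [List.replicate x .tick])

end Lit

section
variable {n : ℕ}

/-- The sum of the weights of the literals that are satisfied. -/
def cost (L : List (Lit n × ℚ)) (ω : Interp n) : ℚ :=
  (L.map fun p => if p.1.val ω then p.2 else 0).sum

theorem lookup_ofFn {δ : Type} (f : Fin n → δ) (x : Fin n) (d : δ) :
    lookup (List.ofFn f) (List.replicate x .tick) d = f x := by
  rw [lookup, List.length_replicate, List.drop_eq_getElem_cons (by simp)]
  simp

theorem litVal_item (l : Lit n) (ω : Interp n) : litVal l.item (List.ofFn ω) = l.val ω := by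
  rcases l with (_ | _) | ⟨x, _ | _⟩
  · rfl
  · rfl
  · change (false == lookup (List.ofFn ω) (List.replicate x .tick) false) = (ω x == false)
    rw [lookup_ofFn]; cases ω x <;> rfl
  · change (true == lookup (List.ofFn ω) (List.replicate x .tick) false) = (ω x == true)
    rw [lookup_ofFn]; cases ω x <;> rfl

/-- The weighted literals as the algorithm reads them. -/
def entries (L : List (Lit n × Frac)) : List Entry := L.map fun p => (p.1.item, p.2)

theorem objective_entries {L : List (Lit n × Frac)} (hL : ∀ p ∈ L, 0 < p.2.2) (ω : Interp n) :
    0 < (objective (entries L) (List.ofFn ω)).2 ∧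
      (objective (entries L) (List.ofFn ω)).val = cost (L.map fun p => (p.1, p.2.val)) ω := by
  suffices h : ∀ (L : List (Lit n × Frac)), (∀ p ∈ L, 0 < p.2.2) → ∀ a : Frac, 0 < a.2 →
      0 < ((entries L).foldl (fun a e => bif litVal e.1 (List.ofFn ω) then a.add e.2 else a) a).2 ∧
      ((entries L).foldl (fun a e => bif litVal e.1 (List.ofFn ω) then a.add e.2 else a) a).val =
        a.val + cost (L.map fun p => (p.1, p.2.val)) ω by
    have := h L hL .zero (by simp [Frac.zero])
    rwa [Frac.val_zero, zero_add] at this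
  intro L
  induction L with
  | nil => intro _ a ha; simpa [entries, cost] using ha
  | cons p L ih =>
    intro hL a ha
    have hp := hL p (by simp)
    have h := ih fun q hq => hL q (by simp [hq])
    simp only [entries, cost, List.map_cons, List.foldl_cons, List.sum_cons, litVal_item] at h ⊢
    cases p.1.val ω
    · simpa using h a ha
    · obtain ⟨h1, h2⟩ := h (a.add p.2) (Frac.add_pos ha hp)
      rw [Frac.val_add ha hp] at h2
      exact ⟨h1, by simp only [cond_true, if_true]; rw [h2, add_assoc]⟩

/-- The sum of the scores is a sum of contributions of the variables. -/
theorem exists_cost_eq (L : List (Lit n × ℚ)) :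
    ∃ (C : ℚ) (c : Fin n → Bool → ℚ), ∀ ω, cost L ω = C + ∑ x, c x (ω x) := by
  induction L with
  | nil => exact ⟨0, fun _ _ => 0, fun ω => by simp [cost]⟩
  | cons p L ih =>
    obtain ⟨C, c, h⟩ := ih
    rcases p with ⟨b | ⟨y, b⟩, w⟩
    · refine ⟨(if b then w else 0) + C, c, fun ω => ?_⟩
      rw [add_assoc, ← h]
      cases b <;> simp [cost, Lit.val]
    · refine ⟨C, fun x a => (if x = y then (if a = b then w else 0) else 0) + c x a, fun ω => ?_⟩
      rw [Finset.sum_add_distrib, Finset.sum_ite_eq' Finset.univ y fun x => if ω x = b then w else 0,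
        if_pos (Finset.mem_univ y), add_left_comm, ← h]
      simp [cost, Lit.val]

namespace NNF

theorem satAt_const {φ : NNF n} {ω : Interp n} {i b} (h : φ.node i = .const b) :
    φ.SatAt ω i ↔ b = true := by
  constructor
  · rintro (h' | ⟨h', -⟩ | ⟨h', -⟩ | ⟨h', -, -⟩) <;> rw [h] at h' <;> cases h'
    rfl
  · rintro rfl; exact .const h

theorem satAt_lit {φ : NNF n} {ω : Interp n} {i x b} (h : φ.node i = .lit x b) :
    φ.SatAt ω i ↔ ω x = b := by
  constructor
  · rintro (h' | ⟨h', h''⟩ | ⟨h', -⟩ | ⟨h', -, -⟩) <;> rw [h] at h' <;> cases h'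
    exact h''
  · exact .lit h

theorem satAt_and {φ : NNF n} {ω : Interp n} {i cs} (h : φ.node i = .and cs) :
    φ.SatAt ω i ↔ ∀ j ∈ cs, φ.SatAt ω j := by
  constructor
  · rintro (h' | ⟨h', -⟩ | ⟨h', h''⟩ | ⟨h', -, -⟩) <;> rw [h] at h' <;> cases h'
    exact h''
  · exact .and h

theorem satAt_or {φ : NNF n} {ω : Interp n} {i cs} (h : φ.node i = .or cs) :
    φ.SatAt ω i ↔ ∃ j ∈ cs, φ.SatAt ω j := by
  constructor
  · rintro (h' | ⟨h', -⟩ | ⟨h', -⟩ | ⟨h', hj, hs⟩) <;> rw [h] at h' <;> cases h'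
    exact ⟨_, hj, hs⟩
  · rintro ⟨j, hj, hs⟩; exact .or h hj hs

theorem varsAt_subset {φ : NNF n} {i j} (h : φ.Child i j) : φ.varsAt j ⊆ φ.varsAt i := by
  rintro x ⟨k, b, hk, hx⟩
  exact ⟨k, b, .head h hk, hx⟩

/-- The value of a node depends on the variables below it only. -/
theorem SatAt.congr {φ : NNF n} {ω ω' : Interp n} {i} (h : φ.SatAt ω i)
    (hω : ∀ x ∈ φ.varsAt i, ω x = ω' x) : φ.SatAt ω' i := by
  induction h with
  | const h => exact .const h
  | lit h hx => exact .lit h (by rw [← hω _ ⟨_, _, .refl, h⟩, hx])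
  | and h _ ih =>
    refine .and h fun j hj => ih j hj fun x hx => hω x (varsAt_subset ?_ hx)
    simpa [Child, h, Node.children] using hj
  | or h hj _ ih =>
    refine .or h hj (ih fun x hx => hω x (varsAt_subset ?_ hx))
    simpa [Child, h, Node.children] using hj

end NNF

section Optimal
variable (F : Interp n → ℚ) (ω₀ : Interp n)

/-- `d` describes an optimal model of `P`: a model that minimizes `F` and that differs from `ω₀`
at the variables in `d`, all of which are in `S`. -/
structure OptOn (S : Set (Fin n)) (P : Interp n → Prop) (d : Interp n) : Prop where
  supp : ∀ x ∉ S, d x = false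
  sat : P fun x => ω₀ x ^^ d x
  opt : ∀ ω, P ω → F (fun x => ω₀ x ^^ d x) ≤ F ω

/-- `r` describes an optimal model of `P`, or `P` has no model. -/
def Spec (S : Set (Fin n)) (P : Interp n → Prop) : Option (List Bool) → Prop
  | none => ∀ ω, ¬ P ω
  | some l => ∃ d, l = List.ofFn d ∧ OptOn F ω₀ S P d

variable {F ω₀}

theorem Spec.mono {S S' : Set (Fin n)} {P P' : Interp n → Prop} {r : Option (List Bool)}
    (h : Spec F ω₀ S P r) (hS : S ⊆ S') (hP : ∀ ω, P ω ↔ P' ω) : Spec F ω₀ S' P' r := by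
  obtain rfl : P = P' := funext fun ω => propext (hP ω)
  cases r with
  | none => exact h
  | some l =>
    obtain ⟨d, hd, h⟩ := h
    exact ⟨d, hd, fun x hx => h.supp x fun hx' => hx (hS hx'), h.sat, h.opt⟩

theorem zipWith_ofFn (f : Bool → Bool → Bool) (a b : Interp n) :
    (List.ofFn a).zipWith f (List.ofFn b) = List.ofFn fun x => f (a x) (b x) := by
  apply List.ext_getElem <;> simp

/-- Models of properties of disjoint sets of variables are combined: the sum of the best values is
the best value, because `F` is a sum over the variables. -/
theorem OptOn.and {C : ℚ} {c : Fin n → Bool → ℚ} (hF : ∀ ω, F ω = C + ∑ x, c x (ω x))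
    (hω₀ : ∀ x b, c x (ω₀ x) ≤ c x b) {S S' : Set (Fin n)} {P P' : Interp n → Prop}
    {d d' : Interp n} (hP : ∀ ω ω', P ω → (∀ x ∈ S, ω x = ω' x) → P ω')
    (hP' : ∀ ω ω', P' ω → (∀ x ∈ S', ω x = ω' x) → P' ω') (hS : Disjoint S S')
    (h : OptOn F ω₀ S P d) (h' : OptOn F ω₀ S' P' d') :
    OptOn F ω₀ (S ∪ S') (fun ω => P ω ∧ P' ω) fun x => d x || d' x := by
  classical
  have hd : ∀ x, d x = false ∨ d' x = false := fun x => by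
    by_cases hx : x ∈ S
    · exact .inr (h'.supp x fun hx' => Set.disjoint_left.1 hS hx hx')
    · exact .inl (h.supp x hx)
  refine ⟨fun x hx => ?_, ⟨hP _ _ h.sat fun x hx => ?_, hP' _ _ h'.sat fun x hx => ?_⟩,
    fun ω hω => ?_⟩
  · rw [h.supp x fun hx' => hx (.inl hx'), h'.supp x fun hx' => hx (.inr hx')]; rfl
  · rw [h'.supp x fun hx' => Set.disjoint_left.1 hS hx hx', Bool.or_false]
  · rw [h.supp x fun hx' => Set.disjoint_left.1 hS hx' hx, Bool.false_or]
  -- compare with the restrictions of `ω` to `S` and to `S'`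
  have h1 := h.opt (fun x => if x ∈ S then ω x else ω₀ x)
    (hP _ _ hω.1 fun x hx => by rw [if_pos hx])
  have h2 := h'.opt (fun x => if x ∈ S' then ω x else ω₀ x)
    (hP' _ _ hω.2 fun x hx => by rw [if_pos hx])
  have h3 : ∑ x, c x (ω₀ x ^^ (d x || d' x)) + ∑ x, c x (ω₀ x) =
      ∑ x, c x (ω₀ x ^^ d x) + ∑ x, c x (ω₀ x ^^ d' x) := by
    rw [← Finset.sum_add_distrib, ← Finset.sum_add_distrib]
    refine Finset.sum_congr rfl fun x _ => ?_
    rcases hd x with e | e <;> rw [e] <;> simp [add_comm]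
  have h4 : ∑ x, c x (if x ∈ S then ω x else ω₀ x) + ∑ x, c x (if x ∈ S' then ω x else ω₀ x) ≤
      ∑ x, c x (ω x) + ∑ x, c x (ω₀ x) := by
    rw [← Finset.sum_add_distrib, ← Finset.sum_add_distrib]
    refine Finset.sum_le_sum fun x _ => ?_
    have := hω₀ x (ω x)
    by_cases hx : x ∈ S
    · rw [if_pos hx, if_neg (Set.disjoint_left.1 hS hx)]
    · rw [if_neg hx]
      split_ifs <;> linarith
  rw [hF, hF] at *
  linarith

end Optimal

/-- What the data for the evaluation of a circuit have to satisfy. -/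
structure Ctx.Good (c : Ctx) (F : Interp n → ℚ) (ω₀ : Interp n) : Prop where
  vars : c.2.1 = OptNNF.vars (List.replicate n .tick)
  best : c.2.2 = List.ofFn ω₀
  le_iff : ∀ ω ω', (objective c.1 (List.ofFn ω)).le (objective c.1 (List.ofFn ω')) = true ↔
    F ω ≤ F ω'
  sep : ∃ (C : ℚ) (c : Fin n → Bool → ℚ), (∀ ω, F ω = C + ∑ x, c x (ω x)) ∧
    ∀ x b, c x (ω₀ x) ≤ c x b

theorem vars_eq_ofFn : vars (List.replicate n .tick) =
    List.ofFn fun x : Fin n => List.replicate x Sym.tick := by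
  apply List.ext_getElem <;> simp [vars]

theorem zeros_vars : zeros (vars (List.replicate n .tick)) = List.ofFn fun _ : Fin n => false := by
  rw [vars_eq_ofFn, zeros, List.map_ofFn]; rfl

theorem sameIdx_replicate (i j : ℕ) :
    sameIdx (List.replicate i .tick) (List.replicate j .tick) = decide (i = j) := by
  rw [Bool.eq_iff_iff]
  simp [sameIdx]
  omega

theorem oneHot_vars (x : Fin n) : oneHot (vars (List.replicate n .tick)) (List.replicate x .tick) =
    List.ofFn fun y : Fin n => decide (y = x) := by
  rw [vars_eq_ofFn, oneHot, List.map_ofFn]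
  congr 1
  funext y
  simp [sameIdx_replicate, Fin.ext_iff]

/-- The data computed from weighted literals. -/
theorem mkCtx_good {L : List (Lit n × Frac)} (hL : ∀ p ∈ L, 0 < p.2.2) :
    ∃ ω₀, (mkCtx (entries L) (vars (List.replicate n .tick))).Good
      (cost (L.map fun p => (p.1, p.2.val))) ω₀ := by
  set F := cost (L.map fun p => (p.1, p.2.val)) with hFdef
  have hle : ∀ ω ω', (objective (entries L) (List.ofFn ω)).le
      (objective (entries L) (List.ofFn ω')) = true ↔ F ω ≤ F ω' := fun ω ω' => by
    obtain ⟨h1, h2⟩ := objective_entries hL ω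
    obtain ⟨h3, h4⟩ := objective_entries hL ω'
    rw [Frac.le_iff h1 h3, h2, h4]
  obtain ⟨C, c, hF⟩ : ∃ (C : ℚ) (c : Fin n → Bool → ℚ), ∀ ω, F ω = C + ∑ x, c x (ω x) :=
    exists_cost_eq _
  refine ⟨fun x => (objective (entries L) (List.ofFn fun y : Fin n => decide (y = x))).le
    (objective (entries L) (List.ofFn fun _ : Fin n => false)), rfl, ?_, hle, C, c, hF, ?_⟩
  · have hv := vars_eq_ofFn (n := n)
    simp only [mkCtx, bestInterp]
    conv_lhs => rw [hv, List.map_ofFn]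
    congr 1
    funext x
    simp only [Function.comp]
    rw [← hv, oneHot_vars, zeros_vars]
  · intro x b
    -- the two interpretations that are compared differ at `x` only
    have key : F (fun y => decide (y = x)) - F (fun _ => false) = c x true - c x false := by
      rw [hF, hF, add_sub_add_left_eq_sub, ← Finset.sum_sub_distrib,
        Finset.sum_eq_single x (fun y _ hy => by simp [hy]) (by simp)]
      simp
    cases h : (objective (entries L) (List.ofFn fun y : Fin n => decide (y = x))).le
      (objective (entries L) (List.ofFn fun _ : Fin n => false))
    · have := (not_congr (hle _ _)).1 (by rw [h]; simp)
      cases b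
      · exact le_rfl
      · linarith
    · have := (hle _ _).1 h
      cases b
      · linarith
      · exact le_rfl

/-- The item that a node is read as. -/
def nodeItem {m : ℕ} : Node n m → Item
  | .const b => (Lit.const b : Lit n).item
  | .lit x b => (Lit.var x b).item
  | .and cs => (.and, cs.reverse.map fun j : Fin m => List.replicate j .tick)
  | .or cs => (.or, cs.reverse.map fun j : Fin m => List.replicate j .tick)

section Nodes
variable {F : Interp n → ℚ} {ω₀ : Interp n} {c : Ctx} {φ : NNF n}
  {T : List (Option (List Bool))}

theorem spec_zeros (hc : c.Good F ω₀) {S : Set (Fin n)} {P : Interp n → Prop} (h : P ω₀) :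
    Spec F ω₀ S P (some (zeros c.2.1)) := by
  obtain ⟨C, d, hF, hd⟩ := hc.sep
  refine ⟨fun _ => false, by rw [hc.vars, zeros_vars], fun _ _ => rfl, ?_, fun ω _ => ?_⟩
  · simpa using h
  · simp only [Bool.xor_false]
    rw [hF, hF]
    gcongr
    exact hd _ _

theorem spec_better (hc : c.Good F ω₀) {S : Set (Fin n)} {P P' : Interp n → Prop} {d d' : Interp n}
    (h : OptOn F ω₀ S P d) (h' : OptOn F ω₀ S P' d') :
    Spec F ω₀ S (fun ω => P ω ∨ P' ω) (some (better c (List.ofFn d) (List.ofFn d'))) := by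
  rw [better, hc.best, zipWith_ofFn, zipWith_ofFn]
  cases hle : (objective c.1 (List.ofFn fun x => ω₀ x ^^ d x)).le
    (objective c.1 (List.ofFn fun x => ω₀ x ^^ d' x))
  · have := (not_congr (hc.le_iff _ _)).1 (by rw [hle]; simp)
    exact ⟨d', rfl, h'.supp, .inr h'.sat, fun ω hω => hω.elim
      (fun hω => (not_le.1 this).le.trans (h.opt ω hω)) (h'.opt ω)⟩
  · have := (hc.le_iff _ _).1 hle
    exact ⟨d, rfl, h.supp, .inl h.sat, fun ω hω => hω.elim (h.opt ω)
      fun hω => this.trans (h'.opt ω hω)⟩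

theorem spec_foldl_orStep (hc : c.Good F ω₀) {S : Set (Fin n)} (l : List (Fin (φ.last + 1)))
    (hT : ∀ j ∈ l, Spec F ω₀ S (fun ω => φ.SatAt ω j) (lookup T (List.replicate j .tick) none)) :
    ∀ {P : Interp n → Prop} {r : Option (List Bool)}, Spec F ω₀ S P r →
      Spec F ω₀ S (fun ω => P ω ∨ ∃ j ∈ l, φ.SatAt ω j)
        ((l.map fun j : Fin _ => List.replicate j .tick).foldl (orStep c T) r) := by
  induction l with
  | nil => intro P r h; simpa using h
  | cons j l ih =>
    intro P r h
    have hj := hT j (by simp)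
    have step : Spec F ω₀ S (fun ω => P ω ∨ φ.SatAt ω j)
        (orStep c T r (List.replicate j .tick)) := by
      unfold orStep
      cases hl : lookup T (List.replicate j .tick) none with
      | none =>
        rw [hl] at hj
        exact h.mono le_rfl fun ω => (or_iff_left (hj ω)).symm
      | some l' =>
        rw [hl] at hj
        cases r with
        | none => exact hj.mono le_rfl fun ω => (or_iff_right (h ω)).symm
        | some l =>
          obtain ⟨d, rfl, h⟩ := h
          obtain ⟨d', rfl, hj⟩ := hj
          exact spec_better hc h hj
    refine (ih (fun k hk => hT k (by simp [hk])) step).mono le_rfl fun ω => ?_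
    simp [or_assoc]

theorem spec_foldl_andStep (hc : c.Good F ω₀) (l : List (Fin (φ.last + 1)))
    (hT : ∀ j ∈ l, Spec F ω₀ (φ.varsAt j) (fun ω => φ.SatAt ω j)
      (lookup T (List.replicate j .tick) none))
    (hl : l.Pairwise fun a b => Disjoint (φ.varsAt a) (φ.varsAt b)) :
    ∀ {S : Set (Fin n)} {P : Interp n → Prop} {r : Option (List Bool)}, Spec F ω₀ S P r →
      (∀ ω ω', P ω → (∀ x ∈ S, ω x = ω' x) → P ω') → (∀ j ∈ l, Disjoint S (φ.varsAt j)) →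
      Spec F ω₀ (S ∪ ⋃ j ∈ l, φ.varsAt j) (fun ω => P ω ∧ ∀ j ∈ l, φ.SatAt ω j)
        ((l.map fun j : Fin _ => List.replicate j .tick).foldl (andStep T) r) := by
  induction l with
  | nil => intro S P r h _ _; simpa using h
  | cons j l ih =>
    intro S P r h hP hS
    obtain ⟨C, d, hF, hd⟩ := hc.sep
    have hj := hT j (by simp)
    have step : Spec F ω₀ (S ∪ φ.varsAt j) (fun ω => P ω ∧ φ.SatAt ω j)
        (andStep T r (List.replicate j .tick)) := by
      unfold andStep
      cases r with
      | none => exact fun ω hω => h ω hω.1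
      | some l =>
        cases hl : lookup T (List.replicate j .tick) none with
        | none =>
          rw [hl] at hj
          exact fun ω hω => hj ω hω.2
        | some l' =>
          rw [hl] at hj
          obtain ⟨d, rfl, h⟩ := h
          obtain ⟨d', rfl, hj⟩ := hj
          exact ⟨_, zipWith_ofFn _ _ _, OptOn.and hF hd hP
            (fun ω ω' hω h => hω.congr h) (hS j (by simp)) h hj⟩
    obtain ⟨hl1, hl2⟩ := List.pairwise_cons.1 hl
    refine (ih (fun k hk => hT k (by simp [hk])) hl2 step ?_ ?_).mono ?_ fun ω => ?_
    · rintro ω ω' ⟨h1, h2⟩ h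
      exact ⟨hP _ _ h1 fun x hx => h x (.inl hx), h2.congr fun x hx => h x (.inr hx)⟩
    · exact fun k hk => Set.disjoint_union_left.2 ⟨hS k (by simp [hk]), hl1 k hk⟩
    · rw [Set.union_assoc]
      refine Set.union_subset_union_right _ ?_
      simp
    · simp [and_assoc]

/-- Optimal models of a node are found from optimal models of its children. -/
theorem spec_nodeVal (hc : c.Good F ω₀) (hφ : φ.Decomposable) (i : Fin (φ.last + 1))
    (hT : ∀ j < i, Spec F ω₀ (φ.varsAt j) (fun ω => φ.SatAt ω j)
      (lookup T (List.replicate j .tick) none)) :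
    Spec F ω₀ (φ.varsAt i) (fun ω => φ.SatAt ω i) (nodeVal c T (nodeItem (φ.node i))) := by
  have hch := φ.topological i
  cases hi : φ.node i with
  | const b =>
    cases b
    · exact fun ω hω => by simpa using (NNF.satAt_const hi).1 hω
    · exact spec_zeros hc ((NNF.satAt_const hi).2 rfl)
  | lit x b =>
    have hnv : nodeVal c T (nodeItem (.lit x b : Node n (φ.last + 1))) =
        bif ω₀ x == b then some (zeros c.2.1)
        else some (oneHot c.2.1 (List.replicate x .tick)) := by
      rw [← lookup_ofFn ω₀ x false, ← hc.best]
      cases b <;> rfl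
    rw [hnv]
    by_cases hb : ω₀ x = b
    · rw [hb, beq_self_eq_true, cond_true]
      exact spec_zeros hc ((NNF.satAt_lit hi).2 hb)
    · rw [beq_false_of_ne hb, cond_false, hc.vars, oneHot_vars]
      obtain ⟨C, d, hF, hd⟩ := hc.sep
      have hxb : (!(ω₀ x)) = b := by cases h : ω₀ x <;> cases b <;> simp_all
      refine ⟨_, rfl, fun y hy => ?_, (NNF.satAt_lit hi).2 ?_, fun ω hω => ?_⟩
      · have : y ≠ x := by rintro rfl; exact hy ⟨i, b, .refl, hi⟩
        simpa using this
      · simpa using hxb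
      · rw [NNF.satAt_lit hi] at hω
        rw [hF, hF]
        gcongr with y
        by_cases hy : y = x
        · subst hy; simp [hxb, hω]
        · simpa [hy] using hd y (ω y)
  | and cs =>
    rw [hi] at hch
    have hnodup : cs.Nodup := by simpa [hi, Node.children] using φ.nodup i
    have h := spec_foldl_andStep (φ := φ) (T := T) hc cs.reverse
      (fun j hj => hT j (hch j (by simpa [Node.children] using hj)))
      (List.Pairwise.imp_of_mem (fun {a b} ha hb hab => hφ i cs hi a (by simpa using ha) b
        (by simpa using hb) hab) (List.nodup_reverse.2 hnodup))
      (spec_zeros hc (S := ∅) (P := fun _ => True) trivial) (fun _ _ _ _ => trivial)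
      (fun j _ => by simp)
    refine h.mono ?_ fun ω => ?_
    · simp only [Set.empty_union, Set.iUnion_subset_iff, List.mem_reverse]
      exact fun j hj => NNF.varsAt_subset (by simpa [NNF.Child, hi, Node.children] using hj)
    · rw [NNF.satAt_and hi]; simp
  | or cs =>
    rw [hi] at hch
    have h := spec_foldl_orStep (φ := φ) (T := T) hc (S := φ.varsAt i) cs.reverse
      (fun j hj => (hT j (hch j (by simpa [Node.children] using hj))).mono
        (NNF.varsAt_subset (by simpa [NNF.Child, hi, Node.children] using hj)) fun _ => Iff.rfl)
      (P := fun _ => False) (r := none) (fun ω h => h)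
    refine h.mono le_rfl fun ω => ?_
    rw [NNF.satAt_or hi]; simp

/-- The items that the nodes of a circuit are read as. -/
def nodeItems (φ : NNF n) : List Item := List.ofFn fun i => nodeItem (φ.node i)

theorem spec_table (hc : c.Good F ω₀) (hφ : φ.Decomposable) (k : ℕ) :
    ∀ j : Fin (φ.last + 1), j < k → Spec F ω₀ (φ.varsAt j) (fun ω => φ.SatAt ω j)
      (lookup (table c ((nodeItems φ).take k)) (List.replicate j .tick) none) := by
  induction k with
  | zero => intro j hj; omega
  | succ k ih =>
    intro j hj
    by_cases hk : k < φ.last + 1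
    · have hlen : (table c ((nodeItems φ).take k)).length = k := by
        rw [length_table]; simp [nodeItems]; omega
      have htab : table c ((nodeItems φ).take (k + 1)) = table c ((nodeItems φ).take k) ++
          [nodeVal c (table c ((nodeItems φ).take k)) (nodeItem (φ.node ⟨k, hk⟩))] := by
        rw [List.take_succ_eq_append_getElem (by simpa [nodeItems] using hk), table,
          List.foldl_append]
        simp only [nodeItems, List.getElem_ofFn]
        rfl
      rw [htab]
      by_cases hjk : (j : ℕ) < k
      · have := ih j hjk
        rw [lookup, List.length_replicate] at this ⊢
        rw [List.drop_append_of_le_length (by omega)]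
        rw [List.drop_eq_getElem_cons (by omega)] at this ⊢
        exact this
      · have hjk' : j = ⟨k, hk⟩ := Fin.ext (by simp only; omega)
        subst hjk'
        rw [lookup, List.length_replicate, List.drop_append_of_le_length (by simp [hlen]),
          List.drop_of_length_le (by simp [hlen])]
        exact spec_nodeVal hc hφ _ fun i hi => ih i hi
    · rw [List.take_of_length_le (by simp [nodeItems]; omega)]
      have := ih j (by have := j.2; omega)
      rwa [List.take_of_length_le (by simp [nodeItems]; omega)] at this

theorem spec_root (hc : c.Good F ω₀) (hφ : φ.Decomposable) :
    Spec F ω₀ Set.univ φ.Sat ((table c (nodeItems φ)).reverse.headD none) := by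
  have h := (spec_table hc hφ (φ.last + 1) φ.root (by simp [NNF.root])).mono
    (Set.subset_univ _) (P' := φ.Sat) fun _ => Iff.rfl
  have hlen : (table c (nodeItems φ)).length = φ.last + 1 := by
    rw [length_table]; simp [nodeItems]
  rw [List.take_of_length_le (by simp [nodeItems]), lookup, List.length_replicate,
    List.drop_eq_getElem_cons (by simp [hlen, NNF.root])] at h
  simp only [NNF.root, Fin.val_last, List.headD_cons] at h
  rw [List.headD_eq_head?_getD, List.head?_reverse, List.getLast?_eq_getElem?, hlen,
    Nat.add_sub_cancel, List.getElem?_eq_getElem (by omega)]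
  exact h

end Nodes

/-! ### The objective functions as sums -/

/-- If the weights `g a` grow by a factor that exceeds the length of the lists, the weight of a
list sorted in decreasing order is governed by the first element that differs. -/
theorem sum_map_lt_of_lt {g : ℚ → ℕ} {K : ℕ} {A : Set ℚ} (hpos : ∀ a, 0 < g a)
    (hg : ∀ a ∈ A, ∀ b ∈ A, a < b → K * g a ≤ g b) :
    ∀ s t : List ℚ, s.length = t.length → s.length < K → (∀ a ∈ s, a ∈ A) → (∀ a ∈ t, a ∈ A) →
      s.Pairwise (· ≥ ·) → s < t → (s.map g).sum < (t.map g).sum := by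
  intro s
  induction s with
  | nil =>
    rintro (_ | ⟨b, t⟩) hlen _ _ _ _ hlt
    · exact absurd hlt (List.not_lt_nil _)
    · simp at hlen
  | cons a s ih =>
    rintro (_ | ⟨b, t⟩) hlen hK hs ht hsort hlt
    · simp at hlen
    rw [List.pairwise_cons] at hsort
    rcases List.cons_lt_cons_iff.1 hlt with hab | ⟨rfl, hlt'⟩
    · have h1 : ∀ x ∈ (a :: s).map g, x ≤ g a := by
        intro x hx
        obtain ⟨y, hy, rfl⟩ := List.mem_map.1 hx
        rcases List.mem_cons.1 hy with rfl | hy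
        · exact le_rfl
        · rcases (hsort.1 y hy).lt_or_eq with h | rfl
          · refine le_trans ?_ (hg y (hs y (by simp [hy])) a (hs a (by simp)) h)
            exact Nat.le_mul_of_pos_left _ (by omega)
          · exact le_rfl
      have h2 := List.sum_le_card_nsmul _ _ h1
      have h3 := hg a (hs a (by simp)) b (ht b (by simp)) hab
      have h4 := Nat.mul_lt_mul_of_pos_right hK (hpos a)
      rw [List.length_map, smul_eq_mul] at h2
      calc ((a :: s).map g).sum ≤ _ := h2
        _ < K * g a := h4
        _ ≤ g b := h3
        _ ≤ _ := by simp
    · simp only [List.map_cons, List.sum_cons]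
      have := ih t (by simpa using hlen) (by simp at hK; omega) (fun x hx => hs x (by simp [hx]))
        (fun x hx => ht x (by simp [hx])) hsort.2 hlt'
      omega

/-- The comparison of score vectors by `leximax` is a comparison of sums. -/
theorem leximax_le_iff {g : ℚ → ℕ} {K : ℕ} {A : Set ℚ} (hpos : ∀ a, 0 < g a)
    (hg : ∀ a ∈ A, ∀ b ∈ A, a < b → K * g a ≤ g b) {s t : List ℚ} (hlen : s.length = t.length)
    (hK : s.length < K) (hs : ∀ a ∈ s, a ∈ A) (ht : ∀ a ∈ t, a ∈ A) :
    Aggregator.leximax.Le s t ↔ (s.map g).sum ≤ (t.map g).sum := by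
  have key : ∀ s t : List ℚ, s.length = t.length → s.length < K → (∀ a ∈ s, a ∈ A) →
      (∀ a ∈ t, a ∈ A) → s.insertionSort (· ≥ ·) < t.insertionSort (· ≥ ·) →
      (s.map g).sum < (t.map g).sum := by
    intro s t hlen hK hs ht hlt
    rw [← ((s.perm_insertionSort (· ≥ ·)).map g).sum_eq,
      ← ((t.perm_insertionSort (· ≥ ·)).map g).sum_eq]
    refine sum_map_lt_of_lt hpos hg _ _ ?_ ?_ ?_ ?_ (List.pairwise_insertionSort _ _) hlt
    · rw [List.length_insertionSort, List.length_insertionSort, hlen]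
    · rwa [List.length_insertionSort]
    · exact fun a ha => hs a ((List.mem_insertionSort _).1 ha)
    · exact fun a ha => ht a ((List.mem_insertionSort _).1 ha)
  change s.insertionSort (· ≥ ·) ≤ t.insertionSort (· ≥ ·) ↔ _
  rcases lt_trichotomy (s.insertionSort (· ≥ ·)) (t.insertionSort (· ≥ ·)) with h | h | h
  · exact iff_of_true (le_of_lt h) (key s t hlen hK hs ht h).le
  · refine iff_of_true (le_of_eq h) (le_of_eq ?_)
    rw [← ((s.perm_insertionSort (· ≥ ·)).map g).sum_eq, h,
      ((t.perm_insertionSort (· ≥ ·)).map g).sum_eq]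
  · exact iff_of_false (not_le_of_gt h) (key t s hlen.symm (hlen ▸ hK) ht hs h).not_ge

theorem powLength_eq (V : List Frac) : powLength V = 2 ^ V.length := by
  suffices h : ∀ (V : List Frac) (a : ℕ), V.foldl (fun a _ => Nat.bit false a) a =
      a * 2 ^ V.length from (h V 1).trans (one_mul _)
  intro V
  induction V with
  | nil => simp
  | cons u V ih => intro a; rw [List.foldl_cons, ih, Nat.bit_val, List.length_cons, pow_succ]; simp; ring

/-- The weight that replaces a score in `lexBase`. -/
def lexWeight (V : List Frac) (q : ℚ) : ℕ :=
  (2 ^ V.length) ^ V.countP fun u => decide (u.val < q)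

theorem rankPow_eq {V : List Frac} (hV : ∀ u ∈ V, 0 < u.2) {v : Frac} (hv : 0 < v.2) :
    rankPow V (powLength V) v = lexWeight V v.val := by
  rw [powLength_eq, lexWeight]
  generalize 2 ^ V.length = K
  suffices h : ∀ a, V.foldl (fun a u => bif v.le u then a else a * K) a =
      a * K ^ V.countP fun u => decide (u.val < v.val) from (h 1).trans (one_mul _)
  induction V with
  | nil => simp
  | cons u V ih =>
    intro a
    have hle := Frac.le_iff hv (hV u (by simp))
    rw [List.foldl_cons, ih fun w hw => hV w (by simp [hw]), List.countP_cons]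
    by_cases h : v.val ≤ u.val
    · rw [hle.2 h]; simp [not_lt.2 h]
    · rw [Bool.eq_false_iff.2 (mt hle.1 h)]; simp [not_le.1 h, pow_succ]; ring

theorem lexWeight_pos (V : List Frac) (q : ℚ) : 0 < lexWeight V q := by
  unfold lexWeight; positivity

theorem lexWeight_le {V : List Frac} {a b : ℚ} (ha : ∃ u ∈ V, u.val = a) (hab : a < b) :
    2 ^ V.length * lexWeight V a ≤ lexWeight V b := by
  unfold lexWeight
  rw [← pow_succ']
  refine Nat.pow_le_pow_right (by positivity) ?_
  obtain ⟨u, hu, rfl⟩ := ha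
  obtain ⟨V₁, V₂, rfl⟩ := List.append_of_mem hu
  rw [List.countP_append, List.countP_append, List.countP_cons, List.countP_cons]
  have h : ∀ V : List Frac, V.countP (fun w => decide (w.val < u.val)) ≤
      V.countP fun w => decide (w.val < b) := fun V =>
    List.countP_mono_left fun w _ hw => by
      simp only [decide_eq_true_eq] at *; exact hw.trans hab
  have h1 := h V₁
  have h2 := h V₂
  simp only [lt_self_iff_false, decide_false, hab, decide_true, if_true]
  simp
  omega

/-- The vector of scores, for weighted literals. -/
def litScores (L : List (Lit n × Frac)) (ω : Interp n) : List ℚ :=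
  L.map fun p => if p.1.val ω then p.2.val else 0

/-- The algorithm compares interpretations as the objective function does. -/
theorem exists_sumBase (agg : Aggregator) {L : List (Lit n × Frac)} (hL : ∀ p ∈ L, 0 < p.2.2) :
    ∃ L' : List (Lit n × Frac), (∀ p ∈ L', 0 < p.2.2) ∧ sumBase agg (entries L) = entries L' ∧
      ∀ ω ω', agg.Le (litScores L ω) (litScores L ω') ↔
        cost (L'.map fun p => (p.1, p.2.val)) ω ≤ cost (L'.map fun p => (p.1, p.2.val)) ω' := by
  cases agg with
  | sum =>
    refine ⟨L, hL, rfl, fun ω ω' => ?_⟩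
    have : ∀ ω, cost (L.map fun p => (p.1, p.2.val)) ω = (litScores L ω).sum := fun ω => by
      rw [cost, litScores, List.map_map]; rfl
    rw [this, this]; rfl
  | leximax =>
    set V : List Frac := .zero :: L.map fun p => p.2 with hVdef
    have hV : ∀ u ∈ V, 0 < u.2 := by
      intro u hu
      rcases List.mem_cons.1 hu with rfl | hu
      · simp [Frac.zero]
      · obtain ⟨p, hp, rfl⟩ := List.mem_map.1 hu
        exact hL p hp
    have hsV : scoreValues (entries L) = V := by simp [scoreValues, entries, hVdef]
    refine ⟨L.map fun p => (p.1, ((lexWeight V p.2.val, lexWeight V 0), 1)), ?_, ?_,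
      fun ω ω' => ?_⟩
    · intro p hp
      obtain ⟨q, -, rfl⟩ := List.mem_map.1 hp
      exact Nat.one_pos
    · change lexBase (entries L) = _
      rw [lexBase, hsV, entries, entries, List.map_map, List.map_map]
      refine List.map_congr_left fun p hp => ?_
      simp only [Function.comp]
      rw [rankPow_eq hV (hL p hp), rankPow_eq hV (by simp [Frac.zero] : 0 < Frac.zero.2),
        Frac.val_zero]
    · have hmem : ∀ ω, ∀ a ∈ litScores L ω, a ∈ {a | ∃ u ∈ V, u.val = a} := by
        intro ω a ha
        obtain ⟨p, hp, rfl⟩ := List.mem_map.1 ha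
        split_ifs
        · exact ⟨p.2, by rw [hVdef]; exact List.mem_cons_of_mem _ (List.mem_map_of_mem hp), rfl⟩
        · exact ⟨.zero, by rw [hVdef]; simp, Frac.val_zero⟩
      have hcost : ∀ (M : List (Lit n × Frac)) (ω : Interp n), cost ((M.map fun p => (p.1,
          (((lexWeight V p.2.val, lexWeight V 0), 1) : Frac))).map
            fun p : Lit n × Frac => (p.1, p.2.val)) ω =
          (((litScores M ω).map (lexWeight V)).sum : ℕ) - M.length * lexWeight V 0 := by
        intro M ω
        induction M with
        | nil => simp [cost, litScores]
        | cons p M ih =>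
          simp only [cost, litScores, List.map_cons, List.sum_cons, List.length_cons] at ih ⊢
          rw [ih]
          generalize p.2.val = q
          cases p.1.val ω <;> simp only [Frac.val, if_true] <;> push_cast <;> simp <;> ring
      rw [leximax_le_iff (K := 2 ^ V.length) (lexWeight_pos V) (fun a ha b _ => lexWeight_le ha)
        (by simp [litScores]) ?_ (hmem ω) (hmem ω'), hcost, hcost, sub_le_sub_iff_right,
        Nat.cast_le]
      refine lt_of_lt_of_le ?_ (Nat.lt_two_pow_self (n := V.length)).le
      simp [litScores, hVdef]

/-! ### Linear weighted bases -/

/-- The literal in a circuit that consists of one. -/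
def litOf (φ : NNF n) : Lit n :=
  match φ.node φ.root with
  | .const b => .const b
  | .lit x b => .var x b
  | _ => .const true

/-- A rational number, as the algorithm reads it. -/
def fracOf (q : ℚ) : Frac :=
  (bif decide (q.num < 0) then (0, q.num.natAbs) else (q.num.natAbs, 0), q.den)

theorem fracOf_val (q : ℚ) : (fracOf q).val = q := by
  conv_rhs => rw [← Rat.num_div_den q]
  unfold fracOf Frac.val
  by_cases h : q.num < 0
  · have : ((q.num.natAbs : ℤ) : ℚ) = -q.num := by rw [Int.ofNat_natAbs_of_nonpos h.le]; simp
    simp only [h, decide_true, cond_true]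
    rw [← Int.cast_natCast q.num.natAbs, this]; simp
  · have : ((q.num.natAbs : ℤ) : ℚ) = q.num := by rw [Int.natAbs_of_nonneg (not_lt.1 h)]
    simp only [h, decide_false, cond_false]
    rw [← Int.cast_natCast q.num.natAbs, this]; simp

/-- The weighted literals of a linear base. -/
def litsOf (B : WeightedBase n) : List (Lit n × Frac) := B.map fun p => (litOf p.1, fracOf p.2)

theorem litsOf_pos (B : WeightedBase n) : ∀ p ∈ litsOf B, 0 < p.2.2 := by
  intro p hp
  obtain ⟨q, -, rfl⟩ := List.mem_map.1 hp
  exact q.2.den_pos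

theorem NNF.IsLiteral.sat_iff {φ : NNF n} (h : φ.IsLiteral) (ω : Interp n) :
    φ.Sat ω ↔ (litOf φ).val ω = true := by
  unfold NNF.Sat litOf
  rcases h with ⟨b, h⟩ | ⟨x, b, h⟩
  · rw [NNF.satAt_const h, h]; simp [Lit.val]
  · rw [NNF.satAt_lit h, h]; simp [Lit.val]

theorem scores_eq {B : WeightedBase n} (hB : B ∈ Linear n) (ω : Interp n) :
    scores B ω = litScores (litsOf B) ω := by
  rw [scores, litScores, litsOf, List.map_map]
  refine List.map_congr_left fun p hp => ?_
  simp only [Function.comp, fracOf_val, (hB p hp).sat_iff]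
  split_ifs <;> simp

/-- A circuit whose root is a leaf has no other node, as all nodes are reached from the root. -/
theorem NNF.IsLiteral.last_eq {φ : NNF n} (h : φ.IsLiteral) : φ.last = 0 := by
  have hch : (φ.node φ.root).children = [] := by
    rcases h with ⟨b, h⟩ | ⟨x, b, h⟩ <;> rw [h] <;> rfl
  rcases (φ.rooted 0).cases_head with h0 | ⟨j, hj, -⟩
  · simpa [Fin.ext_iff] using h0
  · rw [NNF.root] at hch
    rw [hch] at hj
    simp at hj

/-- The answer that is computed from the data read from an instance. -/
noncomputable def answer (agg : Aggregator) (I : Instance) : Option (List Bool) :=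
  let c := mkCtx (sumBase agg (entries (litsOf I.base))) (vars (List.replicate I.n .tick))
  ((table c (nodeItems I.hard)).reverse.headD none).map fun d => c.2.2.zipWith (· ^^ ·) d

/-- The computed answer is correct: the model of the root, found for the sums of the replaced
weights, is optimal for the aggregator. -/
theorem isAnswer_answer (agg : Aggregator) (I : Instance) (hI : I.hard.Decomposable)
    (hB : I.base ∈ Linear I.n) : IsAnswer agg I (answer agg I) := by
  obtain ⟨L', hpos, hL', hle⟩ := exists_sumBase agg (litsOf_pos I.base)
  obtain ⟨ω₀, hc⟩ := mkCtx_good hpos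
  have hspec := spec_root hc hI
  unfold answer
  rw [hL']
  simp only
  cases hr : (table (mkCtx (entries L') (vars (List.replicate I.n .tick)))
      (nodeItems I.hard)).reverse.headD none with
  | none =>
    rw [hr] at hspec
    exact ⟨fun ⟨ω, hω⟩ => absurd hω (hspec ω), fun _ => rfl⟩
  | some d =>
    rw [hr] at hspec
    obtain ⟨d, rfl, hd⟩ := hspec
    refine ⟨fun _ => ⟨_, ⟨hd.sat, fun ω' hω' => ?_⟩, ?_⟩, fun h => absurd ⟨_, hd.sat⟩ h⟩
    · rw [scores_eq hB, scores_eq hB, hle]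
      exact hd.opt ω' hω'
    · rw [Option.map_some, hc.best, zipWith_ofFn]

/-! ### Reading the input -/

/-- The word `l` is divided into the items `its`. -/
def Reads (l : List Sym) (its : List Item) : Prop :=
  ∀ s, l.foldl itemStep (s, []) = (its.reverse ++ s, [])

theorem Reads.append {l l' : List Sym} {its its' : List Item} (h : Reads l its)
    (h' : Reads l' its') : Reads (l ++ l') (its ++ its') := fun s => by
  rw [List.foldl_append, h, h', List.reverse_append, List.append_assoc]

theorem Reads.flatMap {δ : Type} {f : δ → List Sym} {g : δ → List Item} (l : List δ)
    (h : ∀ x ∈ l, Reads (f x) (g x)) : Reads (l.flatMap f) (l.flatMap g) := by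
  induction l with
  | nil => exact fun s => rfl
  | cons x l ih =>
    rw [List.flatMap_cons, List.flatMap_cons]
    exact (h x (by simp)).append (ih fun y hy => h y (by simp [hy]))

theorem Reads.symbol {a : Sym} (h : a ∈ [Sym.close, .minus, .top, .bot, .pos, .neg, .and, .or]) :
    Reads [a] [(a, [])] := fun s => by
  fin_cases h <;> rfl

theorem foldl_itemStep_digits (l : List Sym) (hl : ∀ a ∈ l, a = .tick ∨ a = .bit true ∨ a = .bit false) :
    ∀ (s : List Item) (w : List Sym), l.foldl itemStep (s, w) = (s, l.reverse ++ w) := by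
  induction l with
  | nil => exact fun s w => rfl
  | cons a l ih =>
    intro s w
    have : itemStep (s, w) a = (s, a :: w) := by rcases hl a (by simp) with rfl | rfl | rfl <;> rfl
    rw [List.foldl_cons, this, ih fun b hb => hl b (by simp [hb])]
    simp

theorem foldl_itemStep_index (k : ℕ) (s : List Item) :
    (encodeIndex k).foldl itemStep (s, []) =
      (((s.headD (.sep, [])).1, List.replicate k .tick :: (s.headD (.sep, [])).2) :: s.tail, []) := by
  rw [encodeIndex, List.foldl_append, foldl_itemStep_digits _ (fun a ha => .inl
    (List.eq_of_mem_replicate ha)), List.reverse_replicate, List.append_nil]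
  rfl

theorem foldl_itemStep_children (ks : List ℕ) (a : Sym) (s : List Item) :
    ∀ ws, (ks.flatMap encodeIndex).foldl itemStep ((a, ws) :: s, []) =
      ((a, (ks.reverse.map fun k => List.replicate k .tick) ++ ws) :: s, []) := by
  induction ks with
  | nil => exact fun ws => rfl
  | cons k ks ih =>
    intro ws
    rw [List.flatMap_cons, List.foldl_append, foldl_itemStep_index]
    simp only [List.headD_cons, List.tail_cons]
    rw [ih]
    simp

/-- The items of a node: an internal node is followed by a closing symbol. -/
def nodeTokens {m : ℕ} (nd : Node n m) : List Item :=
  nodeItem nd :: match nd with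
    | .and _ => [(.close, [])]
    | .or _ => [(.close, [])]
    | _ => []

theorem reads_encodeNode {m : ℕ} (nd : Node n m) : Reads (encodeNode nd) (nodeTokens nd) := by
  intro s
  have hcs : ∀ cs : List (Fin m), (cs >>= fun j => pure (j : ℕ)) = cs.map fun j : Fin m => (j : ℕ) :=
    fun cs => by simp [List.map_eq_flatMap]
  rcases nd with (_ | _) | ⟨x, _ | _⟩ | cs | cs
  · rfl
  · rfl
  · exact foldl_itemStep_index x ((.neg, []) :: s)
  · exact foldl_itemStep_index x ((.pos, []) :: s)
  · have := foldl_itemStep_children (cs.map fun j : Fin m => (j : ℕ)) .and s []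
    rw [List.append_nil, ← List.map_reverse, List.map_map] at this
    rw [encodeNode, List.cons_append, List.foldl_cons, List.foldl_append, hcs]
    change List.foldl _ (List.foldl _ ((Sym.and, []) :: s, []) _) _ = _
    rw [this]; rfl
  · have := foldl_itemStep_children (cs.map fun j : Fin m => (j : ℕ)) .or s []
    rw [List.append_nil, ← List.map_reverse, List.map_map] at this
    rw [encodeNode, List.cons_append, List.foldl_cons, List.foldl_append, hcs]
    change List.foldl _ (List.foldl _ ((Sym.or, []) :: s, []) _) _ = _
    rw [this]; rfl

/-- The items of a circuit. -/
def nnfTokens (φ : NNF n) : List Item :=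
  ((List.finRange (φ.last + 1)).flatMap fun i => nodeTokens (φ.node i)) ++ [(.close, [])]

theorem reads_encodeNNF (φ : NNF n) : Reads (encodeNNF φ) (nnfTokens φ) :=
  (Reads.flatMap _ fun i _ => reads_encodeNode (φ.node i)).append (.symbol (by simp))

/-- The word of the binary digits of a number, backwards. -/
def numWord (k : ℕ) : List Sym := ((Computability.encodeNat k).map Sym.bit).reverse

theorem wordVal_numWord (k : ℕ) : wordVal (numWord k) = k := by
  have h : wordVal (numWord k) = ofDigits (Computability.encodeNat k).reverse := by
    rw [wordVal, numWord, ← List.map_reverse, List.map_map]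
    congr 1
    conv_rhs => rw [← List.map_id (Computability.encodeNat k).reverse]
    refine List.map_congr_left fun b _ => ?_
    cases b <;> rfl
  have hp : ∀ p : PosNum, ofDigits (Computability.encodePosNum p).reverse = (p : ℕ) := by
    intro p
    induction p with
    | one => rfl
    | bit0 p ih =>
      rw [Computability.encodePosNum, List.reverse_cons, ofDigits, List.foldl_append]
      rw [ofDigits] at ih
      rw [ih, PosNum.cast_bit0]
      simp [Nat.bit_val]; ring
    | bit1 p ih =>
      rw [Computability.encodePosNum, List.reverse_cons, ofDigits, List.foldl_append]
      rw [ofDigits] at ih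
      rw [ih, PosNum.cast_bit1]
      simp [Nat.bit_val]; ring
  rw [h, Computability.encodeNat]
  conv_rhs => rw [← Num.to_of_nat k]
  cases (k : Num) with
  | zero => rfl
  | pos p => exact hp p

/-- The items of a weight. -/
def weightTokens (q : ℚ) : List Item :=
  (if q.num < 0 then [(.minus, [])] else []) ++
    [(.slash, [numWord q.den, numWord q.num.natAbs])]

theorem reads_encodeWeight (q : ℚ) : Reads (encodeWeight q) (weightTokens q) := by
  have hd : ∀ k, ∀ a ∈ (Computability.encodeNat k).map Sym.bit,
      a = .tick ∨ a = .bit true ∨ a = .bit false := by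
    intro k a ha
    obtain ⟨b, -, rfl⟩ := List.mem_map.1 ha
    cases b <;> simp
  have h : Reads ((Computability.encodeNat q.num.natAbs).map Sym.bit ++ [Sym.slash] ++
      (Computability.encodeNat q.den).map Sym.bit ++ [Sym.sep])
      [(.slash, [numWord q.den, numWord q.num.natAbs])] := by
    intro s
    rw [List.foldl_append, List.foldl_append, List.foldl_append,
      foldl_itemStep_digits ((Computability.encodeNat q.num.natAbs).map Sym.bit) (hd _),
      List.append_nil]
    change List.foldl _ (List.foldl _ ((Sym.slash, [numWord q.num.natAbs]) :: s, []) _) _ = _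
    rw [foldl_itemStep_digits _ (hd _), List.append_nil]
    rfl
  have h' : Reads (if q.num < 0 then [Sym.minus] else [])
      (if q.num < 0 then [(.minus, [])] else []) := by
    split_ifs
    · exact .symbol (by simp)
    · exact fun s => rfl
  simpa [encodeWeight, weightTokens] using h'.append h

theorem items_encodeInstance (I : Instance) : items (encodeInstance I) =
    (.sep, [List.replicate I.n .tick]) ::
      (nnfTokens I.hard ++ I.base.flatMap fun p => nnfTokens p.1 ++ weightTokens p.2) := by
  have h := (reads_encodeNNF I.hard).append (Reads.flatMap
    (f := fun p : NNF I.n × ℚ => encodeNNF p.1 ++ encodeWeight p.2) I.base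
      fun p _ => (reads_encodeNNF p.1).append (reads_encodeWeight p.2))
  rw [items, encodeInstance, List.append_assoc, List.foldl_append, foldl_itemStep_index, h]
  simp

theorem foldl_readStep_node {m : ℕ} (nd : Node n m) (ns : List Item)
    (r : (Item × Bool) × List Entry) : (nodeTokens nd).foldl readStep ((false, false), ns, r) =
      ((false, false), nodeItem nd :: ns, r) := by
  rcases nd with (_ | _) | ⟨x, _ | _⟩ | cs | cs <;> rfl

theorem foldl_readStep_nnf (φ : NNF n) (r : (Item × Bool) × List Entry) :
    (nnfTokens φ).foldl readStep ((false, false), [], r) =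
      ((false, true), (nodeItems φ).reverse, r) := by
  have h : ∀ (l : List (Fin (φ.last + 1))) (ns : List Item),
      (l.flatMap fun i => nodeTokens (φ.node i)).foldl readStep ((false, false), ns, r) =
        ((false, false), (l.map fun i => nodeItem (φ.node i)).reverse ++ ns, r) := by
    intro l
    induction l with
    | nil => exact fun ns => rfl
    | cons i l ih =>
      intro ns
      rw [List.flatMap_cons, List.foldl_append, foldl_readStep_node, ih]
      simp
  rw [nnfTokens, List.foldl_append, h, List.append_nil, nodeItems, List.ofFn_eq_map]
  rfl

theorem nnfTokens_literal {φ : NNF n} (h : φ.IsLiteral) :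
    nnfTokens φ = [(litOf φ).item, (.close, [])] := by
  have h0 := h.last_eq
  obtain ⟨last, node, _, _, _, _⟩ := φ
  dsimp only at h0
  subst h0
  rcases h with ⟨b, h⟩ | ⟨x, b, h⟩ <;>
  · simp only [NNF.root] at h
    have h' : node 0 = _ := h
    simp [nnfTokens, litOf, NNF.root, List.finRange_succ, h', nodeTokens, nodeItem]

theorem foldl_readStep_entry {φ : NNF n} (h : φ.IsLiteral) (q : ℚ) (ns : List Item)
    (B : List Entry) :
    (nnfTokens φ ++ weightTokens q).foldl readStep
        ((false, true), ns, ((.top, []), false), B) =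
      ((false, true), ns, ((.top, []), false), ((litOf φ).item, fracOf q) :: B) := by
  have hw : ∀ b, weightOf b [numWord q.den, numWord q.num.natAbs] =
      (bif b then (0, q.num.natAbs) else (q.num.natAbs, 0), q.den) := fun b => by
    simp [weightOf, wordVal_numWord]
  have hlit : (nnfTokens φ).foldl readStep ((false, true), ns, ((.top, []), false), B) =
      ((false, true), ns, ((litOf φ).item, false), B) := by
    rw [nnfTokens_literal h]
    rcases litOf φ with (_ | _) | ⟨x, _ | _⟩ <;> rfl
  rw [List.foldl_append, hlit, weightTokens, fracOf]
  by_cases hq : q.num < 0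
  · rw [if_pos hq, decide_eq_true hq, ← hw]; rfl
  · rw [if_neg hq, decide_eq_false hq, ← hw]; rfl

theorem foldl_readStep_base {B : WeightedBase n} (hB : B ∈ Linear n) (ns : List Item) :
    ∀ E : List Entry, (B.flatMap fun p => nnfTokens p.1 ++ weightTokens p.2).foldl readStep
      ((false, true), ns, ((.top, []), false), E) =
      ((false, true), ns, ((.top, []), false), (entries (litsOf B)).reverse ++ E) := by
  induction B with
  | nil => exact fun E => rfl
  | cons p B ih =>
    intro E
    rw [List.flatMap_cons, List.foldl_append, foldl_readStep_entry (hB p (by simp)),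
      ih fun q hq => hB q (by simp [hq])]
    simp [entries, litsOf]

/-- The algorithm computes the answer. -/
theorem solveItems_encodeInstance (agg : Aggregator) {I : Instance} (hB : I.base ∈ Linear I.n) :
    solveItems agg (items (encodeInstance I)) = encodeAnswer (answer agg I) := by
  have hread : (nnfTokens I.hard ++ I.base.flatMap fun p => nnfTokens p.1 ++ weightTokens p.2).foldl
      readStep readInit = ((false, true), (nodeItems I.hard).reverse, ((.top, []), false),
        (entries (litsOf I.base)).reverse) := by
    rw [List.foldl_append, readInit, foldl_readStep_nnf, foldl_readStep_base hB, List.append_nil]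
  rw [items_encodeInstance, solveItems, List.tail_cons, hread]
  simp only [List.headD_cons, List.reverse_reverse, answer, answerOf]
  cases (table (mkCtx (sumBase agg (entries (litsOf I.base))) (vars (List.replicate I.n .tick)))
    (nodeItems I.hard)).reverse.headD none <;> rfl

/-! ### The optimization problems -/

theorem optInP_of_subset (agg : Aggregator) (L : Language) (hL : ∀ n, L n ⊆ DNNF n) :
    OPTinP L Linear agg :=
  ⟨fun I => answer agg I.1, fun I => isAnswer_answer agg I.1 (hL _ I.2.1) I.2.2,
    (PolyTime.solveRev agg).computable fun I => by
      rw [solveRev, List.reverse_reverse, List.reverse_reverse,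
        solveItems_encodeInstance agg I.2.2]⟩

theorem DNF_subset (n : ℕ) : DNF n ⊆ DNNF n := fun _ h i cs hi => (h.2 i cs hi).2

end

end OptNNF



theorem mainTheorem1 (agg : OptNNF.Aggregator) :
    OptNNF.OPTinP OptNNF.DNNF OptNNF.Linear agg ∧
    (∀ L : OptNNF.Language, (∀ n : ℕ, L n ⊆ OptNNF.DNNF n) →
      OptNNF.OPTinP L OptNNF.Linear agg) ∧
    OptNNF.OPTinP OptNNF.DNF OptNNF.Linear agg ∧
    OptNNF.OPTinP OptNNF.IP OptNNF.Linear agg ∧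
    OptNNF.OPTinP OptNNF.MODS OptNNF.Linear agg ∧
    OptNNF.OPTinP OptNNF.dDNNF OptNNF.Linear agg ∧
    OptNNF.OPTinP OptNNF.FBDD OptNNF.Linear agg ∧
    OptNNF.OPTinP OptNNF.OBDD OptNNF.Linear agg ∧
    (∀ rank : (n : ℕ) → Equiv.Perm (Fin n),
      OptNNF.OPTinP (OptNNF.OBDDlt rank) OptNNF.Linear agg) ∧
    OptNNF.OPTinP OptNNF.SDNNF OptNNF.Linear agg ∧
    (∀ (m : ℕ) (T : OptNNF.VTree m),
      OptNNF.OPTinP (OptNNF.DNNFT T) OptNNF.Linear agg) := by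
  have h := OptNNF.optInP_of_subset agg
  exact ⟨h _ fun _ => subset_rfl, h, h _ OptNNF.DNF_subset,
    h _ fun n _ hφ => OptNNF.DNF_subset n hφ.1, h _ fun n _ hφ => OptNNF.DNF_subset n hφ.1,
    h _ fun _ _ hφ => hφ.1, h _ fun _ _ hφ => hφ.2, h _ fun _ _ hφ => hφ.1.2,
    fun _ => h _ fun _ _ hφ => hφ.1.2, h _ fun _ _ hφ => hφ.1, fun _ _ => h _ fun _ _ hφ => hφ.1⟩
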